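/- Let $n\ge 1$. A bounded domain in $\mathbb R^n$ is a nonempty, connected, bounded open set $\Omega\subseteq\mathbb R^n$; $|\cdot|$ is Lebesgue measure, $\mathcal H^{n-1}$ is $(n-1)$-dimensional Hausdorff measure and $\delta_\Omega(x)=\operatorname{dist}(x,\partial\Omega)$. Let $u$ denote the (weak) solution of the Saint Venant problem $$u\in W^{1,2}_0(\Omega),\qquad \Delta u=-1\ \text{ in }\Omega .$$ The upper $\gamma$-dimensional Minkowski content of $\partial\Omega$ with respect to $\Omega$ is $M^*_\gamma(\partial\Omega)=\limsup_{r\to0^+} r^{-(n-\gamma)}\,|\{x\in\Omega:\delta_\Omega(x)<r\}|$. A set $\Sigma\subseteq\mathbb R^n$ is Ahlfors regular if there are $C_0,C_1,\rho\in(0,\infty)$ such that $$C_0r^{n-1}\le\mathcal H^{n-1}(B(x,r)\cap\Sigma)\le C_1r^{n-1}\qquad\text{for all }x\in\Sigma,\ r\in(0,\rho).$$ (i) If $\Omega\subseteq\mathbb R^n$ is a bounded domain and $M^*_\gamma(\partial\Omega)<\infty$ for some real $\gamma<n$, then $\int_\Omega u^{-\beta}\,dx<\infty$ for every $\beta\in(0,(n-\gamma)/2)$.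 (ii) If $\Omega\subseteq\mathbb R^n$ is a bounded domain whose boundary is Ahlfors regular, then $\int_\Omega u^{-\beta}\,dx<\infty$ for every $\beta\in(0,1/2)$. Moreover, for every $\beta\in(0,1/2)$ and all $C_0,C_1,R\in(0,\infty)$ there is a finite constant $C$, depending only on $n,\beta,C_0,C_1,R$, such that for every bounded domain $\Omega\subseteq\mathbb R^n$ whose boundary satisfies the Ahlfors condition above with the constants $C_0,C_1$ and $\rho=R\operatorname{diam}(\Omega)$, $$\int_\Omega u^{-\beta}\,dx\le C\,|\Omega|^{1-2\beta}\,\mathcal H^{n-1}(\partial\Omega)^{2\beta}\qquad\text{and}\qquad |\Omega|^{1-2\beta}\,\mathcal H^{n-1}(\partial\Omega)^{2\beta}\le C\operatorname{diam}(\Omega)^{n-2\beta}.$$ (iii) For every $\beta\in(1/2,1)$ there is a bounded domain $\Omega\subseteq\mathbb R^2$ which is regular for the Dirichlet problem (for each continuous $f$ on $\partial\Omega$ there is exactly one function continuous on $\overline\Omega$, harmonic in $\Omega$ and equal to $f$ on $\partial\Omega$), whose boundary is Ahlfors regular, and for which $\int_\Omega u^{-\beta}\,dx=\infty$. -/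

import Mathlib

open MeasureTheory Filter Topology Set
open scoped ENNReal NNReal ContDiff Gradient

namespace SaintVenant

/-- A bounded domain of `ℝⁿ`: a nonempty, connected, bounded open set. -/
structure IsBoundedDomain {n : ℕ} (Ω : Set (EuclideanSpace ℝ (Fin n))) : Prop where
  isOpen : IsOpen Ω
  isConnected : IsConnected Ω
  isBounded : Bornology.IsBounded Ω

/-- The space `C₀^∞(Ω)` of smooth functions with compact support contained in `Ω`. -/
structure IsTestFunction {n : ℕ} (Ω : Set (EuclideanSpace ℝ (Fin n)))
    (φ : EuclideanSpace ℝ (Fin n) → ℝ) : Prop where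
  contDiff : ContDiff ℝ ∞ φ
  hasCompactSupport : HasCompactSupport φ
  tsupport_subset : tsupport φ ⊆ Ω

/-- `u` belongs to the Sobolev space `W^{1,2}(Ω)` and its weak gradient is `G`. -/
structure MemW12 {n : ℕ} (Ω : Set (EuclideanSpace ℝ (Fin n)))
    (u : EuclideanSpace ℝ (Fin n) → ℝ)
    (G : EuclideanSpace ℝ (Fin n) → EuclideanSpace ℝ (Fin n)) : Prop where
  memLp : MemLp u 2 (volume.restrict Ω)
  memLp_grad : MemLp G 2 (volume.restrict Ω)
  weak_grad : ∀ φ, IsTestFunction Ω φ → ∀ v : EuclideanSpace ℝ (Fin n),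
    ∫ x in Ω, u x * fderiv ℝ φ x v = - ∫ x in Ω, inner ℝ (G x) v * φ x

/-- `u` belongs to `W₀^{1,2}(Ω)`, the closure of `C₀^∞(Ω)` in `W^{1,2}(Ω)`, and its weak gradient
is `G`. -/
structure MemW12Zero {n : ℕ} (Ω : Set (EuclideanSpace ℝ (Fin n)))
    (u : EuclideanSpace ℝ (Fin n) → ℝ)
    (G : EuclideanSpace ℝ (Fin n) → EuclideanSpace ℝ (Fin n)) : Prop extends MemW12 Ω u G where
  approx : ∃ φ : ℕ → EuclideanSpace ℝ (Fin n) → ℝ, (∀ k, IsTestFunction Ω (φ k)) ∧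
    Tendsto (fun k => eLpNorm (fun x => φ k x - u x) 2 (volume.restrict Ω)) atTop (𝓝 0) ∧
    Tendsto (fun k => eLpNorm (fun x => ∇ (φ k) x - G x) 2 (volume.restrict Ω)) atTop (𝓝 0)

/-- `u` is the (weak) solution of the Saint Venant problem
`u ∈ W₀^{1,2}(Ω)`, `Δu = -1` in `Ω`. Only the values of `u` on `Ω` matter. -/
def IsSolution {n : ℕ} (Ω : Set (EuclideanSpace ℝ (Fin n)))
    (u : EuclideanSpace ℝ (Fin n) → ℝ) : Prop :=
  ∃ G : EuclideanSpace ℝ (Fin n) → EuclideanSpace ℝ (Fin n), MemW12Zero Ω u G ∧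
    ∀ φ, IsTestFunction Ω φ → ∫ x in Ω, inner ℝ (G x) (∇ φ x) = ∫ x in Ω, φ x

/-- The `β`-integral `∫_Ω u^{-β} dx ∈ [0, ∞]`. -/
noncomputable def betaIntegral {n : ℕ} (Ω : Set (EuclideanSpace ℝ (Fin n)))
    (u : EuclideanSpace ℝ (Fin n) → ℝ) (β : ℝ) : ℝ≥0∞ :=
  ∫⁻ x in Ω, (ENNReal.ofReal (u x)) ^ (-β)

/-- The upper `γ`-dimensional Minkowski content of `∂Ω` with respect to `Ω`:
`limsup_{r → 0⁺} |{x ∈ Ω : dist(x, ∂Ω) < r}| / r^{n-γ}`. -/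
noncomputable def upperMinkowskiContent {n : ℕ} (Ω : Set (EuclideanSpace ℝ (Fin n)))
    (γ : ℝ) : ℝ≥0∞ :=
  limsup (fun r : ℝ => volume {x ∈ Ω | Metric.infDist x (frontier Ω) < r} /
    ENNReal.ofReal (r ^ ((n : ℝ) - γ))) (𝓝[>] 0)

/-- `(n-1)`-dimensional Hausdorff measure on `ℝⁿ` for the Euclidean metric (it is a multiple,
by a positive constant depending only on `n`, of the one normalised to agree with surface
measure). -/
noncomputable def surfaceMeasure (n : ℕ) : Measure (EuclideanSpace ℝ (Fin n)) :=
  Measure.hausdorffMeasure ((n : ℝ) - 1)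

/-- The Ahlfors regularity condition with constants `C₀`, `C₁` up to the scale `R`:
`C₀ r^{n-1} ≤ 𝓗^{n-1}(B(x, r) ∩ S) ≤ C₁ r^{n-1}` for all `x ∈ S` and `0 < r < R`. -/
def IsAhlforsRegularWith {n : ℕ} (S : Set (EuclideanSpace ℝ (Fin n))) (C₀ C₁ R : ℝ) : Prop :=
  ∀ x ∈ S, ∀ r : ℝ, 0 < r → r < R →
    ENNReal.ofReal (C₀ * r ^ ((n : ℝ) - 1)) ≤ surfaceMeasure n (Metric.ball x r ∩ S) ∧
    surfaceMeasure n (Metric.ball x r ∩ S) ≤ ENNReal.ofReal (C₁ * r ^ ((n : ℝ) - 1))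

/-- Ahlfors regular sets. -/
def IsAhlforsRegular {n : ℕ} (S : Set (EuclideanSpace ℝ (Fin n))) : Prop :=
  ∃ C₀ C₁ R : ℝ, 0 < C₀ ∧ 0 < C₁ ∧ 0 < R ∧ IsAhlforsRegularWith S C₀ C₁ R

/-- `h` is a classical solution of the Dirichlet problem in `Ω` with boundary datum `f`. -/
structure IsDirichletSolution {n : ℕ} (Ω : Set (EuclideanSpace ℝ (Fin n)))
    (f h : EuclideanSpace ℝ (Fin n) → ℝ) : Prop where
  continuousOn : ContinuousOn h (closure Ω)
  harmonic : InnerProductSpace.HarmonicOnNhd h Ω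
  boundary : EqOn h f (frontier Ω)

/-- `Ω` is regular for the Dirichlet problem: for every continuous boundary datum the classical
Dirichlet problem has one and only one solution continuous on the closure of `Ω`. -/
def IsDirichletRegular {n : ℕ} (Ω : Set (EuclideanSpace ℝ (Fin n))) : Prop :=
  ∀ f : EuclideanSpace ℝ (Fin n) → ℝ, ContinuousOn f (frontier Ω) →
    ∃ h, IsDirichletSolution Ω f h ∧
      ∀ h', IsDirichletSolution Ω f h' → EqOn h' h (closure Ω)

end SaintVenant

/-! Everything rests on the weak comparison principle `ae_comparison`, applied to two explicit
polynomials. Its proof never truncates a Sobolev function: `u` is replaced by the test functions `φ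
k` approximating it, the difference from the barrier is passed through the smooth positive part
`smoothPos`, and the resulting test functions tend to zero by an energy estimate and Friedrichs'
inequality.

Parts (i) and (ii): the torsion function `(r² - |x - q|²) / 2n` of a ball inside `Ω` lies below `u`,
so `u ≥ δ² / 16n` with `δ` the distance to the boundary (`ae_infDist_sq_le`). Hence `u^{-β}` is at
most a multiple of `δ^{-2β}`, whose integral is controlled by the volumes of the layers `{δ < r}`
through a dyadic decomposition (`lintegral_rpow_neg_le`): a layer bound `A r^a` suffices when `2β <
a`. Finite Minkowski content is such a bound with `a = n - γ`. For an Ahlfors regular boundary a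
Vitali covering by boundary balls gives `a = 1` and `A` proportional to the surface measure
(`volume_layer_le`); optimising the dyadic cut-off produces the product of powers of volume and
surface measure. A second Vitali covering bounds the surface measure by the diameter, which gives
the other inequality.

Part (iii): in a plane domain with a cusp `|y| ≲ x^{m+1}`, the supersolution `K x^{2m+2} - y²` lies
above `u`. A box of size `x` by `x^{m+1}` near the tip therefore contributes at least a multiple of
`x^{m+2-(2m+2)β}`, and for `m` large this exponent is negative, so boxes tending to the tip force
the integral to be infinite. The domain is the image of a half strip under `w ↦ w^{-1/m}`, which
makes the rest explicit: `w = z^{-m}`, a translate of `sinh` and a Cayley transform carry it into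
the disc, continuously up to the boundary and injectively there, so the Poisson integral solves the
Dirichlet problem; the boundary consists of three arcs with bi-Lipschitz coordinates and the tip,
whence the upper Ahlfors bound, and it is connected, whence the lower one. -/

namespace SaintVenant

/-! ### A smooth positive part. -/

/-- A smooth substitute for the positive part: it vanishes on `(-∞, 0]`, is positive on `(0, ∞)`
and has derivative in `[0, 1]`. -/
noncomputable def smoothPos (s : ℝ) : ℝ := ∫ t in (0 : ℝ)..s, Real.smoothTransition t

theorem hasDerivAt_smoothPos (s : ℝ) : HasDerivAt smoothPos (Real.smoothTransition s) s :=
  intervalIntegral.integral_hasDerivAt_right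
    (Real.smoothTransition.continuous.intervalIntegrable _ _)
    (Real.smoothTransition.continuous.stronglyMeasurableAtFilter _ _)
    Real.smoothTransition.continuousAt

theorem deriv_smoothPos : deriv smoothPos = Real.smoothTransition :=
  funext fun s => (hasDerivAt_smoothPos s).deriv

theorem contDiff_smoothPos : ContDiff ℝ ∞ smoothPos := by
  rw [contDiff_infty_iff_deriv, deriv_smoothPos]
  exact ⟨fun s => (hasDerivAt_smoothPos s).differentiableAt, Real.smoothTransition.contDiff⟩

theorem smoothPos_of_nonpos {s : ℝ} (hs : s ≤ 0) : smoothPos s = 0 := by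
  rw [smoothPos, intervalIntegral.integral_congr (g := fun _ => 0)]
  · simp
  · intro t ht
    rw [uIcc_of_ge hs] at ht
    exact Real.smoothTransition.zero_of_nonpos ht.2

theorem smoothPos_pos {s : ℝ} (hs : 0 < s) : 0 < smoothPos s :=
  intervalIntegral.intervalIntegral_pos_of_pos_on
    (Real.smoothTransition.continuous.intervalIntegrable _ _)
    (fun _ hx => Real.smoothTransition.pos_of_pos hx.1) hs

theorem smoothPos_nonneg (s : ℝ) : 0 ≤ smoothPos s := by
  rcases le_or_gt s 0 with h | h
  · exact (smoothPos_of_nonpos h).ge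
  · exact (smoothPos_pos h).le

theorem lipschitzWith_smoothPos : LipschitzWith 1 smoothPos := by
  apply lipschitzWith_of_nnnorm_deriv_le (fun s => (hasDerivAt_smoothPos s).differentiableAt)
  intro s
  rw [deriv_smoothPos, ← NNReal.coe_le_coe, coe_nnnorm, Real.norm_of_nonneg
    (Real.smoothTransition.nonneg s)]
  exact Real.smoothTransition.le_one s

/-! ### Integration by parts and Friedrichs' inequality. -/

variable {n : ℕ}

theorem continuous_gradient {ψ : EuclideanSpace ℝ (Fin n) → ℝ} (hψ : ContDiff ℝ 1 ψ) :
    Continuous (∇ ψ) :=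
  (InnerProductSpace.toDual ℝ _).symm.continuous.comp (hψ.continuous_fderiv one_ne_zero)

theorem hasCompactSupport_gradient {ψ : EuclideanSpace ℝ (Fin n) → ℝ}
    (hc : HasCompactSupport ψ) : HasCompactSupport (∇ ψ) :=
  (hc.fderiv (𝕜 := ℝ)).comp_left (g := (InnerProductSpace.toDual ℝ _).symm) (map_zero _)

/-- Integration by parts against a compactly supported function. -/
theorem integral_mul_fderiv_eq_neg {f g : EuclideanSpace ℝ (Fin n) → ℝ} (hf : ContDiff ℝ 1 f)
    (hg : ContDiff ℝ 1 g) (hc : HasCompactSupport g) (v : EuclideanSpace ℝ (Fin n)) :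
    ∫ x, f x * fderiv ℝ g x v = - ∫ x, fderiv ℝ f x v * g x := by
  have hfc : Continuous fun x => fderiv ℝ f x v :=
    (hf.continuous_fderiv one_ne_zero).clm_apply continuous_const
  have hgc : Continuous fun x => fderiv ℝ g x v :=
    (hg.continuous_fderiv one_ne_zero).clm_apply continuous_const
  exact integral_bilinear_fderiv_right_eq_neg_left_of_integrable
    (B := ContinuousLinearMap.mul ℝ ℝ)
    ((hfc.mul hg.continuous).integrable_of_hasCompactSupport hc.mul_left)
    ((hf.continuous.mul hgc).integrable_of_hasCompactSupport
      (hc.fderiv_apply (𝕜 := ℝ) v).mul_left)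
    ((hf.continuous.mul hg.continuous).integrable_of_hasCompactSupport hc.mul_left)
    (fun x _ => hf.differentiable one_ne_zero x) (fun x _ => hg.differentiable one_ne_zero x)

theorem fderiv_single_le_norm_gradient (i : Fin n) {ψ : EuclideanSpace ℝ (Fin n) → ℝ}
    (x : EuclideanSpace ℝ (Fin n)) :
    |fderiv ℝ ψ x (EuclideanSpace.single i 1)| ≤ ‖∇ ψ x‖ := by
  rw [← inner_gradient_left]
  refine (abs_real_inner_le_norm _ _).trans ?_
  simp

theorem integrable_norm_gradient_sq 
    {ψ : EuclideanSpace ℝ (Fin n) → ℝ} (hψ : ContDiff ℝ 1 ψ) (hc : HasCompactSupport ψ) :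
    Integrable (fun x : EuclideanSpace ℝ (Fin n) => ‖∇ ψ x‖ ^ 2) volume := by
  have hgc := continuous_gradient hψ
  apply Continuous.integrable_of_hasCompactSupport
  · exact hgc.norm.pow 2
  · refine (hasCompactSupport_gradient hc).mono fun x hx => ?_
    contrapose! hx
    simp only [Function.mem_support, ne_eq, not_not] at hx ⊢
    rw [hx]
    simp

/-- Friedrichs' inequality for smooth functions supported in a ball. -/
theorem integral_sq_le_integral_norm_gradient_sq (i : Fin n)
    {ψ : EuclideanSpace ℝ (Fin n) → ℝ} (hψ : ContDiff ℝ 1 ψ) (hc : HasCompactSupport ψ)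
    {R : ℝ} (hR : tsupport ψ ⊆ Metric.closedBall 0 R) :
    ∫ x, ψ x ^ 2 ≤ 4 * R ^ 2 * ∫ x, ‖∇ ψ x‖ ^ 2 := by
  have hψd : Differentiable ℝ ψ := hψ.differentiable one_ne_zero
  have hfc : Continuous fun x => fderiv ℝ ψ x (EuclideanSpace.single i 1) :=
    (hψ.continuous_fderiv one_ne_zero).clm_apply continuous_const
  have hcf : HasCompactSupport fun x => fderiv ℝ ψ x (EuclideanSpace.single i 1) :=
    hc.fderiv_apply (𝕜 := ℝ) _
  have hpc : ContDiff ℝ 1 fun x : EuclideanSpace ℝ (Fin n) => x i :=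
    (EuclideanSpace.proj i : _ →L[ℝ] ℝ).contDiff
  have hfd : ∀ x : EuclideanSpace ℝ (Fin n),
      fderiv ℝ (fun x : EuclideanSpace ℝ (Fin n) => x i) x (EuclideanSpace.single i 1) = 1 := by
    intro x
    have : HasFDerivAt (fun x : EuclideanSpace ℝ (Fin n) => x i)
      (EuclideanSpace.proj i : _ →L[ℝ] ℝ) x := (EuclideanSpace.proj i : _ →L[ℝ] ℝ).hasFDerivAt
    rw [this.fderiv]
    simp
  have hsq : ∀ x v, fderiv ℝ (fun x => ψ x ^ 2) x v = (2 * ψ x) * fderiv ℝ ψ x v := by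
    intro x v
    have := ((hψd x).hasFDerivAt.pow 2).fderiv
    rw [this]
    simp
  have hc2 : HasCompactSupport fun x => ψ x ^ 2 := hc.comp_left (g := fun t : ℝ => t ^ 2) (by simp)
  have hI2 : Integrable fun x => ψ x ^ 2 :=
    (hψ.continuous.pow 2).integrable_of_hasCompactSupport hc2
  have hIg := integrable_norm_gradient_sq hψ hc
  have hIm : Integrable fun x => x i * ((2 * ψ x) * fderiv ℝ ψ x (EuclideanSpace.single i 1)) := by
    apply Continuous.integrable_of_hasCompactSupport
    · exact hpc.continuous.mul ((continuous_const.mul hψ.continuous).mul hfc)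
    · apply HasCompactSupport.mul_left
      exact hcf.mul_left
  have key := integral_mul_fderiv_eq_neg hpc (hψ.pow 2) hc2 (EuclideanSpace.single i 1)
  simp only [hfd, hsq, one_mul] at key
  -- By `key`, the integral of `ψ²` is that of `-2 xᵢ ψ ∂ᵢψ`. Young's inequality is weighted so that
  -- half of `ψ²` can be absorbed on the left, whence the constant `4 R²`.
  have hle : ∫ x, -(x i * ((2 * ψ x) * fderiv ℝ ψ x (EuclideanSpace.single i 1))) ≤
      ∫ x, (1 / 2 * ψ x ^ 2 + 2 * R ^ 2 * ‖∇ ψ x‖ ^ 2) := by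
    apply integral_mono hIm.neg ((hI2.const_mul _).add (hIg.const_mul _))
    intro x
    by_cases hx : x ∈ tsupport ψ
    · have hxR : ‖x‖ ≤ R := by simpa using hR hx
      have h1 : |x i| ≤ R := (PiLp.norm_apply_le x i).trans hxR
      have h2 := fderiv_single_le_norm_gradient i (ψ := ψ) x
      have h3 : (x i * fderiv ℝ ψ x (EuclideanSpace.single i 1)) ^ 2 ≤ R ^ 2 * ‖∇ ψ x‖ ^ 2 := by
        rw [← mul_pow, sq_le_sq, abs_mul]
        exact (mul_le_mul h1 h2 (abs_nonneg _) ((abs_nonneg _).trans h1)).trans (le_abs_self _)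
      have h4 := sq_nonneg (ψ x + 2 * (x i * fderiv ℝ ψ x (EuclideanSpace.single i 1)))
      simp only [Pi.neg_apply, Pi.add_apply]
      linarith
    · have h0 : ψ x = 0 := image_eq_zero_of_notMem_tsupport hx
      have h1 : 0 ≤ 2 * R ^ 2 * ‖∇ ψ x‖ ^ 2 := by positivity
      simpa [h0] using h1
  rw [integral_add (hI2.const_mul _) (hIg.const_mul _), integral_const_mul, integral_const_mul,
    integral_neg, key, neg_neg] at hle
  linarith


/-! ### The weak comparison principle. -/

theorem eLpNorm_two_eq_sqrt {α E : Type*} {m : MeasurableSpace α} {μ : Measure α}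
    [NormedAddCommGroup E] {f : α → E} (hf : MemLp f 2 μ) :
    eLpNorm f 2 μ = ENNReal.ofReal (√(∫ a, ‖f a‖ ^ 2 ∂μ)) := by
  rw [hf.eLpNorm_eq_integral_rpow_norm (by norm_num) (by norm_num), Real.sqrt_eq_rpow]
  norm_num

theorem integrable_inner_of_memLp {α E : Type*} {m : MeasurableSpace α} {μ : Measure α}
    [NormedAddCommGroup E] [InnerProductSpace ℝ E] {f g : α → E} (hf : MemLp f 2 μ)
    (hg : MemLp g 2 μ) : Integrable (fun a => inner ℝ (f a) (g a)) μ := by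
  have h1 : Integrable (fun a => ‖f a‖ ^ 2 + ‖g a‖ ^ 2) μ :=
    (MemLp.integrable_norm_pow (p := 2) (by exact_mod_cast hf) two_ne_zero).add
      (MemLp.integrable_norm_pow (p := 2) (by exact_mod_cast hg) two_ne_zero)
  refine h1.mono' (hf.1.inner hg.1) (Eventually.of_forall fun a => ?_)
  refine (norm_inner_le_norm _ _).trans ?_
  nlinarith [sq_nonneg (‖f a‖ - ‖g a‖), sq_nonneg (‖f a‖), sq_nonneg (‖g a‖)]

variable {n : ℕ}

theorem IsTestFunction.memLp_gradient {Ω : Set (EuclideanSpace ℝ (Fin n))}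
    {φ : EuclideanSpace ℝ (Fin n) → ℝ} (hφ : IsTestFunction Ω φ)
    (μ : Measure (EuclideanSpace ℝ (Fin n))) [IsFiniteMeasureOnCompacts μ] : MemLp (∇ φ) 2 μ :=
  (continuous_gradient (hφ.contDiff.of_le (by simp))).memLp_of_hasCompactSupport
    (hasCompactSupport_gradient hφ.hasCompactSupport)

theorem IsTestFunction.memLp {Ω : Set (EuclideanSpace ℝ (Fin n))}
    {φ : EuclideanSpace ℝ (Fin n) → ℝ} (hφ : IsTestFunction Ω φ)
    (μ : Measure (EuclideanSpace ℝ (Fin n))) [IsFiniteMeasureOnCompacts μ] : MemLp φ 2 μ :=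
  hφ.contDiff.continuous.memLp_of_hasCompactSupport hφ.hasCompactSupport

/-- A smooth function on an open set vanishing off a compact subset extends by zero. -/
theorem isTestFunction_indicator {Ω L : Set (EuclideanSpace ℝ (Fin n))} (hΩ : IsOpen Ω)
    (hL : IsCompact L) (hLΩ : L ⊆ Ω) {F : EuclideanSpace ℝ (Fin n) → ℝ} (hF : ContDiff ℝ ∞ F)
    (h0 : ∀ x ∈ Ω, x ∉ L → F x = 0) : IsTestFunction Ω (Ω.indicator F) := by
  have hz : ∀ x ∉ L, Ω.indicator F x = 0 := fun x hx => by
    by_cases hxΩ : x ∈ Ω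
    · rw [indicator_of_mem hxΩ, h0 x hxΩ hx]
    · exact indicator_of_notMem hxΩ _
  have hsupp : tsupport (Ω.indicator F) ⊆ L :=
    closure_minimal (fun x hx => by_contra fun h => hx (hz x h)) hL.isClosed
  refine ⟨contDiff_iff_contDiffAt.2 fun x => ?_, HasCompactSupport.intro hL hz,
    hsupp.trans hLΩ⟩
  by_cases hx : x ∈ Ω
  · refine hF.contDiffAt.congr_of_eventuallyEq ?_
    filter_upwards [hΩ.mem_nhds hx] with y hy
    exact indicator_of_mem hy _
  · refine (contDiffAt_const (c := (0 : ℝ))).congr_of_eventuallyEq ?_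
    filter_upwards [hL.isClosed.isOpen_compl.mem_nhds fun h => hx (hLΩ h)] with y hy
    exact hz y hy

theorem gradient_indicator_smoothPos {Ω : Set (EuclideanSpace ℝ (Fin n))} (hΩ : IsOpen Ω)
    {d : EuclideanSpace ℝ (Fin n) → ℝ} {x : EuclideanSpace ℝ (Fin n)} (hx : x ∈ Ω)
    (hd : DifferentiableAt ℝ d x) :
    ∇ (Ω.indicator fun y => smoothPos (d y)) x = Real.smoothTransition (d x) • ∇ d x := by
  have h1 : (Ω.indicator fun y => smoothPos (d y)) =ᶠ[𝓝 x] fun y => smoothPos (d y) := by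
    filter_upwards [hΩ.mem_nhds hx] with y hy
    exact indicator_of_mem hy _
  rw [h1.gradient_eq]
  have h2 := (hasDerivAt_smoothPos (d x)).comp_hasFDerivAt x hd.hasFDerivAt
  have h3 : fderiv ℝ (fun y => smoothPos (d y)) x =
      Real.smoothTransition (d x) • fderiv ℝ d x := h2.fderiv
  simp only [gradient, h3, map_smul]

/-- Energy estimate behind the weak comparison principle. -/
theorem integral_norm_gradient_sq_le {Ω : Set (EuclideanSpace ℝ (Fin n))}
    (hΩ : IsBoundedDomain Ω) {w f φ ψ : EuclideanSpace ℝ (Fin n) → ℝ}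
    {G : EuclideanSpace ℝ (Fin n) → EuclideanSpace ℝ (Fin n)}
    (hG : MemLp G 2 (volume.restrict Ω))
    (hsol : ∀ φ, IsTestFunction Ω φ → ∫ x in Ω, inner ℝ (G x) (∇ φ x) = ∫ x in Ω, φ x)
    (hw : ContDiff ℝ ∞ w) (hf : Continuous f)
    (heq : ∀ φ, IsTestFunction Ω φ → ∫ x in Ω, inner ℝ (∇ w x) (∇ φ x) = ∫ x in Ω, f x * φ x)
    {σ : ℝ} (hσ : σ ^ 2 = 1) (hfσ : ∀ x ∈ Ω, σ * (f x - 1) ≤ 0) (hφ : IsTestFunction Ω φ)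
    (hψ : IsTestFunction Ω ψ) (hψ0 : ∀ x, 0 ≤ ψ x) {η : EuclideanSpace ℝ (Fin n) → ℝ}
    (hη0 : ∀ x, 0 ≤ η x) (hη1 : ∀ x, η x ≤ 1)
    (hψη : ∀ x ∈ Ω, ∇ ψ x = η x • (σ • (∇ w x - ∇ φ x))) :
    ∫ x in Ω, ‖∇ ψ x‖ ^ 2 ≤ ∫ x in Ω, ‖∇ φ x - G x‖ ^ 2 := by
  have hmeas := hΩ.isOpen.measurableSet
  have hψm := hψ.memLp_gradient (volume.restrict Ω)
  have hwi : Integrable (fun x => inner ℝ (∇ w x) (∇ ψ x)) (volume.restrict Ω) := by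
    apply Integrable.integrableOn
    apply Continuous.integrable_of_hasCompactSupport
    · exact (continuous_gradient (hw.of_le (by simp))).inner
        (continuous_gradient (hψ.contDiff.of_le (by simp)))
    · refine (hasCompactSupport_gradient hψ.hasCompactSupport).mono fun x hx => ?_
      contrapose! hx
      simp only [Function.mem_support, ne_eq, not_not] at hx ⊢
      rw [hx, inner_zero_right]
  have hGi : Integrable (fun x => inner ℝ (G x) (∇ ψ x)) (volume.restrict Ω) :=
    integrable_inner_of_memLp hG hψm
  have hψi : Integrable ψ (volume.restrict Ω) :=
    (hψ.contDiff.continuous.integrable_of_hasCompactSupport hψ.hasCompactSupport).integrableOn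
  have hfi : Integrable (fun x => f x * ψ x) (volume.restrict Ω) := by
    apply Integrable.integrableOn
    apply Continuous.integrable_of_hasCompactSupport
    · exact hf.mul hψ.contDiff.continuous
    · exact hψ.hasCompactSupport.mul_left
  have hdm : MemLp (fun x => ∇ φ x - G x) 2 (volume.restrict Ω) :=
    (hφ.memLp_gradient (volume.restrict Ω)).sub hG
  have hdi : Integrable (fun x => ‖∇ φ x - G x‖ ^ 2) (volume.restrict Ω) :=
    MemLp.integrable_norm_pow (p := 2) (by exact_mod_cast hdm) two_ne_zero
  have hψ2i : Integrable (fun x => ‖∇ ψ x‖ ^ 2) (volume.restrict Ω) :=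
    MemLp.integrable_norm_pow (p := 2) (by exact_mod_cast hψm) two_ne_zero
  -- Testing both equations with `ψ` leaves the integral of `2σ (f - 1) ψ`, whose sign is known.
  have hneg : 2 * σ * ((∫ x in Ω, inner ℝ (∇ w x) (∇ ψ x)) - ∫ x in Ω, inner ℝ (G x) (∇ ψ x))
      ≤ 0 := by
    rw [heq ψ hψ, hsol ψ hψ, ← integral_sub hfi hψi, mul_assoc, ← integral_const_mul]
    have : ∫ x in Ω, σ * (f x * ψ x - ψ x) ≤ 0 := by
      apply setIntegral_nonpos hmeas
      intro x hx
      have := mul_le_mul_of_nonneg_right (hfσ x hx) (hψ0 x)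
      linarith
    linarith
  have hsub : Integrable (fun x => 2 * σ * (inner ℝ (∇ w x) (∇ ψ x) - inner ℝ (G x) (∇ ψ x)))
      (volume.restrict Ω) := (hwi.sub hGi).const_mul _
  have hmono : ∫ x in Ω, ‖∇ ψ x‖ ^ 2 ≤ ∫ x in Ω, (‖∇ φ x - G x‖ ^ 2 +
      2 * σ * (inner ℝ (∇ w x) (∇ ψ x) - inner ℝ (G x) (∇ ψ x))) := by
    apply setIntegral_mono_on hψ2i (hdi.add hsub) hmeas
    intro x hx
    set d := ∇ w x - ∇ φ x with hd
    set e := ∇ φ x - G x with he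
    have h1 : ∇ w x - G x = d + e := by rw [hd, he]; abel
    -- As `σ² = 1` this is `|e + η d|² ≥ 0`. With `η² ≤ η` it gives `η²|d|² ≤ |e|² + 2η(|d|² + ⟨e,
    -- d⟩)`, the desired pointwise bound.
    have h2 : 0 ≤ ‖e + (σ * (η x * σ)) • d‖ ^ 2 := by positivity
    rw [Pi.add_apply, ← inner_sub_left, h1, hψη x hx, norm_smul, norm_smul, mul_pow, mul_pow, ← hd, ← he]
    simp only [Real.norm_eq_abs, sq_abs, hσ, one_mul, inner_add_left, inner_smul_right,
      real_inner_self_eq_norm_sq]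
    rw [norm_add_sq_real, norm_smul, mul_pow, inner_smul_right, Real.norm_eq_abs, sq_abs,
      mul_pow, mul_pow, hσ, real_inner_comm] at h2
    have h3 : (η x) ^ 2 * ‖d‖ ^ 2 ≤ η x * ‖d‖ ^ 2 :=
      mul_le_mul_of_nonneg_right (by nlinarith [hη0 x, hη1 x]) (by positivity)
    have h4 : σ * (η x * σ) = η x := by linear_combination η x * hσ
    have h5 : 2 * σ * (η x * (σ * ‖d‖ ^ 2) + η x * (σ * inner ℝ e d)) =
        2 * (η x * ‖d‖ ^ 2 + η x * inner ℝ e d) := by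
      linear_combination 2 * (η x * ‖d‖ ^ 2 + η x * inner ℝ e d) * hσ
    simp only [h4] at h2
    rw [real_inner_comm] at h2
    linarith
  rw [integral_add hdi hsub, integral_const_mul,
    integral_sub hwi hGi] at hmono
  linarith

/-- Weak comparison principle. With `σ = 1` it says that a subsolution `w`, nonpositive outside a
compact subset of `Ω`, lies below `u`; with `σ = -1` and `K = ∅`, that a nonnegative
supersolution lies above `u`. -/
theorem ae_comparison (hn : 1 ≤ n) {Ω : Set (EuclideanSpace ℝ (Fin n))}
    (hΩ : IsBoundedDomain Ω) {u w f : EuclideanSpace ℝ (Fin n) → ℝ} (hu : IsSolution Ω u)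
    (hw : ContDiff ℝ ∞ w) (hf : Continuous f)
    (heq : ∀ φ, IsTestFunction Ω φ → ∫ x in Ω, inner ℝ (∇ w x) (∇ φ x) = ∫ x in Ω, f x * φ x)
    {σ : ℝ} (hσ : σ ^ 2 = 1) (hfσ : ∀ x ∈ Ω, σ * (f x - 1) ≤ 0)
    {K : Set (EuclideanSpace ℝ (Fin n))} (hK : IsCompact K) (hKΩ : K ⊆ Ω)
    (hwK : ∀ x ∈ Ω, x ∉ K → σ * w x ≤ 0) :
    ∀ᵐ x ∂volume.restrict Ω, σ * (w x - u x) ≤ 0 := by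
  obtain ⟨G, hW, hsol⟩ := hu
  obtain ⟨φ, hφ, hφu, hφG⟩ := hW.approx
  obtain ⟨R, hR⟩ := hΩ.isBounded.subset_closedBall 0
  set d : ℕ → EuclideanSpace ℝ (Fin n) → ℝ := fun k x => σ * (w x - φ k x) with hd
  have hdc : ∀ k, ContDiff ℝ ∞ (d k) := fun k => contDiff_const.mul (hw.sub (hφ k).contDiff)
  -- With `φ k` in place of `u` the truncated difference is a genuine test function: off the compact
  -- set `K ∪ tsupport (φ k)` its argument is `σ w ≤ 0`, where `smoothPos` vanishes.
  set ψ : ℕ → EuclideanSpace ℝ (Fin n) → ℝ := fun k => Ω.indicator fun y => smoothPos (d k y)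
    with hψdef
  have hψ : ∀ k, IsTestFunction Ω (ψ k) := fun k => by
    apply isTestFunction_indicator hΩ.isOpen (hK.union (hφ k).hasCompactSupport)
      (union_subset hKΩ (hφ k).tsupport_subset) (contDiff_smoothPos.comp (hdc k))
    intro x hxΩ hx
    rw [mem_union, not_or] at hx
    apply smoothPos_of_nonpos
    simpa [hd, image_eq_zero_of_notMem_tsupport hx.2] using hwK x hxΩ hx.1
  have hψ0 : ∀ k x, 0 ≤ ψ k x := fun k x => indicator_nonneg (fun y _ => smoothPos_nonneg _) x
  have hen : ∀ k, ∫ x in Ω, ‖∇ (ψ k) x‖ ^ 2 ≤ ∫ x in Ω, ‖∇ (φ k) x - G x‖ ^ 2 := by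
    intro k
    apply integral_norm_gradient_sq_le hΩ hW.memLp_grad hsol hw hf heq hσ hfσ (hφ k) (hψ k)
      (hψ0 k) (η := fun x => Real.smoothTransition (d k x))
      (fun x => Real.smoothTransition.nonneg _) (fun x => Real.smoothTransition.le_one _)
    intro x hx
    rw [gradient_indicator_smoothPos hΩ.isOpen hx ((hdc k).differentiable (by simp) x)]
    congr 1
    have h1 : DifferentiableAt ℝ w x := hw.differentiable (by simp) x
    have h2 : DifferentiableAt ℝ (φ k) x := (hφ k).contDiff.differentiable (by simp) x
    have h3 : fderiv ℝ (d k) x = σ • (fderiv ℝ w x - fderiv ℝ (φ k) x) :=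
      ((h1.hasFDerivAt.sub h2.hasFDerivAt).const_mul σ).fderiv
    simp only [gradient, h3, map_smul, map_sub]
  have hψ2 : ∀ k, eLpNorm (ψ k) 2 (volume.restrict Ω) ≤ ENNReal.ofReal (2 * |R|) *
      eLpNorm (fun x => ∇ (φ k) x - G x) 2 (volume.restrict Ω) := by
    intro k
    have h1 := integral_sq_le_integral_norm_gradient_sq ⟨0, hn⟩
      ((hψ k).contDiff.of_le (by simp)) (hψ k).hasCompactSupport
      ((hψ k).tsupport_subset.trans hR)
    have h2 : ∫ x in Ω, ‖∇ (ψ k) x‖ ^ 2 = ∫ x, ‖∇ (ψ k) x‖ ^ 2 := by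
      apply setIntegral_eq_integral_of_forall_compl_eq_zero
      intro x hx
      have : fderiv ℝ (ψ k) x = 0 := by
        have := fun h => hx ((hψ k).tsupport_subset (support_fderiv_subset ℝ h) : x ∈ Ω)
        simpa using this
      simp [gradient, this]
    have h3 : ∫ x in Ω, ‖ψ k x‖ ^ 2 = ∫ x, ψ k x ^ 2 := by
      rw [setIntegral_eq_integral_of_forall_compl_eq_zero]
      · simp
      · intro x hx
        simp [hψdef, indicator_of_notMem hx]
    rw [eLpNorm_two_eq_sqrt ((hψ k).memLp _), eLpNorm_two_eq_sqrt
      (f := fun x => ∇ (φ k) x - G x)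
      (((hφ k).memLp_gradient (volume.restrict Ω)).sub hW.memLp_grad),
      ← ENNReal.ofReal_mul (by positivity)]
    apply ENNReal.ofReal_le_ofReal
    rw [h3]
    calc √(∫ x, ψ k x ^ 2) ≤ √((2 * |R|) ^ 2 * ∫ x in Ω, ‖∇ (φ k) x - G x‖ ^ 2) := by
          apply Real.sqrt_le_sqrt
          refine h1.trans ?_
          rw [mul_pow, sq_abs]
          rw [← h2]
          have := mul_le_mul_of_nonneg_left (hen k) (by positivity : 0 ≤ 4 * R ^ 2)
          linarith
      _ = _ := by
          rw [Real.sqrt_mul (by positivity), Real.sqrt_sq (by positivity)]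
  set g : EuclideanSpace ℝ (Fin n) → ℝ := fun x => smoothPos (σ * (w x - u x)) with hg
  have habs : |σ| = 1 := by
    rcases (sq_eq_sq_iff_eq_or_eq_neg.1 (hσ.trans (one_pow 2).symm)) with h | h <;> simp [h]
  have hum : AEStronglyMeasurable u (volume.restrict Ω) := hW.memLp.1
  have hgm : AEStronglyMeasurable g (volume.restrict Ω) :=
    contDiff_smoothPos.continuous.comp_aestronglyMeasurable
      ((hw.continuous.aestronglyMeasurable.sub hum).const_mul σ)
  -- `ψ k` is small by the energy estimate and Friedrichs, and differs from `g` by at most `|φ k -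
  -- u|` since `smoothPos` is 1-Lipschitz. Both bounds tend to zero, so `g = 0` almost everywhere.
  have hgle : ∀ k, eLpNorm g 2 (volume.restrict Ω) ≤
      ENNReal.ofReal (2 * |R|) * eLpNorm (fun x => ∇ (φ k) x - G x) 2 (volume.restrict Ω) +
      eLpNorm (fun x => φ k x - u x) 2 (volume.restrict Ω) := by
    intro k
    have h1 : eLpNorm (fun x => g x - ψ k x) 2 (volume.restrict Ω) ≤
        eLpNorm (fun x => φ k x - u x) 2 (volume.restrict Ω) := by
      apply eLpNorm_mono_ae
      filter_upwards [ae_restrict_mem hΩ.isOpen.measurableSet] with x hx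
      simp only [hg, hψdef, indicator_of_mem hx, hd]
      refine (lipschitzWith_smoothPos.norm_sub_le _ _).trans ?_
      rw [← mul_sub, norm_mul, Real.norm_eq_abs σ, habs]
      simp
    calc eLpNorm g 2 (volume.restrict Ω)
        = eLpNorm (ψ k + fun x => g x - ψ k x) 2 (volume.restrict Ω) := by
          congr 1; ext x; simp
      _ ≤ eLpNorm (ψ k) 2 (volume.restrict Ω) +
          eLpNorm (fun x => g x - ψ k x) 2 (volume.restrict Ω) :=
          eLpNorm_add_le (hψ k).contDiff.continuous.aestronglyMeasurable
            (hgm.sub (hψ k).contDiff.continuous.aestronglyMeasurable) (by norm_num)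
      _ ≤ _ := add_le_add (hψ2 k) h1
  have hlim : Tendsto (fun k => ENNReal.ofReal (2 * |R|) *
      eLpNorm (fun x => ∇ (φ k) x - G x) 2 (volume.restrict Ω) +
      eLpNorm (fun x => φ k x - u x) 2 (volume.restrict Ω)) atTop (𝓝 0) := by
    have := (ENNReal.Tendsto.const_mul (a := ENNReal.ofReal (2 * |R|)) hφG
      (Or.inr ENNReal.ofReal_ne_top)).add hφu
    simpa using this
  have hg0 : eLpNorm g 2 (volume.restrict Ω) = 0 :=
    le_antisymm (ge_of_tendsto' hlim hgle) zero_le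
  rw [eLpNorm_eq_zero_iff hgm (by norm_num)] at hg0
  filter_upwards [hg0] with x hx
  by_contra! h
  exact (smoothPos_pos h).ne' hx


/-! ### Explicit barriers: the torsion function of a ball and a cusp supersolution. -/

variable {n : ℕ}

/-- Green's formula against a test function. -/
theorem setIntegral_inner_gradient_eq {w f : EuclideanSpace ℝ (Fin n) → ℝ}
    {g : Fin n → EuclideanSpace ℝ (Fin n) → ℝ} (hg : ∀ i, ContDiff ℝ 1 (g i))
    (hwg : ∀ i x, fderiv ℝ w x (EuclideanSpace.single i 1) = g i x)
    (hf : ∀ x, f x = - ∑ i, fderiv ℝ (g i) x (EuclideanSpace.single i 1))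
    {Ω : Set (EuclideanSpace ℝ (Fin n))} {φ : EuclideanSpace ℝ (Fin n) → ℝ}
    (hφ : IsTestFunction Ω φ) :
    ∫ x in Ω, inner ℝ (∇ w x) (∇ φ x) = ∫ x in Ω, f x * φ x := by
  have hφ1 : ContDiff ℝ 1 φ := hφ.contDiff.of_le (by simp)
  have hgrad : ∀ (h : EuclideanSpace ℝ (Fin n) → ℝ) x i,
      (∇ h x) i = fderiv ℝ h x (EuclideanSpace.single i 1) := by
    intro h x i
    rw [← inner_gradient_left, EuclideanSpace.inner_single_right]
    simp
  rw [setIntegral_eq_integral_of_forall_compl_eq_zero,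
    setIntegral_eq_integral_of_forall_compl_eq_zero]
  · have h1 : ∀ x, inner ℝ (∇ w x) (∇ φ x) =
        ∑ i, g i x * fderiv ℝ φ x (EuclideanSpace.single i 1) := by
      intro x
      rw [PiLp.inner_apply]
      refine Finset.sum_congr rfl fun i _ => ?_
      rw [hgrad, hgrad, hwg]
      simp [mul_comm]
    have h2 : ∀ x, f x * φ x =
        ∑ i, -(fderiv ℝ (g i) x (EuclideanSpace.single i 1) * φ x) := by
      intro x
      rw [hf, neg_mul, Finset.sum_mul, Finset.sum_neg_distrib]
    simp only [h1, h2]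
    rw [integral_finsetSum, integral_finsetSum]
    · refine Finset.sum_congr rfl fun i _ => ?_
      rw [integral_mul_fderiv_eq_neg (hg i) hφ1 hφ.hasCompactSupport, integral_neg]
    · intro i _
      apply Integrable.neg
      apply Continuous.integrable_of_hasCompactSupport
      · exact (((hg i).continuous_fderiv one_ne_zero).clm_apply continuous_const).mul
          hφ1.continuous
      · exact hφ.hasCompactSupport.mul_left
    · intro i _
      apply Continuous.integrable_of_hasCompactSupport
      · exact (hg i).continuous.mul
          ((hφ1.continuous_fderiv one_ne_zero).clm_apply continuous_const)
      · exact (hφ.hasCompactSupport.fderiv_apply (𝕜 := ℝ) _).mul_left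
  · intro x hx
    rw [image_eq_zero_of_notMem_tsupport fun h => hx (hφ.tsupport_subset h), mul_zero]
  · intro x hx
    have : fderiv ℝ φ x = 0 := by
      by_contra h
      exact hx (hφ.tsupport_subset (support_fderiv_subset ℝ h))
    simp [gradient, this]

theorem hasFDerivAt_coord (i : Fin n) (x : EuclideanSpace ℝ (Fin n)) :
    HasFDerivAt (fun y : EuclideanSpace ℝ (Fin n) => y i)
      (EuclideanSpace.proj i : EuclideanSpace ℝ (Fin n) →L[ℝ] ℝ) x :=
  (EuclideanSpace.proj i : EuclideanSpace ℝ (Fin n) →L[ℝ] ℝ).hasFDerivAt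

theorem contDiff_coord {k : WithTop ℕ∞} (i : Fin n) :
    ContDiff ℝ k (fun y : EuclideanSpace ℝ (Fin n) => y i) :=
  (EuclideanSpace.proj i : EuclideanSpace ℝ (Fin n) →L[ℝ] ℝ).contDiff

/-- The solution dominates the torsion function of every ball contained in the domain. -/
theorem ae_ball_torsion_le (hn : 1 ≤ n) {Ω : Set (EuclideanSpace ℝ (Fin n))}
    (hΩ : IsBoundedDomain Ω) {u : EuclideanSpace ℝ (Fin n) → ℝ} (hu : IsSolution Ω u)
    {q : EuclideanSpace ℝ (Fin n)} {r : ℝ} (hr : 0 ≤ r) (hq : Metric.closedBall q r ⊆ Ω) :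
    ∀ᵐ x ∂volume.restrict Ω, (r ^ 2 - ‖x - q‖ ^ 2) / (2 * n) ≤ u x := by
  have hn0 : (n : ℝ) ≠ 0 := by positivity
  -- This satisfies `-Δw = 1` on the whole space and is nonpositive off the ball, which therefore
  -- serves as the compact set of the comparison principle.
  set w : EuclideanSpace ℝ (Fin n) → ℝ := fun x => (2 * n : ℝ)⁻¹ * (r ^ 2 - ‖x - q‖ ^ 2) with hw
  have hwc : ContDiff ℝ ∞ w :=
    contDiff_const.mul (contDiff_const.sub ((contDiff_id.sub contDiff_const).norm_sq ℝ))
  have h := ae_comparison hn hΩ hu hwc (f := fun _ => 1) continuous_const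
    (fun φ hφ => setIntegral_inner_gradient_eq (g := fun i x => -((n : ℝ)⁻¹ * (x i - q i)))
      (fun i => (contDiff_const.mul ((contDiff_coord i).sub contDiff_const)).neg) ?_ ?_ hφ)
    (σ := 1) (by norm_num) (by simp) (isCompact_closedBall q r) hq ?_
  · filter_upwards [h] with x hx
    rw [div_eq_inv_mul]
    linarith
  · intro i x
    have h1 : HasFDerivAt (fun x : EuclideanSpace ℝ (Fin n) => ‖x - q‖ ^ 2)
        (2 • innerSL ℝ (x - q)) x := by
      simpa using ((hasFDerivAt_id x).sub_const q).norm_sq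
    have h2 : HasFDerivAt w _ x := (h1.const_sub (r ^ 2)).const_mul (2 * n : ℝ)⁻¹
    rw [h2.fderiv]
    simp
    field_simp
    simp [EuclideanSpace.inner_single_right]
  · intro x
    have : ∀ i : Fin n, fderiv ℝ (fun x : EuclideanSpace ℝ (Fin n) => -((n : ℝ)⁻¹ * (x i - q i))) x
        (EuclideanSpace.single i 1) = -(n : ℝ)⁻¹ := by
      intro i
      have h : HasFDerivAt (fun x : EuclideanSpace ℝ (Fin n) => -((n : ℝ)⁻¹ * (x i - q i))) _ x :=
        (((hasFDerivAt_coord i x).sub_const (q i)).const_mul (n : ℝ)⁻¹).neg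
      rw [h.fderiv]
      simp
    simp only [this]
    simp [hn0]
  · intro x _ hx
    simp only [Metric.mem_closedBall, dist_eq_norm, not_le] at hx
    rw [one_mul, hw]
    apply mul_nonpos_of_nonneg_of_nonpos (by positivity)
    nlinarith

/-- In the plane, `K x₀^{2k} - x₁²` dominates the solution wherever it is a nonnegative
supersolution. -/
theorem ae_le_of_pow_sub_sq {Ω : Set (EuclideanSpace ℝ (Fin 2))}
    (hΩ : IsBoundedDomain Ω) {u : EuclideanSpace ℝ (Fin 2) → ℝ} (hu : IsSolution Ω u)
    {K : ℝ} {k : ℕ} (hpos : ∀ x ∈ Ω, x 1 ^ 2 ≤ K * x 0 ^ (2 * k + 2))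
    (hsmall : ∀ x ∈ Ω, K * ((2 * k + 2) * ((2 * k + 1) * x 0 ^ (2 * k))) ≤ 1) :
    ∀ᵐ x ∂volume.restrict Ω, u x ≤ K * x 0 ^ (2 * k + 2) - x 1 ^ 2 := by
  -- Here `f = -Δw`: the term `-x₁²` contributes `2`, and `hsmall` keeps the loss from the power of
  -- `x₀` below `1`, so `f ≥ 1`.
  have h := ae_comparison one_le_two hΩ hu
    (w := fun x => K * x 0 ^ (2 * k + 2) - x 1 ^ 2)
    (f := fun x => 2 - K * ((2 * k + 2) * ((2 * k + 1) * x 0 ^ (2 * k))))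
    ((contDiff_const.mul ((contDiff_coord 0).pow _)).sub ((contDiff_coord 1).pow _))
    (by
      have : Continuous fun x : EuclideanSpace ℝ (Fin 2) => x 0 :=
        (contDiff_coord (k := 1) 0).continuous
      fun_prop)
    (fun φ hφ => setIntegral_inner_gradient_eq
      (g := ![fun x => K * ((2 * k + 2) * x 0 ^ (2 * k + 1)), fun x => -(2 * x 1)]) ?_ ?_ ?_ hφ)
    (σ := -1) (by norm_num) (fun x hx => by have := hsmall x hx; linarith) isCompact_empty
    (empty_subset _) (fun x hx _ => by have := hpos x hx; linarith)
  · filter_upwards [h] with x hx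
    linarith
  · intro i
    fin_cases i
    · exact contDiff_const.mul (contDiff_const.mul ((contDiff_coord 0).pow _))
    · exact (contDiff_const.mul (contDiff_coord 1)).neg
  · intro i x
    have h2 : HasFDerivAt (fun x : EuclideanSpace ℝ (Fin 2) => K * x 0 ^ (2 * k + 2) - x 1 ^ 2)
        _ x := (((hasFDerivAt_coord 0 x).pow (2 * k + 2)).const_mul K).sub
          ((hasFDerivAt_coord 1 x).pow 2)
    rw [h2.fderiv]
    fin_cases i
    · simp
    · simp
  · intro x
    have h0 : HasFDerivAt (fun x : EuclideanSpace ℝ (Fin 2) =>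
        K * ((2 * k + 2) * x 0 ^ (2 * k + 1))) _ x :=
      (((hasFDerivAt_coord 0 x).pow (2 * k + 1)).const_mul (2 * k + 2 : ℝ)).const_mul K
    have h1 : HasFDerivAt (fun x : EuclideanSpace ℝ (Fin 2) => -(2 * x 1)) _ x :=
      ((hasFDerivAt_coord 1 x).const_mul 2).neg
    rw [Fin.sum_univ_two]
    simp only [Matrix.cons_val_zero, Matrix.cons_val_one, h0.fderiv, h1.fderiv]
    simp
    ring

/-! ### Distance to the boundary and the lower bound for the solution. -/

theorem IsBoundedDomain.ne_univ (hn : 1 ≤ n) {Ω : Set (EuclideanSpace ℝ (Fin n))}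
    (hΩ : IsBoundedDomain Ω) : Ω ≠ univ := by
  rintro rfl
  have : Nonempty (Fin n) := ⟨⟨0, hn⟩⟩
  exact NormedSpace.unbounded_univ ℝ (EuclideanSpace ℝ (Fin n)) hΩ.isBounded

theorem IsBoundedDomain.frontier_nonempty (hn : 1 ≤ n) {Ω : Set (EuclideanSpace ℝ (Fin n))}
    (hΩ : IsBoundedDomain Ω) : (frontier Ω).Nonempty :=
  nonempty_frontier_iff.2 ⟨hΩ.isConnected.nonempty, hΩ.ne_univ hn⟩

theorem IsBoundedDomain.infDist_frontier_pos (hn : 1 ≤ n) {Ω : Set (EuclideanSpace ℝ (Fin n))}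
    (hΩ : IsBoundedDomain Ω) {x : EuclideanSpace ℝ (Fin n)} (hx : x ∈ Ω) :
    0 < Metric.infDist x (frontier Ω) := by
  rw [← isClosed_frontier.notMem_iff_infDist_pos (hΩ.frontier_nonempty hn)]
  intro h
  exact (disjoint_frontier_iff_isOpen.2 hΩ.isOpen).le_bot ⟨h, hx⟩

/-- A point of the complement nearest to `x` lies on the frontier, so the distance to the frontier
is at most the distance to the complement. -/
theorem IsBoundedDomain.ball_infDist_frontier_subset (hn : 1 ≤ n)
    {Ω : Set (EuclideanSpace ℝ (Fin n))} (hΩ : IsBoundedDomain Ω)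
    {x : EuclideanSpace ℝ (Fin n)} (hx : x ∈ Ω) :
    Metric.ball x (Metric.infDist x (frontier Ω)) ⊆ Ω := by
  obtain ⟨y, hy, hxy⟩ := exists_mem_frontier_infDist_compl_eq_dist hx (hΩ.ne_univ hn)
  refine (Metric.ball_subset_ball ?_).trans (Metric.ball_infDist_compl_subset (x := x) (s := Ω))
  rw [hxy]
  exact Metric.infDist_le_dist_of_mem hy

/-- The solution is bounded below by a multiple of the squared distance to the boundary. -/
theorem ae_infDist_sq_le (hn : 1 ≤ n) {Ω : Set (EuclideanSpace ℝ (Fin n))}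
    (hΩ : IsBoundedDomain Ω) {u : EuclideanSpace ℝ (Fin n) → ℝ} (hu : IsSolution Ω u) :
    ∀ᵐ x ∂volume.restrict Ω, Metric.infDist x (frontier Ω) ^ 2 / (16 * n) ≤ u x := by
  obtain ⟨D, hDc, hDd⟩ := TopologicalSpace.exists_countable_dense (EuclideanSpace ℝ (Fin n))
  -- Comparison with a fixed ball holds only off a null set depending on the ball; countably many
  -- centres and rational radii leave a single exceptional null set.
  have hall : ∀ᵐ x ∂volume.restrict Ω, ∀ q ∈ D, ∀ r : ℚ, 0 ≤ r →
      Metric.closedBall q r ⊆ Ω → ((r : ℝ) ^ 2 - ‖x - q‖ ^ 2) / (2 * n) ≤ u x := by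
    rw [ae_ball_iff hDc]
    intro q _
    rw [ae_all_iff]
    intro r
    by_cases h : 0 ≤ r ∧ Metric.closedBall q (r : ℝ) ⊆ Ω
    · filter_upwards [ae_ball_torsion_le hn hΩ hu (Rat.cast_nonneg.2 h.1) h.2] with x hx _ _
      exact hx
    · exact Eventually.of_forall fun x h1 h2 => (h ⟨h1, h2⟩).elim
  filter_upwards [hall, ae_restrict_mem hΩ.isOpen.measurableSet] with x hx hxΩ
  have hδ := hΩ.infDist_frontier_pos hn hxΩ
  have hball := hΩ.ball_infDist_frontier_subset hn hxΩ
  set δ := Metric.infDist x (frontier Ω)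
  obtain ⟨q, hqD, hqx⟩ := hDd.exists_mem_open (Metric.isOpen_ball (x := x) (ε := δ / 4))
    ⟨x, Metric.mem_ball_self (by positivity)⟩
  -- As `|x - q| < δ/4` and `δ/2 < r < 3δ/4`, the closed ball about `q` stays in the `δ`-ball about
  -- `x`, and `r² - |x - q|² ≥ δ²/8`; division by `2n` gives `16n`.
  obtain ⟨r, hr1, hr2⟩ := exists_rat_btwn (show δ / 2 < 3 * δ / 4 by linarith)
  have hqx' : ‖x - q‖ < δ / 4 := by rwa [Metric.mem_ball', dist_eq_norm] at hqx
  refine le_trans ?_ (hx q hqD r (by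
    have : (0 : ℝ) ≤ r := by linarith
    exact_mod_cast this) ?_)
  · have h0 := norm_nonneg (x - q)
    have h1 : 1 / 8 * δ ^ 2 ≤ (r : ℝ) ^ 2 - ‖x - q‖ ^ 2 := by nlinarith
    have hn0 : (0 : ℝ) < n := by exact_mod_cast hn
    rw [div_le_div_iff₀ (by positivity) (by positivity)]
    nlinarith
  · intro y hy
    apply hball
    rw [Metric.mem_closedBall] at hy
    rw [Metric.mem_ball]
    have := dist_triangle y q x
    rw [Metric.mem_ball] at hqx
    linarith


/-! ### From volumes of boundary layers to the `β`-integral; part (i). -/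

/-- The constant of `lintegral_rpow_neg_le`. -/
noncomputable def layerConst (s : ℝ) : ℝ := 1 + 2 * 2 ^ s * (1 - 2 ^ (s - 1))⁻¹

theorem layerConst_pos {s : ℝ} (hs : s < 1) : 0 < layerConst s := by
  have : (2 : ℝ) ^ (s - 1) < 1 := Real.rpow_lt_one_of_one_lt_of_neg (by norm_num) (by linarith)
  have : 0 < 1 - (2 : ℝ) ^ (s - 1) := by linarith
  unfold layerConst
  positivity

/-- A function whose sublevel sets have measure `O(t)` has integrable negative powers of exponent
less than one, with an explicit bound. -/
theorem lintegral_rpow_neg_le {α : Type*} {m : MeasurableSpace α} {μ : Measure α} {g : α → ℝ}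
    (hg : Measurable g) (hpos : ∀ᵐ x ∂μ, 0 < g x) {A V s : ℝ} (hA : 0 < A) (hV : 0 < V)
    (hμ : μ univ ≤ ENNReal.ofReal V)
    (hμg : ∀ t : ℝ, 0 < t → μ {x | g x < t} ≤ ENNReal.ofReal (A * t)) (hs0 : 0 < s) (hs1 : s < 1) :
    ∫⁻ x, ENNReal.ofReal (g x) ^ (-s) ∂μ ≤
      ENNReal.ofReal (layerConst s * (V ^ (1 - s) * A ^ s)) := by
  -- At this level the trivial bound `V` and the sublevel bound `A t` agree. Above it `ρ^{-s}`
  -- bounds the integrand; below it the range is cut dyadically.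
  set ρ := V / A with hρ
  have hρ0 : 0 < ρ := by positivity
  set c : ℕ → ℝ := fun j => (ρ * (1 / 2) ^ (j + 1)) ^ (-s) with hc
  -- The factor `2` turns the nonstrict upper bound on `g` in a dyadic shell into the strict
  -- inequality of a sublevel set.
  set t : ℕ → ℝ := fun j => 2 * ρ * (1 / 2) ^ j with ht
  have hmeas : ∀ j, MeasurableSet {x | g x < t j} := fun j => measurableSet_lt hg measurable_const
  have hpt : ∀ᵐ x ∂μ, ENNReal.ofReal (g x) ^ (-s) ≤ ENNReal.ofReal (ρ ^ (-s)) +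
      ∑' j, {x | g x < t j}.indicator (fun _ => ENNReal.ofReal (c j)) x := by
    filter_upwards [hpos] with x hx
    rw [ENNReal.ofReal_rpow_of_pos hx]
    rcases le_or_gt ρ (g x) with h | h
    · exact le_add_right (ENNReal.ofReal_le_ofReal
        (Real.rpow_le_rpow_of_nonpos hρ0 h (by linarith)))
    · obtain ⟨j, hj1, hj2⟩ := exists_nat_pow_near_of_lt_one (show 0 < g x / ρ by positivity)
        ((div_le_one hρ0).2 h.le) (show (0 : ℝ) < 1 / 2 by norm_num) (by norm_num)
      rw [lt_div_iff₀ hρ0] at hj1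
      rw [div_le_iff₀ hρ0] at hj2
      have hmem : x ∈ {x | g x < t j} := by
        have : 0 < (1 / 2 : ℝ) ^ j * ρ := by positivity
        simp only [mem_ofPred_eq, ht]
        linarith
      refine le_add_left (le_trans ?_ (ENNReal.le_tsum j))
      rw [indicator_of_mem hmem]
      apply ENNReal.ofReal_le_ofReal
      apply Real.rpow_le_rpow_of_nonpos (by positivity) _ (by linarith)
      linarith
  have hq0 : (0 : ℝ) ≤ 2 ^ (s - 1) := by positivity
  have hq1 : (2 : ℝ) ^ (s - 1) < 1 :=
    Real.rpow_lt_one_of_one_lt_of_neg (by norm_num) (by linarith)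
  -- Height times measure of a shell is geometric with ratio `2^{s-1}`, less than one exactly
  -- because `s < 1`.
  have hterm : ∀ j, c j * (A * t j) = 2 * 2 ^ s * (V ^ (1 - s) * A ^ s) * (2 ^ (s - 1)) ^ j := by
    intro j
    have h1 : c j = ρ ^ (-s) * (2 ^ s * (2 ^ s) ^ j) := by
      simp only [hc]
      rw [Real.mul_rpow hρ0.le (by positivity), one_div, inv_pow, Real.inv_rpow (by positivity),
        Real.rpow_neg (x := 2 ^ (j + 1)) (by positivity), inv_inv, ← Real.rpow_natCast_mul (by norm_num),
        mul_comm ((j + 1 : ℕ) : ℝ), Real.rpow_mul_natCast (by norm_num), pow_succ']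
    have h2 : (2 : ℝ) ^ (s - 1) = 2 ^ s * (1 / 2) := by
      rw [Real.rpow_sub_one (by norm_num)]; ring
    have h3 : A * ρ ^ (-s) * ρ = V ^ (1 - s) * A ^ s := by
      rw [hρ, Real.rpow_neg (by positivity), Real.div_rpow hV.le hA.le, Real.rpow_sub hV,
        Real.rpow_one]
      field_simp
    rw [h1, h2, ← h3, mul_pow]
    simp only [ht]
    ring
  calc ∫⁻ x, ENNReal.ofReal (g x) ^ (-s) ∂μ
      ≤ ∫⁻ x, (ENNReal.ofReal (ρ ^ (-s)) +
        ∑' j, {x | g x < t j}.indicator (fun _ => ENNReal.ofReal (c j)) x) ∂μ :=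
        lintegral_mono_ae hpt
    _ = ENNReal.ofReal (ρ ^ (-s)) * μ univ + ∑' j, ENNReal.ofReal (c j) * μ {x | g x < t j} := by
        rw [lintegral_add_left measurable_const, lintegral_const, lintegral_tsum]
        · congr 2
          ext j
          rw [lintegral_indicator (hmeas j), setLIntegral_const]
        · exact fun j => (measurable_const.indicator (hmeas j)).aemeasurable
    _ ≤ ENNReal.ofReal (ρ ^ (-s)) * ENNReal.ofReal V +
        ∑' j, ENNReal.ofReal (c j) * ENNReal.ofReal (A * t j) := by
        gcongr with j
        exact hμg _ (by positivity)
    _ = ENNReal.ofReal (ρ ^ (-s) * V) + ENNReal.ofReal (∑' j,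
          2 * 2 ^ s * (V ^ (1 - s) * A ^ s) * (2 ^ (s - 1)) ^ j) := by
        rw [← ENNReal.ofReal_mul (by positivity), ENNReal.ofReal_tsum_of_nonneg
          (fun j => by positivity) ((summable_geometric_of_lt_one hq0 hq1).mul_left _)]
        congr 2
        ext j
        rw [← ENNReal.ofReal_mul (by positivity), hterm]
    _ = ENNReal.ofReal (layerConst s * (V ^ (1 - s) * A ^ s)) := by
        rw [tsum_mul_left, tsum_geometric_of_lt_one hq0 hq1, ← ENNReal.ofReal_add (by positivity)
          (by have : 0 < 1 - (2 : ℝ) ^ (s - 1) := by linarith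
              positivity)]
        congr 1
        have h3 : ρ ^ (-s) * V = V ^ (1 - s) * A ^ s := by
          rw [hρ, Real.rpow_neg (by positivity), Real.div_rpow hV.le hA.le, Real.rpow_sub hV,
            Real.rpow_one]
          field_simp
        rw [h3, layerConst]
        ring

variable {n : ℕ}

theorem IsBoundedDomain.volume_pos {Ω : Set (EuclideanSpace ℝ (Fin n))}
    (hΩ : IsBoundedDomain Ω) : 0 < volume Ω :=
  hΩ.isOpen.measure_pos _ hΩ.isConnected.nonempty

theorem IsBoundedDomain.volume_ne_top {Ω : Set (EuclideanSpace ℝ (Fin n))}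
    (hΩ : IsBoundedDomain Ω) : volume Ω ≠ ⊤ :=
  hΩ.isBounded.measure_lt_top.ne

/-- A bound on the volumes of the boundary layers of the domain bounds its `β`-integral. -/
theorem betaIntegral_le_of_layer (hn : 1 ≤ n) {Ω : Set (EuclideanSpace ℝ (Fin n))}
    (hΩ : IsBoundedDomain Ω) {u : EuclideanSpace ℝ (Fin n) → ℝ} (hu : IsSolution Ω u)
    {a A β : ℝ} (hA : 0 < A)
    (hlayer : ∀ r : ℝ, 0 < r →
      volume {x ∈ Ω | Metric.infDist x (frontier Ω) < r} ≤ ENNReal.ofReal (A * r ^ a))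
    (hβ0 : 0 < β) (hβ : 2 * β < a) :
    betaIntegral Ω u β ≤ ENNReal.ofReal ((16 * n) ^ β * (layerConst (2 * β / a) *
      ((volume Ω).toReal ^ (1 - 2 * β / a) * A ^ (2 * β / a)))) := by
  have ha : 0 < a := by linarith
  have hn0 : (0 : ℝ) < n := by exact_mod_cast hn
  have hmeas := hΩ.isOpen.measurableSet
  set δ : EuclideanSpace ℝ (Fin n) → ℝ := fun x => Metric.infDist x (frontier Ω) with hδ
  have hδm : Measurable δ := (Metric.continuous_infDist_pt _).measurable
  have hδ0 : ∀ x, 0 ≤ δ x := fun x => Metric.infDist_nonneg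
  have hδpos : ∀ᵐ x ∂volume.restrict Ω, 0 < δ x := by
    filter_upwards [ae_restrict_mem hmeas] with x hx
    exact hΩ.infDist_frontier_pos hn hx
  -- The power `δ^a` has sublevel sets of measure at most `A t`, and `δ^{-2β}` is its power of
  -- exponent `-2β/a`.
  have key := lintegral_rpow_neg_le (μ := volume.restrict Ω) (g := fun x => δ x ^ a)
    (A := A) (V := (volume Ω).toReal) (s := 2 * β / a) (hδm.pow_const a)
    (by filter_upwards [hδpos] with x hx; positivity) hA
    (ENNReal.toReal_pos hΩ.volume_pos.ne' hΩ.volume_ne_top)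
    (by rw [Measure.restrict_apply_univ, ENNReal.ofReal_toReal hΩ.volume_ne_top]) ?_
    (by positivity) ((div_lt_one ha).2 hβ)
  · rw [ENNReal.ofReal_mul (by positivity)]
    refine le_trans ?_ (mul_le_mul_right key _)
    rw [← lintegral_const_mul' _ _ ENNReal.ofReal_ne_top]
    apply lintegral_mono_ae
    filter_upwards [hδpos, ae_infDist_sq_le hn hΩ hu] with x hx hxu
    have h1 : 0 < δ x ^ 2 / (16 * n) := by positivity
    rw [ENNReal.ofReal_rpow_of_pos (h1.trans_le hxu), ENNReal.ofReal_rpow_of_pos (by positivity),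
      ← ENNReal.ofReal_mul (by positivity)]
    apply ENNReal.ofReal_le_ofReal
    refine (Real.rpow_le_rpow_of_nonpos h1 hxu (by linarith)).trans_eq ?_
    have h2 : (δ x ^ a) ^ (-(2 * β / a)) = (δ x ^ 2) ^ (-β) := by
      rw [← Real.rpow_mul (hδ0 x), ← Real.rpow_natCast_mul (hδ0 x)]
      congr 1
      push_cast
      field_simp
    rw [h2, Real.div_rpow (by positivity) (by positivity), Real.rpow_neg (x := 16 * (n : ℝ))
      (by positivity), div_inv_eq_mul, mul_comm]
  · intro t ht
    have h1 := hlayer (t ^ a⁻¹) (by positivity)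
    rw [Real.rpow_inv_rpow ht.le ha.ne'] at h1
    refine le_trans (le_of_eq ?_) h1
    rw [Measure.restrict_apply (measurableSet_lt (hδm.pow_const a) measurable_const)]
    congr 1
    ext x
    simp only [mem_inter_iff, mem_ofPred_eq, and_comm (a := x ∈ Ω)]
    rw [Real.lt_rpow_inv_iff_of_pos (hδ0 x) ht.le ha]

theorem betaIntegral_lt_top_of_minkowski (hn : 1 ≤ n) {Ω : Set (EuclideanSpace ℝ (Fin n))}
    (hΩ : IsBoundedDomain Ω) {γ : ℝ} (hγ : upperMinkowskiContent Ω γ < ⊤) {β : ℝ} (hβ0 : 0 < β)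
    (hβ : β < (n - γ) / 2) {u : EuclideanSpace ℝ (Fin n) → ℝ} (hu : IsSolution Ω u) :
    betaIntegral Ω u β < ⊤ := by
  obtain ⟨M, hM, -⟩ := ENNReal.lt_iff_exists_nnreal_btwn.1 hγ
  have hev := eventually_lt_of_limsup_lt hM
  obtain ⟨r₀, hr₀, hr⟩ := mem_nhdsGT_iff_exists_Ioo_subset.1 hev
  rw [mem_Ioi] at hr₀
  set a := (n : ℝ) - γ with ha
  set V := (volume Ω).toReal
  have hV : 0 < V := ENNReal.toReal_pos hΩ.volume_pos.ne' hΩ.volume_ne_top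
  -- The content controls only widths below `r₀`. For larger widths the volume of the whole domain
  -- is at most `(V / r₀^a) r^a`, whence the second term of `A`.
  refine (betaIntegral_le_of_layer hn hΩ hu (a := a) (A := M + V / r₀ ^ a) (by positivity) ?_ hβ0
    (by linarith)).trans_lt ENNReal.ofReal_lt_top
  intro r hr0
  rcases lt_or_ge r r₀ with h | h
  · have h1 := hr ⟨hr0, h⟩
    have h2 : (0 : ℝ) < r ^ a := by positivity
    have h3 := (ENNReal.div_lt_iff (Or.inl (by simpa using h2))
      (Or.inl ENNReal.ofReal_ne_top)).1 h1
    refine h3.le.trans ?_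
    rw [← ENNReal.ofReal_coe_nnreal, ← ENNReal.ofReal_mul (by positivity)]
    apply ENNReal.ofReal_le_ofReal
    gcongr
    have : 0 ≤ V / r₀ ^ a := by positivity
    linarith
  · calc volume {x ∈ Ω | Metric.infDist x (frontier Ω) < r} ≤ volume Ω :=
          measure_mono fun x hx => hx.1
      _ = ENNReal.ofReal V := (ENNReal.ofReal_toReal hΩ.volume_ne_top).symm
      _ ≤ _ := by
          apply ENNReal.ofReal_le_ofReal
          have h1 : r₀ ^ a ≤ r ^ a := Real.rpow_le_rpow hr₀.le h (by linarith)
          have h2 : 0 < r₀ ^ a := by positivity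
          calc V = V / r₀ ^ a * r₀ ^ a := by field_simp
            _ ≤ V / r₀ ^ a * r ^ a := by gcongr
            _ ≤ _ := by
              gcongr
              have : (0 : ℝ) ≤ M := M.2
              linarith


/-! ### Ahlfors regular boundaries; part (ii). -/

variable {n : ℕ}

/-- Vitali covering of a set by balls of a fixed radius. -/
theorem exists_countable_disjoint_cover (S : Set (EuclideanSpace ℝ (Fin n))) {r : ℝ} (hr : 0 < r) :
    ∃ u ⊆ S, u.Countable ∧ (u.PairwiseDisjoint fun a => Metric.closedBall a r) ∧
      ∀ a ∈ S, ∃ b ∈ u, Metric.closedBall a r ⊆ Metric.closedBall b (4 * r) := by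
  obtain ⟨u, hu, hd, hc⟩ := Vitali.exists_disjoint_subfamily_covering_enlargement_closedBall S
    (fun a : EuclideanSpace ℝ (Fin n) => a) (fun _ => r) r (fun _ _ => le_rfl) 4 (by norm_num)
  refine ⟨u, hu, hd.countable_of_nonempty_interior fun a _ => ?_, hd, hc⟩
  exact (Metric.nonempty_ball.2 hr).mono Metric.ball_subset_interior_closedBall

/-- The volume of the unit ball. -/
noncomputable def unitBallVolume (n : ℕ) : ℝ :=
  (volume (Metric.ball (0 : EuclideanSpace ℝ (Fin n)) 1)).toReal

theorem unitBallVolume_pos (n : ℕ) : 0 < unitBallVolume n :=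
  ENNReal.toReal_pos (Metric.measure_ball_pos _ _ one_pos).ne' Metric.isBounded_ball.measure_lt_top.ne

theorem volume_closedBall_eq (x : EuclideanSpace ℝ (Fin n)) {r : ℝ} (hr : 0 ≤ r) :
    volume (Metric.closedBall x r) = ENNReal.ofReal (r ^ n * unitBallVolume n) := by
  rw [Measure.addHaar_closedBall _ _ hr, ENNReal.ofReal_mul (by positivity), unitBallVolume,
    ENNReal.ofReal_toReal Metric.isBounded_ball.measure_lt_top.ne, finrank_euclideanSpace_fin]

theorem rpow_natCast_sub_one {r : ℝ} (hr : 0 < r) : r ^ ((n : ℝ) - 1) = r ^ n / r := by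
  rw [Real.rpow_sub_one hr.ne', Real.rpow_natCast]

/-- The neighbourhoods of an Ahlfors regular boundary have volume at most proportional to their
width. -/
theorem volume_layer_le (hn : 1 ≤ n) {Ω : Set (EuclideanSpace ℝ (Fin n))} (hΩ : IsBoundedDomain Ω)
    {C₀ C₁ ρ : ℝ} (hC₀ : 0 < C₀) (hreg : IsAhlforsRegularWith (frontier Ω) C₀ C₁ ρ) {r : ℝ}
    (hr : 0 < r) (hrρ : r < ρ) :
    volume {x ∈ Ω | Metric.infDist x (frontier Ω) < r} ≤
      ENNReal.ofReal (4 ^ n * unitBallVolume n / C₀ * r) * surfaceMeasure n (frontier Ω) := by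
  have hvb := unitBallVolume_pos n
  obtain ⟨u, huS, huc, hud, hucov⟩ := exists_countable_disjoint_cover (frontier Ω) hr
  have hcov : {x ∈ Ω | Metric.infDist x (frontier Ω) < r} ⊆
      ⋃ b ∈ u, Metric.closedBall b (4 * r) := by
    rintro x ⟨_, hx⟩
    obtain ⟨a, ha, hxa⟩ := (Metric.infDist_lt_iff (hΩ.frontier_nonempty hn)).1 hx
    obtain ⟨b, hb, hab⟩ := hucov a ha
    exact mem_iUnion₂.2 ⟨b, hb, hab hxa.le⟩
  have hsum : ∑' b : u, surfaceMeasure n (Metric.closedBall (b : EuclideanSpace ℝ (Fin n)) r ∩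
      frontier Ω) ≤ surfaceMeasure n (frontier Ω) := by
    rw [← measure_biUnion huc (hud.mono fun b => inter_subset_left)
      fun b _ => Metric.isClosed_closedBall.measurableSet.inter isClosed_frontier.measurableSet]
    exact measure_mono (iUnion₂_subset fun b _ => inter_subset_right)
  calc volume {x ∈ Ω | Metric.infDist x (frontier Ω) < r}
      ≤ volume (⋃ b ∈ u, Metric.closedBall b (4 * r)) := measure_mono hcov
    _ ≤ ∑' b : u, volume (Metric.closedBall (b : EuclideanSpace ℝ (Fin n)) (4 * r)) :=
        measure_biUnion_le _ huc _
    -- The lower Ahlfors bound trades the volume `~ rⁿ` of an enlarged ball for `r` times the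
    -- surface measure in the original ball; those balls are disjoint, so the measures add up to at
    -- most the total.
    _ ≤ ∑' b : u, ENNReal.ofReal (4 ^ n * unitBallVolume n / C₀ * r) *
        surfaceMeasure n (Metric.closedBall (b : EuclideanSpace ℝ (Fin n)) r ∩ frontier Ω) := by
        gcongr with b
        rw [volume_closedBall_eq _ (by positivity)]
        calc ENNReal.ofReal ((4 * r) ^ n * unitBallVolume n)
            = ENNReal.ofReal (4 ^ n * unitBallVolume n / C₀ * r) *
              ENNReal.ofReal (C₀ * r ^ ((n : ℝ) - 1)) := by
              rw [← ENNReal.ofReal_mul (by positivity), rpow_natCast_sub_one hr]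
              congr 1
              rw [mul_pow]
              field_simp
          _ ≤ _ := by
              gcongr
              refine ((hreg b (huS b.2) r hr hrρ).1).trans (measure_mono ?_)
              exact inter_subset_inter_left _ Metric.ball_subset_closedBall
    _ ≤ _ := by
        rw [ENNReal.tsum_mul_left]
        gcongr

/-- An Ahlfors regular boundary has finite surface measure, controlled by the diameter. -/
theorem surfaceMeasure_frontier_le (hn : 1 ≤ n) {Ω : Set (EuclideanSpace ℝ (Fin n))}
    (hΩ : IsBoundedDomain Ω) {C₀ C₁ R : ℝ} (hC₁ : 0 < C₁) (hR : 0 < R)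
    (hD : 0 < Metric.diam Ω)
    (hreg : IsAhlforsRegularWith (frontier Ω) C₀ C₁ (R * Metric.diam Ω)) :
    surfaceMeasure n (frontier Ω) ≤ ENNReal.ofReal
      (C₁ * (9 / 2) ^ ((n : ℝ) - 1) * (5 / R) * (1 + R / 5) ^ n *
        Metric.diam Ω ^ ((n : ℝ) - 1)) := by
  have hvb := unitBallVolume_pos n
  set D := Metric.diam Ω
  -- The closed balls of radius `4r` of the covering lie in open balls of radius `9r/2 = 0.9 R D`,
  -- still below the scale `R D` of the Ahlfors condition.
  set r := R * D / 5 with hrdef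
  have hr : 0 < r := by positivity
  obtain ⟨x₀, hx₀⟩ := hΩ.frontier_nonempty hn
  obtain ⟨u, huS, huc, hud, hucov⟩ := exists_countable_disjoint_cover (frontier Ω) hr
  -- A packing bound in place of a count of the balls: they are disjoint and contained in one ball
  -- of radius `D + r`.
  have hvol : ∑' b : u, volume (Metric.closedBall (b : EuclideanSpace ℝ (Fin n)) r) ≤
      ENNReal.ofReal ((D + r) ^ n * unitBallVolume n) := by
    rw [← measure_biUnion huc hud fun b _ => Metric.isClosed_closedBall.measurableSet,
      ← volume_closedBall_eq x₀ (by positivity)]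
    apply measure_mono (iUnion₂_subset fun b hb x hx => ?_)
    have h1 : dist b x₀ ≤ D := by
      have := Metric.dist_le_diam_of_mem hΩ.isBounded.closure (frontier_subset_closure (huS hb))
        (frontier_subset_closure hx₀)
      rwa [Metric.diam_closure] at this
    rw [Metric.mem_closedBall] at hx ⊢
    linarith [dist_triangle x b x₀]
  calc surfaceMeasure n (frontier Ω)
      ≤ surfaceMeasure n (⋃ b ∈ u, (Metric.ball b (9 / 2 * r) ∩ frontier Ω)) := by
        apply measure_mono
        intro a ha
        obtain ⟨b, hb, hab⟩ := hucov a ha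
        refine mem_iUnion₂.2 ⟨b, hb, ?_, ha⟩
        exact Metric.closedBall_subset_ball (by linarith) (hab (Metric.mem_closedBall_self hr.le))
    _ ≤ ∑' b : u, surfaceMeasure n (Metric.ball (b : EuclideanSpace ℝ (Fin n)) (9 / 2 * r) ∩
        frontier Ω) := measure_biUnion_le _ huc _
    _ ≤ ∑' b : u, ENNReal.ofReal (C₁ * (9 / 2 * r) ^ ((n : ℝ) - 1) / (r ^ n * unitBallVolume n)) *
        volume (Metric.closedBall (b : EuclideanSpace ℝ (Fin n)) r) := by
        gcongr with b
        refine (hreg b (huS b.2) (9 / 2 * r) (by positivity) ?_).2.trans_eq ?_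
        · rw [hrdef]
          have : 0 < R * D := by positivity
          linarith
        · rw [volume_closedBall_eq _ hr.le, ← ENNReal.ofReal_mul (by positivity)]
          congr 1
          field_simp
    _ ≤ ENNReal.ofReal (C₁ * (9 / 2 * r) ^ ((n : ℝ) - 1) / (r ^ n * unitBallVolume n)) *
        ENNReal.ofReal ((D + r) ^ n * unitBallVolume n) := by
        rw [ENNReal.tsum_mul_left]
        gcongr
    _ = _ := by
        rw [← ENNReal.ofReal_mul (by positivity)]
        congr 1
        have h1 : D + r = D * (1 + R / 5) := by rw [hrdef]; ring
        rw [h1, Real.mul_rpow (by norm_num) hr.le, rpow_natCast_sub_one hr,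
          rpow_natCast_sub_one hD, mul_pow]
        have h2 : r⁻¹ = 5 / R / D := by rw [hrdef]; field_simp
        have h3 : C₁ * ((9 / 2) ^ ((n : ℝ) - 1) * (r ^ n / r)) / (r ^ n * unitBallVolume n) *
            (D ^ n * (1 + R / 5) ^ n * unitBallVolume n) =
            C₁ * (9 / 2) ^ ((n : ℝ) - 1) * r⁻¹ * (D ^ n * (1 + R / 5) ^ n) := by
          field_simp
        rw [h3, h2]
        ring

theorem volume_le_diam_pow {Ω : Set (EuclideanSpace ℝ (Fin n))} (hΩ : IsBoundedDomain Ω) :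
    volume Ω ≤ ENNReal.ofReal (Metric.diam Ω ^ n * unitBallVolume n) := by
  obtain ⟨x₀, hx₀⟩ := hΩ.isConnected.nonempty
  rw [← volume_closedBall_eq x₀ Metric.diam_nonneg]
  exact measure_mono fun x hx => Metric.dist_le_diam_of_mem hΩ.isBounded hx hx₀

theorem IsBoundedDomain.diam_pos (hn : 1 ≤ n) {Ω : Set (EuclideanSpace ℝ (Fin n))}
    (hΩ : IsBoundedDomain Ω) : 0 < Metric.diam Ω := by
  refine Metric.diam_nonneg.lt_of_ne fun h => ?_
  have h1 := volume_le_diam_pow hΩ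
  rw [← h, zero_pow (by omega)] at h1
  simp only [zero_mul, ENNReal.ofReal_zero, nonpos_iff_eq_zero] at h1
  exact hΩ.volume_pos.ne' h1

/-- The quantitative estimates for domains with Ahlfors regular boundary. -/
theorem exists_betaIntegral_le (hn : 1 ≤ n) {β : ℝ} (hβ0 : 0 < β) (hβ : β < 1 / 2)
    {C₀ C₁ R : ℝ} (hC₀ : 0 < C₀) (hC₁ : 0 < C₁) (hR : 0 < R) :
    ∃ C : ℝ≥0, ∀ Ω : Set (EuclideanSpace ℝ (Fin n)), IsBoundedDomain Ω →
      IsAhlforsRegularWith (frontier Ω) C₀ C₁ (R * Metric.diam Ω) →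
      (∀ u : EuclideanSpace ℝ (Fin n) → ℝ, IsSolution Ω u →
        betaIntegral Ω u β ≤
          C * (volume Ω ^ (1 - 2 * β) * surfaceMeasure n (frontier Ω) ^ (2 * β))) ∧
      volume Ω ^ (1 - 2 * β) * surfaceMeasure n (frontier Ω) ^ (2 * β) ≤
        C * ENNReal.ofReal (Metric.diam Ω) ^ (n - 2 * β) := by
  have hvb := unitBallVolume_pos n
  have hn0 : (0 : ℝ) < n := by exact_mod_cast hn
  set vb := unitBallVolume n
  -- The first term serves layers thinner than `R D`, by the covering estimate; the second serves
  -- wider ones, where `|Ω| ≤ vb Dⁿ` is compared with the lower bound `hSlow` for the surface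
  -- measure.
  set K : ℝ := 4 ^ n * vb / C₀ + vb / (R * (C₀ * (R / 2) ^ ((n : ℝ) - 1))) with hK
  have hK0 : 0 < K := by positivity
  set B₁ : ℝ := (16 * n) ^ β * (layerConst (2 * β) * K ^ (2 * β)) with hB₁
  have hB₁0 : 0 < B₁ := by
    have := layerConst_pos (s := 2 * β) (by linarith)
    positivity
  set H : ℝ := C₁ * (9 / 2) ^ ((n : ℝ) - 1) * (5 / R) * (1 + R / 5) ^ n with hH
  have hH0 : 0 < H := by positivity
  set B₂ : ℝ := vb ^ (1 - 2 * β) * H ^ (2 * β) with hB₂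
  have hB₂0 : 0 < B₂ := by positivity
  refine ⟨(B₁ + B₂).toNNReal, fun Ω hΩ hreg => ?_⟩
  have hD := hΩ.diam_pos hn
  have hSle := surfaceMeasure_frontier_le hn hΩ hC₁ hR hD hreg
  have hVle := volume_le_diam_pow hΩ
  -- Radius `R D / 2`, because the Ahlfors condition holds only strictly below `R D`.
  have hSlow : ENNReal.ofReal (C₀ * (R / 2 * Metric.diam Ω) ^ ((n : ℝ) - 1)) ≤
      surfaceMeasure n (frontier Ω) := by
    obtain ⟨x₀, hx₀⟩ := hΩ.frontier_nonempty hn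
    refine (hreg x₀ hx₀ (R / 2 * Metric.diam Ω) (by positivity) ?_).1.trans
      (measure_mono inter_subset_right)
    have : 0 < R * Metric.diam Ω := by positivity
    linarith
  have hStop : surfaceMeasure n (frontier Ω) ≠ ⊤ := ne_top_of_le_ne_top ENNReal.ofReal_ne_top hSle
  have hVtop := hΩ.volume_ne_top
  set D := Metric.diam Ω
  obtain ⟨V, hVdef⟩ : ∃ V, V = (volume Ω).toReal := ⟨_, rfl⟩
  obtain ⟨h, hhdef⟩ : ∃ h, h = (surfaceMeasure n (frontier Ω)).toReal := ⟨_, rfl⟩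
  have hVeq : volume Ω = ENNReal.ofReal V := by rw [hVdef, ENNReal.ofReal_toReal hVtop]
  have hheq : surfaceMeasure n (frontier Ω) = ENNReal.ofReal h := by
    rw [hhdef, ENNReal.ofReal_toReal hStop]
  have hV0 : 0 < V := hVdef ▸ ENNReal.toReal_pos hΩ.volume_pos.ne' hVtop
  rw [hheq] at hSle hSlow
  rw [hVeq] at hVle
  have hlow : 0 < C₀ * (R / 2 * D) ^ ((n : ℝ) - 1) := by positivity
  have hh0 : 0 < h := by
    by_contra! hneg
    rw [ENNReal.ofReal_of_nonpos hneg, nonpos_iff_eq_zero, ENNReal.ofReal_eq_zero] at hSlow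
    linarith
  rw [ENNReal.ofReal_le_ofReal_iff hh0.le] at hSlow
  rw [ENNReal.ofReal_le_ofReal_iff (by positivity)] at hSle hVle
  have hprod : volume Ω ^ (1 - 2 * β) * surfaceMeasure n (frontier Ω) ^ (2 * β) =
      ENNReal.ofReal (V ^ (1 - 2 * β) * h ^ (2 * β)) := by
    rw [hVeq, hheq, ENNReal.ofReal_rpow_of_pos hV0, ENNReal.ofReal_rpow_of_pos hh0,
      ← ENNReal.ofReal_mul (by positivity)]
  have hC : (((B₁ + B₂).toNNReal : ℝ≥0) : ℝ≥0∞) = ENNReal.ofReal (B₁ + B₂) := rfl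
  rw [hprod, hC]
  constructor
  · intro u hu
    have key := betaIntegral_le_of_layer hn hΩ hu (a := 1) (A := K * h) (by positivity) ?_ hβ0
      (by linarith)
    · refine key.trans ?_
      rw [div_one, ← hVdef, ← ENNReal.ofReal_mul (by positivity)]
      apply ENNReal.ofReal_le_ofReal
      rw [Real.mul_rpow hK0.le hh0.le]
      calc _ = B₁ * (V ^ (1 - 2 * β) * h ^ (2 * β)) := by rw [hB₁]; ring
        _ ≤ _ := by
          gcongr
          linarith
    · intro r hr
      rw [Real.rpow_one]
      rcases lt_or_ge r (R * D) with hlt | hge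
      · refine (volume_layer_le hn hΩ hC₀ hreg hr hlt).trans ?_
        rw [hheq, ← ENNReal.ofReal_mul (by positivity)]
        apply ENNReal.ofReal_le_ofReal
        have : 4 ^ n * vb / C₀ ≤ K := by
          rw [hK, le_add_iff_nonneg_right]
          positivity
        calc 4 ^ n * vb / C₀ * r * h ≤ K * r * h := by gcongr
          _ = K * h * r := by ring
      · refine (measure_mono fun x hx => hx.1 : _ ≤ volume Ω).trans ?_
        rw [hVeq]
        apply ENNReal.ofReal_le_ofReal
        have h1 : vb / (R * (C₀ * (R / 2) ^ ((n : ℝ) - 1))) ≤ K := by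
          rw [hK, le_add_iff_nonneg_left]
          positivity
        calc V ≤ D ^ n * vb := hVle
          _ = vb / (R * (C₀ * (R / 2) ^ ((n : ℝ) - 1))) *
              (C₀ * (R / 2 * D) ^ ((n : ℝ) - 1)) * (R * D) := by
              rw [Real.mul_rpow (by positivity) hD.le, rpow_natCast_sub_one hD]
              field_simp
          _ ≤ K * h * r := by gcongr
  · rw [ENNReal.ofReal_rpow_of_pos hD, ← ENNReal.ofReal_mul (by positivity)]
    apply ENNReal.ofReal_le_ofReal
    calc V ^ (1 - 2 * β) * h ^ (2 * β)
        ≤ (D ^ n * vb) ^ (1 - 2 * β) * (H * D ^ ((n : ℝ) - 1)) ^ (2 * β) := by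
          have : 0 ≤ 1 - 2 * β := by linarith
          gcongr
      _ = B₂ * D ^ (n - 2 * β) := by
          have h1 : D ^ ((n : ℝ) - 2 * β) =
              (D ^ n) ^ (1 - 2 * β) * (D ^ ((n : ℝ) - 1)) ^ (2 * β) := by
            rw [← Real.rpow_natCast_mul hD.le, ← Real.rpow_mul hD.le, ← Real.rpow_add hD]
            congr 1
            ring
          rw [Real.mul_rpow (by positivity) hvb.le, Real.mul_rpow hH0.le (by positivity), h1, hB₂]
          ring
      _ ≤ _ := by
          gcongr
          linarith

/-- The quantitative estimate applies with `R = ρ / diam Ω`, and its second inequality shows that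
the bound in the first is finite. -/
theorem betaIntegral_lt_top_of_ahlforsRegular (hn : 1 ≤ n) {Ω : Set (EuclideanSpace ℝ (Fin n))}
    (hΩ : IsBoundedDomain Ω) (hreg : IsAhlforsRegular (frontier Ω)) {β : ℝ} (hβ0 : 0 < β)
    (hβ : β < 1 / 2) {u : EuclideanSpace ℝ (Fin n) → ℝ} (hu : IsSolution Ω u) :
    betaIntegral Ω u β < ⊤ := by
  obtain ⟨C₀, C₁, ρ, hC₀, hC₁, hρ, hreg⟩ := hreg
  have hD := hΩ.diam_pos hn
  obtain ⟨C, hC⟩ := exists_betaIntegral_le hn hβ0 hβ hC₀ hC₁ (div_pos hρ hD)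
  obtain ⟨h1, h2⟩ := hC Ω hΩ (by rwa [div_mul_cancel₀ _ hD.ne'])
  refine (h1 u hu).trans_lt (ENNReal.mul_lt_top ENNReal.coe_lt_top (h2.trans_lt ?_))
  refine ENNReal.mul_lt_top ENNReal.coe_lt_top ?_
  rw [ENNReal.ofReal_rpow_of_pos hD]
  exact ENNReal.ofReal_lt_top


/-! ### The maximum principle and uniqueness for the Dirichlet problem. -/

section MaximumPrinciple

variable {E : Type*} [NormedAddCommGroup E] [InnerProductSpace ℝ E]

/-- At a local maximum the second directional derivatives are nonpositive. -/
theorem iteratedFDeriv_two_nonpos_of_isLocalMax {f : E → ℝ} {y : E} (hf : ContDiffAt ℝ 2 f y)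
    (hmax : IsLocalMax f y) (v : E) : iteratedFDeriv ℝ 2 f y ![v, v] ≤ 0 := by
  rw [iteratedFDeriv_two_apply]
  simp only [Matrix.cons_val_zero, Matrix.cons_val_one]
  set ℓ : ℝ → E := fun t => y + t • v with hℓ
  have hℓ0 : ℓ 0 = y := by simp [hℓ]
  have hℓc : Continuous ℓ := by fun_prop
  have hℓd : ∀ t, HasDerivAt ℓ v t := fun t => by
    have h := ((hasDerivAt_id t).smul_const v).const_add y
    rw [one_smul] at h
    exact h
  set c : ℝ → ℝ := fun t => f (ℓ t) with hc
  have hcmax : IsLocalMax c 0 := by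
    have h1 : Tendsto ℓ (𝓝 0) (𝓝 y) := by simpa [hℓ0] using hℓc.tendsto 0
    have h2 : ∀ᶠ t in 𝓝 (0 : ℝ), f (ℓ t) ≤ f y := h1.eventually hmax
    simpa [IsLocalMax, IsMaxFilter, hc, hℓ0] using h2
  have hev : ∀ᶠ t in 𝓝 (0 : ℝ), DifferentiableAt ℝ f (ℓ t) := by
    have h1 : Tendsto ℓ (𝓝 0) (𝓝 y) := by simpa [hℓ0] using hℓc.tendsto 0
    apply h1.eventually
    filter_upwards [hf.eventually (by simp)] with z hz
    exact hz.differentiableAt (by simp)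
  have hd1 : deriv c =ᶠ[𝓝 0] fun t => fderiv ℝ f (ℓ t) v := by
    filter_upwards [hev] with t ht
    exact (ht.hasFDerivAt.comp_hasDerivAt t (hℓd t)).deriv
  have hd2 : deriv (deriv c) 0 = fderiv ℝ (fderiv ℝ f) y v v := by
    rw [hd1.deriv_eq]
    have h1 : DifferentiableAt ℝ (fderiv ℝ f) (ℓ 0) := by
      rw [hℓ0]
      exact (hf.fderiv_right (m := 1) (by norm_num)).differentiableAt (by simp)
    have h2 := (h1.hasFDerivAt.comp_hasDerivAt 0 (hℓd 0)).clm_apply (hasDerivAt_const (0 : ℝ) v)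
    simpa [hℓ0] using h2.deriv
  -- A positive second derivative at a critical point would make the local maximum a local minimum
  -- too, hence `c` locally constant with zero second derivative.
  by_contra! hpos
  rw [← hd2] at hpos
  have hcc : ContinuousAt c 0 := by
    have h1 : ContinuousAt f (ℓ 0) := by rw [hℓ0]; exact hf.continuousAt
    exact h1.comp hℓc.continuousAt
  have hmin := isLocalMin_of_deriv_deriv_pos hpos hcmax.deriv_eq_zero hcc
  have hconst : c =ᶠ[𝓝 0] fun _ => c 0 := by
    filter_upwards [hcmax, hmin] with t h1 h2
    exact le_antisymm h1 h2
  have : deriv (deriv c) 0 = 0 := by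
    have h1 : deriv c =ᶠ[𝓝 0] deriv fun _ => c 0 := hconst.deriv
    rw [h1.deriv_eq]
    simp
  linarith

theorem iteratedFDeriv_two_const_mul_norm_sq (ε : ℝ) (y v : E) :
    iteratedFDeriv ℝ 2 (fun x : E => ε * ‖x‖ ^ 2) y ![v, v] = 2 * ε * ‖v‖ ^ 2 := by
  rw [iteratedFDeriv_two_apply]
  have h1 : fderiv ℝ (fun x : E => ε * ‖x‖ ^ 2) = fun x => (ε • 2 • innerSL ℝ : E →L[ℝ] E →L[ℝ] ℝ) x := by
    ext1 x
    have : HasFDerivAt (fun x : E => ε * ‖x‖ ^ 2) _ x := ((hasFDerivAt_id x).norm_sq).const_mul ε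
    rw [this.fderiv]
    ext z
    simp only [smul_apply, ContinuousLinearMap.comp_apply,
      ContinuousLinearMap.id_apply, id]
  rw [h1, ContinuousLinearMap.fderiv]
  have h2 : innerSL ℝ v v = ‖v‖ ^ 2 := real_inner_self_eq_norm_sq v
  simp only [Matrix.cons_val_zero, Matrix.cons_val_one, smul_apply, h2,
    nsmul_eq_mul, smul_eq_mul]
  push_cast
  ring

/-- Maximum principle: a harmonic function, continuous up to the boundary of a bounded open set,
that is nonpositive on the boundary is nonpositive. -/
theorem harmonic_nonpos_of_frontier [FiniteDimensional ℝ E] [Nontrivial E] {Ω : Set E}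
    (hb : Bornology.IsBounded Ω) {g : E → ℝ} (hg : ContinuousOn g (closure Ω))
    (hh : InnerProductSpace.HarmonicOnNhd g Ω) (hfr : ∀ x ∈ frontier Ω, g x ≤ 0) :
    ∀ x ∈ closure Ω, g x ≤ 0 := by
  by_contra! hcon
  obtain ⟨x₀, hx₀, hpos⟩ := hcon
  have hK : IsCompact (closure Ω) := hb.isCompact_closure
  obtain ⟨M, hM⟩ := hb.closure.exists_norm_le
  -- Small enough that `ε‖x‖² < g x₀` on the closure: the maximum of `g + ε‖x‖²` is then interior,
  -- and there the Laplacian of `g` would be negative.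
  set ε : ℝ := g x₀ / (2 * (M ^ 2 + 1)) with hε
  have hε0 : 0 < ε := by positivity
  set q : E → ℝ := fun x => ε * ‖x‖ ^ 2 with hq
  have hqc : ContDiff ℝ 2 q := contDiff_const.mul (contDiff_id.norm_sq ℝ)
  obtain ⟨y, hy, hmax⟩ := hK.exists_isMaxOn ⟨x₀, hx₀⟩ (hg.add hqc.continuous.continuousOn)
  have hqle : ∀ x ∈ closure Ω, q x < g x₀ := by
    intro x hx
    have h1 : ‖x‖ ^ 2 ≤ M ^ 2 := by
      have := hM x hx
      have := norm_nonneg x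
      nlinarith
    calc q x ≤ ε * M ^ 2 := by simp only [hq]; gcongr
      _ < ε * (2 * (M ^ 2 + 1)) := by gcongr; nlinarith [sq_nonneg M]
      _ = g x₀ := by rw [hε]; field_simp
  have hyΩ : y ∈ interior Ω := by
    by_contra h
    have h1 := hfr y ⟨hy, h⟩
    have h2 : g x₀ + q x₀ ≤ g y + q y := hmax hx₀
    have h3 := hqle y hy
    have h4 : 0 ≤ q x₀ := by positivity
    linarith
  have hharm := hh y (interior_subset hyΩ)
  have hlm : IsLocalMax (g + q) y :=
    hmax.isLocalMax (Filter.mem_of_superset (isOpen_interior.mem_nhds hyΩ)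
      (interior_subset.trans subset_closure))
  set b := stdOrthonormalBasis ℝ E
  have hsum : ∑ i, iteratedFDeriv ℝ 2 g y ![b i, b i] = 0 := by
    have h1 := hharm.2.self_of_nhds
    rwa [InnerProductSpace.laplacian_eq_iteratedFDeriv_orthonormalBasis g b] at h1
  have hle : ∀ i, iteratedFDeriv ℝ 2 g y ![b i, b i] ≤ -(2 * ε) := by
    intro i
    have h1 := iteratedFDeriv_two_nonpos_of_isLocalMax (f := g + q) (hharm.1.add hqc.contDiffAt) hlm (b i)
    rw [iteratedFDeriv_add_apply hharm.1 hqc.contDiffAt, add_apply,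
      iteratedFDeriv_two_const_mul_norm_sq, b.norm_eq_one] at h1
    linarith
  have hn : 0 < Module.finrank ℝ E := Module.finrank_pos
  have := Finset.sum_le_sum fun i (_ : i ∈ Finset.univ) => hle i
  rw [hsum, Finset.sum_const, Finset.card_univ, Fintype.card_fin, nsmul_eq_mul] at this
  have : (0 : ℝ) < Module.finrank ℝ E := by exact_mod_cast hn
  nlinarith

end MaximumPrinciple

theorem isDirichletSolution_unique {n : ℕ} (hn : 1 ≤ n) {Ω : Set (EuclideanSpace ℝ (Fin n))}
    (hΩ : IsBoundedDomain Ω) {f h h' : EuclideanSpace ℝ (Fin n) → ℝ}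
    (hh : IsDirichletSolution Ω f h) (hh' : IsDirichletSolution Ω f h') :
    EqOn h' h (closure Ω) := by
  have : Nonempty (Fin n) := ⟨⟨0, hn⟩⟩
  have key : ∀ a b : EuclideanSpace ℝ (Fin n) → ℝ, IsDirichletSolution Ω f a →
      IsDirichletSolution Ω f b → ∀ x ∈ closure Ω, a x ≤ b x := by
    intro a b ha hb x hx
    have := harmonic_nonpos_of_frontier hΩ.isBounded (ha.continuousOn.sub hb.continuousOn)
      (ha.harmonic.sub hb.harmonic)
      (fun y hy => by simp [ha.boundary hy, hb.boundary hy]) x hx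
    simpa using this
  exact fun x hx => le_antisymm (key h' h hh' hh x hx) (key h h' hh hh' x hx)

/-! ### The Dirichlet problem in the disc and its transfer to plane domains. -/

/-- The Poisson integral solves the Dirichlet problem in the unit disc. -/
theorem exists_disc_dirichlet {g : ℂ → ℝ} (hg : Continuous g) :
    ∃ F : ℂ → ℂ, ∃ H : ℂ → ℝ, AnalyticOnNhd ℂ F (Metric.ball 0 1) ∧
      ContinuousOn H (Metric.closedBall 0 1) ∧ (∀ z ∈ Metric.ball (0 : ℂ) 1, H z = (F z).re) ∧
      ∀ z ∈ Metric.sphere (0 : ℂ) 1, H z = g z := by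
  classical
  have hci : ∀ f : ℂ → ℝ, Continuous f → CircleIntegrable f 0 1 := fun f hf =>
    hf.continuousOn.circleIntegrable zero_le_one
  have hgi : CircleIntegrable (fun ζ => (g ζ : ℂ)) 0 1 :=
    (Complex.continuous_ofReal.comp hg).continuousOn.circleIntegrable zero_le_one
  -- The Herglotz integral exhibits the Poisson integral as the real part of an analytic function,
  -- so composition with an analytic map remains harmonic.
  set F : ℂ → ℂ := fun w => Real.circleAverage
    (fun ζ => herglotzRieszKernel 0 w ζ • (g ζ : ℂ)) 0 1 with hF
  have hFa : AnalyticOnNhd ℂ F (Metric.ball 0 1) :=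
    analyticOnNhd_circleAverage_herglotzRieszKernel_smul hgi
  have hFre : ∀ w ∈ Metric.ball (0 : ℂ) 1, (F w).re =
      Real.circleAverage (poissonKernel 0 w • g) 0 1 := fun w hw => by
    rw [poissonKernel_eq_re_herglotzRieszKernel]
    exact re_circleAverage_herglotzRieszKernel_smul (hci g hg) hw
  have hPone : ∀ w ∈ Metric.ball (0 : ℂ) 1, ∀ a : ℝ,
      Real.circleAverage (poissonKernel 0 w • fun _ => a) 0 1 = a := fun w hw a =>
    InnerProductSpace.HarmonicContOnCl.circleAverage_poissonKernel_smul
      (InnerProductSpace.harmonicContOnCl_const (c := a)) hw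
  have hPcont : ∀ w ∈ Metric.ball (0 : ℂ) 1, ContinuousOn (poissonKernel 0 w)
      (Metric.sphere 0 1) := by
    intro w hw
    rw [poissonKernel_eq_re_herglotzRieszKernel]
    have := continuousOn_herglotzRieszKernel_sphere hw
    rw [abs_one] at this
    exact Complex.continuous_re.comp_continuousOn this
  have hPint : ∀ w ∈ Metric.ball (0 : ℂ) 1, ∀ f : ℂ → ℝ, Continuous f →
      CircleIntegrable (poissonKernel 0 w • f) 0 1 := fun w hw f hf =>
    ((hPcont w hw).smul hf.continuousOn).circleIntegrable zero_le_one
  set H : ℂ → ℝ := fun z => if z ∈ Metric.ball (0 : ℂ) 1 then (F z).re else g z with hH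
  have hHb : ∀ z ∈ Metric.ball (0 : ℂ) 1, H z = (F z).re := fun z hz => if_pos hz
  have hHs : ∀ z, z ∉ Metric.ball (0 : ℂ) 1 → H z = g z := fun z hz => if_neg hz
  refine ⟨F, H, hFa, ?_, hHb, fun z hz => hHs z fun h => ?_⟩
  · obtain ⟨M, hM⟩ : ∃ M, ∀ ζ ∈ Metric.closedBall (0 : ℂ) 1, ‖g ζ‖ ≤ M :=
      (isCompact_closedBall 0 1).exists_bound_of_continuousOn hg.continuousOn
    intro z₀ hz₀
    by_cases hz₀b : z₀ ∈ Metric.ball (0 : ℂ) 1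
    · apply ContinuousAt.continuousWithinAt
      have h1 : H =ᶠ[𝓝 z₀] fun z => (F z).re := by
        filter_upwards [Metric.isOpen_ball.mem_nhds hz₀b] with z hz
        exact hHb z hz
      exact (Complex.continuous_re.continuousAt.comp (hFa z₀ hz₀b).continuousAt).congr h1.symm
    · have hz₀s : ‖z₀‖ = 1 := by
        simp only [Metric.mem_closedBall, Metric.mem_ball, dist_zero_right, not_lt] at hz₀ hz₀b
        linarith
      have hM0 : 0 ≤ M := (norm_nonneg _).trans (hM z₀ hz₀)
      rw [Metric.continuousWithinAt_iff]
      intro ε hε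
      obtain ⟨δ, hδ, hgδ⟩ := Metric.continuous_iff.1 hg z₀ (ε / 2) (by positivity)
      set c : ℝ := 2 * M * (4 / δ ^ 2) with hc
      have hc0 : 0 ≤ c := by positivity
      obtain ⟨η, hη, hηc⟩ : ∃ η, 0 < η ∧ c * (2 * η) < ε / 2 := by
        refine ⟨ε / (8 * (c + 1)), by positivity, ?_⟩
        have h1 : c * (2 * (ε / (8 * (c + 1)))) = (c / (c + 1)) * (ε / 4) := by
          field_simp; ring
        rw [h1]
        have h2 : c / (c + 1) ≤ 1 := (div_le_one (by positivity)).2 (by linarith)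
        nlinarith
      -- `δ/2` keeps circle points that are `δ`-far from `z₀` at distance at least `δ/2` from `w`;
      -- `η` gives `1 - ‖w‖² ≤ 2η`, so the kernel is small at those points.
      refine ⟨min (δ / 2) η, by positivity, fun {w} hw hwz => ?_⟩
      rw [lt_min_iff] at hwz
      rw [hHs z₀ hz₀b]
      by_cases hwb : w ∈ Metric.ball (0 : ℂ) 1
      · rw [hHb w hwb, hFre w hwb, Real.dist_eq]
        have hw1 : ‖w‖ < 1 := by simpa using hwb
        have h1w : 1 - ‖w‖ ^ 2 ≤ 2 * η := by
          have h1 : 1 - ‖w‖ ≤ dist w z₀ := by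
            rw [← hz₀s, dist_comm, dist_eq_norm]
            exact norm_sub_norm_le z₀ w
          nlinarith [norm_nonneg w]
        -- The Poisson kernel has mean one, so the constant `g z₀` can be moved under the average.
        have hdiff : Real.circleAverage (poissonKernel 0 w • g) 0 1 - g z₀ =
            Real.circleAverage (poissonKernel 0 w • fun ζ => g ζ - g z₀) 0 1 := by
          conv_lhs => rw [← hPone w hwb (g z₀)]
          rw [← Real.circleAverage_sub (hPint w hwb g hg) (hPint w hwb _ continuous_const)]
          congr 1
          ext ζ
          simp [mul_sub]
        rw [hdiff]
        have hpt : ∀ ζ ∈ Metric.sphere (0 : ℂ) |1|,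
            |(poissonKernel 0 w • fun ζ : ℂ => g ζ - g z₀) ζ| ≤
            ((poissonKernel 0 w • fun _ : ℂ => ε / 2) + fun _ : ℂ => c * (2 * η)) ζ := by
          intro ζ hζ
          have hζ1 : ‖ζ‖ = 1 := by simpa using hζ
          have hP0 : 0 ≤ poissonKernel 0 w ζ := by
            rw [poissonKernel_def]
            simp only [sub_zero, hζ1]
            have : 0 ≤ 1 ^ 2 - ‖w‖ ^ 2 := by nlinarith [norm_nonneg w]
            positivity
          simp only [Pi.smul_apply', Pi.add_apply, Pi.mul_apply, smul_eq_mul, abs_mul, abs_of_nonneg hP0]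
          rcases lt_or_ge (dist ζ z₀) δ with h | h
          · have h1 := hgδ ζ h
            rw [Real.dist_eq] at h1
            have h2 := mul_le_mul_of_nonneg_left h1.le hP0
            have h3 : 0 ≤ c * (2 * η) := by positivity
            linarith
          · have h1 : |g ζ - g z₀| ≤ 2 * M := by
              have h2 := hM ζ (by simp [hζ1])
              have h3 := hM z₀ hz₀
              have := norm_sub_le (g ζ) (g z₀)
              rw [Real.norm_eq_abs] at this
              linarith
            have h2 : δ / 2 ≤ ‖ζ - w‖ := by
              have h3 := dist_triangle ζ w z₀
              rw [← dist_eq_norm]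
              linarith
            have h4 : poissonKernel 0 w ζ ≤ 2 * η * (4 / δ ^ 2) := by
              rw [poissonKernel_def]
              simp only [sub_zero, hζ1, one_pow]
              calc (1 - ‖w‖ ^ 2) / ‖ζ - w‖ ^ 2 ≤ (2 * η) / (δ / 2) ^ 2 := by gcongr
                _ = _ := by field_simp; ring
            have h5 : poissonKernel 0 w ζ * |g ζ - g z₀| ≤ 2 * η * (4 / δ ^ 2) * (2 * M) := by
              gcongr
            have h6 : 0 ≤ poissonKernel 0 w ζ * (ε / 2) := by positivity
            have h7 : c * (2 * η) = 2 * η * (4 / δ ^ 2) * (2 * M) := by rw [hc]; ring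
            linarith
        have hint := hPint w hwb (fun ζ => g ζ - g z₀) (hg.sub continuous_const)
        calc |Real.circleAverage (poissonKernel 0 w • fun ζ => g ζ - g z₀) 0 1|
            ≤ Real.circleAverage |poissonKernel 0 w • fun ζ => g ζ - g z₀| 0 1 :=
              Real.abs_circleAverage_le_circleAverage_abs
          _ ≤ Real.circleAverage ((poissonKernel 0 w • fun _ : ℂ => ε / 2) +
                fun _ : ℂ => c * (2 * η)) 0 1 :=
              Real.circleAverage_mono hint.abs
                ((hPint w hwb _ continuous_const).add (hci _ continuous_const)) hpt
          _ = ε / 2 + c * (2 * η) := by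
              rw [Real.circleAverage_add (hPint w hwb _ continuous_const)
                (hci _ continuous_const), hPone w hwb, Real.circleAverage_const]
          _ < ε := by linarith
      · rw [hHs w hwb]
        have := hgδ w (by linarith [hwz.1])
        linarith
  · simp only [Metric.mem_sphere, Metric.mem_ball, dist_zero_right] at hz h
    linarith

/-- Harmonicity is invariant under linear isometries. -/
theorem harmonicAt_comp_symm {E F : Type*} [NormedAddCommGroup E] [InnerProductSpace ℝ E]
    [FiniteDimensional ℝ E] [NormedAddCommGroup F] [InnerProductSpace ℝ F]
    [FiniteDimensional ℝ F] (e : E ≃ₗᵢ[ℝ] F) {f : E → ℝ} {x : F}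
    (hf : InnerProductSpace.HarmonicAt f (e.symm x)) :
    InnerProductSpace.HarmonicAt (fun y => f (e.symm y)) x := by
  refine ⟨hf.1.comp x e.symm.contDiff.contDiffAt, ?_⟩
  set b := stdOrthonormalBasis ℝ E
  have h1 : ∀ y, Laplacian.laplacian (fun y => f (e.symm y)) y =
      Laplacian.laplacian f (e.symm y) := by
    intro y
    rw [InnerProductSpace.laplacian_eq_iteratedFDeriv_orthonormalBasis f b,
      InnerProductSpace.laplacian_eq_iteratedFDeriv_orthonormalBasis _ (b.map e)]
    refine Finset.sum_congr rfl fun i _ => ?_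
    have h2 := e.symm.toContinuousLinearEquiv.iteratedFDerivWithin_comp_right (𝕜 := ℝ) f
      uniqueDiffOn_univ (x := y) (mem_univ _) 2
    simp only [preimage_univ, iteratedFDerivWithin_univ] at h2
    have h3 : iteratedFDeriv ℝ 2 (fun y => f (e.symm y)) y = _ := h2
    rw [h3]
    simp only [ContinuousMultilinearMap.compContinuousLinearMap_apply]
    congr 1
    ext j
    fin_cases j <;> simp
  have h4 : Tendsto e.symm (𝓝 x) (𝓝 (e.symm x)) := e.symm.continuous.tendsto x
  filter_upwards [h4.eventually hf.2] with y hy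
  rw [h1, hy]
  rfl


/-- The standard isometry from the complex plane to the Euclidean plane. -/
noncomputable def planeIso : ℂ ≃ₗᵢ[ℝ] EuclideanSpace ℝ (Fin 2) := Complex.orthonormalBasisOneI.repr

theorem planeIso_apply_zero (z : ℂ) : planeIso z 0 = z.re := by
  simp [planeIso, Complex.orthonormalBasisOneI]

theorem planeIso_apply_one (z : ℂ) : planeIso z 1 = z.im := by
  simp [planeIso, Complex.orthonormalBasisOneI]

/-- A plane domain is regular for the Dirichlet problem if it is mapped analytically into the unit
disc by a map that extends continuously to the closure and is injective from the boundary to the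
unit circle. -/
theorem isDirichletRegular_of_disc_map {Ω : Set (EuclideanSpace ℝ (Fin 2))}
    (hΩ : IsBoundedDomain Ω) {Ψ : EuclideanSpace ℝ (Fin 2) → ℂ}
    (hcont : ContinuousOn Ψ (closure Ω)) (hin : ∀ x ∈ Ω, Ψ x ∈ Metric.ball (0 : ℂ) 1)
    (hfr : ∀ x ∈ frontier Ω, Ψ x ∈ Metric.sphere (0 : ℂ) 1) (hinj : InjOn Ψ (frontier Ω))
    (han : ∀ x ∈ Ω, AnalyticAt ℂ (fun z => Ψ (planeIso z)) (planeIso.symm x)) :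
    IsDirichletRegular Ω := by
  intro f hf
  have hK : IsCompact (frontier Ω) :=
    hΩ.isBounded.isCompact_closure.of_isClosed_subset isClosed_frontier frontier_subset_closure
  have : CompactSpace (frontier Ω) := isCompact_iff_compactSpace.1 hK
  have hemb : IsClosedEmbedding ((frontier Ω).domRestrict Ψ) :=
    (hcont.mono frontier_subset_closure).domRestrict.isClosedEmbedding hinj.injective
  -- `Ψ` embeds the compact frontier as a closed set, so Tietze's theorem extends the transported
  -- boundary datum to a continuous function on `ℂ`.
  obtain ⟨g, hg⟩ := ContinuousMap.exists_extension hemb ⟨(frontier Ω).domRestrict f, hf.domRestrict⟩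
  have hgf : ∀ x ∈ frontier Ω, g (Ψ x) = f x := fun x hx =>
    congrArg (fun φ : C(frontier Ω, ℝ) => φ ⟨x, hx⟩) hg
  obtain ⟨F, H, hF, hH, hHF, hHg⟩ := exists_disc_dirichlet g.continuous
  have hmaps : MapsTo Ψ (closure Ω) (Metric.closedBall 0 1) := by
    intro x hx
    by_cases hxΩ : x ∈ Ω
    · exact Metric.ball_subset_closedBall (hin x hxΩ)
    · refine Metric.sphere_subset_closedBall (hfr x ?_)
      rw [hΩ.isOpen.frontier_eq]
      exact ⟨hx, hxΩ⟩
  have hsol : IsDirichletSolution Ω f (fun x => H (Ψ x)) := by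
    refine ⟨hH.comp hcont hmaps, fun x hx => ?_, fun x hx => ?_⟩
    · have h1 : AnalyticAt ℂ (fun z => F (Ψ (planeIso z))) (planeIso.symm x) := by
        refine AnalyticAt.fun_comp ?_ (han x hx)
        rw [LinearIsometryEquiv.apply_symm_apply]
        exact hF _ (hin x hx)
      have h2 := harmonicAt_comp_symm planeIso h1.harmonicAt_re
      refine (InnerProductSpace.harmonicAt_congr_nhds ?_).1 h2
      filter_upwards [hΩ.isOpen.mem_nhds hx] with y hy
      simp [hHF _ (hin y hy)]
    · simp only [hHg _ (hfr x hx), hgf x hx]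
  exact ⟨_, hsol, fun h' hh' => isDirichletSolution_unique one_le_two hΩ hsol hh'⟩

/-! ### Length estimates for connected sets and bi-Lipschitz arcs. -/

section Hausdorff

variable {X : Type*} [MetricSpace X] [MeasurableSpace X] [BorelSpace X]

/-- A connected set has length at least `r` in a ball of radius `r` that it leaves. -/
theorem le_hausdorffMeasure_ball_inter {S : Set X} (hS : IsPreconnected S) {x y : X} (hx : x ∈ S)
    (hy : y ∈ S) {r : ℝ} (hr : r ≤ dist x y) :
    ENNReal.ofReal r ≤ Measure.hausdorffMeasure 1 (Metric.ball x r ∩ S) := by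
  -- On a connected set leaving the ball, the distance to `x` takes every value in `[0, r)`; being
  -- 1-Lipschitz, it does not increase length.
  have hsub : Ico 0 r ⊆ (fun z => dist z x) '' (Metric.ball x r ∩ S) := by
    intro t ht
    have hmem : t ∈ Icc (dist x x) (dist y x) := by
      rw [dist_self, dist_comm]
      exact ⟨ht.1, ht.2.le.trans hr⟩
    obtain ⟨z, hz, hzt⟩ := hS.intermediate_value hx hy
      (continuous_id.dist continuous_const).continuousOn hmem
    refine ⟨z, ⟨?_, hz⟩, hzt⟩
    have : dist z x = t := hzt
    rw [Metric.mem_ball, this]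
    exact ht.2
  have hlip : LipschitzOnWith 1 (fun z => dist z x) (Metric.ball x r ∩ S) :=
    (LipschitzWith.dist_left x).lipschitzOnWith
  calc ENNReal.ofReal r = Measure.hausdorffMeasure 1 (Ico (0 : ℝ) r) := by
        rw [hausdorffMeasure_real, Real.volume_Ico, sub_zero]
    _ ≤ Measure.hausdorffMeasure 1 ((fun z => dist z x) '' (Metric.ball x r ∩ S)) :=
        measure_mono hsub
    _ ≤ _ := by simpa using hlip.hausdorffMeasure_image_le zero_le_one

/-- A set with a Lipschitz coordinate whose inverse is Lipschitz has length `O(r)` in balls of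
radius `r`. -/
theorem hausdorffMeasure_ball_inter_le {S : Set X} {p : X → ℝ} {L L' : ℝ} (hL : 0 ≤ L)
    (hL' : 0 ≤ L') (hp : ∀ a ∈ S, ∀ b ∈ S, |p a - p b| ≤ L * dist a b)
    (hq : ∀ a ∈ S, ∀ b ∈ S, dist a b ≤ L' * |p a - p b|) (x : X) (r : ℝ) :
    Measure.hausdorffMeasure 1 (Metric.ball x r ∩ S) ≤ ENNReal.ofReal (4 * L * L' * r) := by
  rcases (Metric.ball x r ∩ S).eq_empty_or_nonempty with h | ⟨a, ha⟩
  · simp [h]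
  set T := Metric.ball x r ∩ S with hT
  have : Nonempty X := ⟨a⟩
  have hinj : InjOn p T := fun b hb c hc hbc => by
    have := hq b hb.2 c hc.2
    rw [hbc, sub_self, abs_zero, mul_zero] at this
    exact dist_le_zero.1 this
  have hinv : Function.invFunOn p T '' (p '' T) = T := by
    ext b
    constructor
    · rintro ⟨_, ⟨c, hc, rfl⟩, rfl⟩
      rwa [hinj.leftInvOn_invFunOn hc]
    · intro hb
      exact ⟨p b, ⟨b, hb, rfl⟩, hinj.leftInvOn_invFunOn hb⟩
  have hlip : LipschitzOnWith L'.toNNReal (Function.invFunOn p T) (p '' T) := by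
    apply LipschitzOnWith.of_dist_le_mul
    rintro _ ⟨b, hb, rfl⟩ _ ⟨c, hc, rfl⟩
    rw [hinj.leftInvOn_invFunOn hb, hinj.leftInvOn_invFunOn hc, Real.coe_toNNReal _ hL',
      Real.dist_eq]
    exact hq b hb.2 c hc.2
  -- Points of `T` are at most `2r` apart, so the coordinate ranges over an interval of length
  -- `4Lr`, which the inverse stretches by at most `L'`.
  have hsub : p '' T ⊆ Icc (p a - 2 * L * r) (p a + 2 * L * r) := by
    rintro _ ⟨b, hb, rfl⟩
    have h1 := hp b hb.2 a ha.2
    have h2 : dist b a ≤ 2 * r := by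
      have h3 := Metric.mem_ball.1 hb.1
      have h4 := Metric.mem_ball'.1 ha.1
      linarith [dist_triangle b x a]
    have h5 : |p b - p a| ≤ 2 * L * r := by nlinarith
    rw [abs_le] at h5
    constructor <;> linarith
  calc Measure.hausdorffMeasure 1 T
      = Measure.hausdorffMeasure 1 (Function.invFunOn p T '' (p '' T)) := by rw [hinv]
    _ ≤ (L'.toNNReal : ℝ≥0∞) * Measure.hausdorffMeasure 1 (p '' T) := by
        simpa using hlip.hausdorffMeasure_image_le zero_le_one
    _ ≤ ENNReal.ofReal L' * ENNReal.ofReal (4 * L * r) := by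
        rw [hausdorffMeasure_real]
        have h1 := measure_mono (μ := (volume : Measure ℝ)) hsub
        rw [Real.volume_Icc] at h1
        have h2 : p a + 2 * L * r - (p a - 2 * L * r) = 4 * L * r := by ring
        rw [h2] at h1
        exact mul_le_mul_right h1 _
    _ = _ := by
        rw [← ENNReal.ofReal_mul hL']
        congr 1
        ring

end Hausdorff

/-- Transfer of Ahlfors regularity from the complex plane. -/
theorem isAhlforsRegular_image_planeIso {S : Set ℂ} {C₀ C₁ R : ℝ} (hC₀ : 0 < C₀) (hC₁ : 0 < C₁)
    (hR : 0 < R) (h : ∀ x ∈ S, ∀ r : ℝ, 0 < r → r < R →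
      ENNReal.ofReal (C₀ * r) ≤ Measure.hausdorffMeasure 1 (Metric.ball x r ∩ S) ∧
      Measure.hausdorffMeasure 1 (Metric.ball x r ∩ S) ≤ ENNReal.ofReal (C₁ * r)) :
    IsAhlforsRegular (planeIso '' S) := by
  refine ⟨C₀, C₁, R, hC₀, hC₁, hR, ?_⟩
  rintro _ ⟨x, hx, rfl⟩ r hr0 hr
  have h1 : Metric.ball (planeIso x) r ∩ planeIso '' S = planeIso '' (Metric.ball x r ∩ S) := by
    rw [image_inter planeIso.injective, LinearIsometryEquiv.image_ball]
  have h2 : ((2 : ℕ) : ℝ) - 1 = 1 := by norm_num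
  rw [h1, surfaceMeasure, h2, Real.rpow_one,
    planeIso.isometry.hausdorffMeasure_image (Or.inl zero_le_one)]
  exact h x hx r hr0 hr


/-! ### The cusp domain and its closure. -/

/-- The branch of `w ↦ w ^ (-1/m)` on the slit plane. -/
noncomputable def negRoot (m : ℕ) (w : ℂ) : ℂ := Complex.exp (-(Complex.log w) / m)

/-- The half strip `{a + ib : A < a, |b| < π / 2}`. -/
def halfStrip (A : ℝ) : Set ℂ := Ioi A ×ℂ Ioo (-(Real.pi / 2)) (Real.pi / 2)

/-- The closed half strip `{a + ib : A ≤ a, |b| ≤ π / 2}`. -/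
def closedHalfStrip (A : ℝ) : Set ℂ := Ici A ×ℂ Icc (-(Real.pi / 2)) (Real.pi / 2)

/-- A planar domain with a cusp of order `m + 1` at the origin: the image of a half strip under
`w ↦ w ^ (-1/m)`. -/
def cusp (m : ℕ) (A : ℝ) : Set ℂ := negRoot m '' halfStrip A

theorem halfStrip_subset_closedHalfStrip (A : ℝ) : halfStrip A ⊆ closedHalfStrip A :=
  fun w hw => ⟨(show A < w.re from hw.1).le, Ioo_subset_Icc_self hw.2⟩

theorem closure_halfStrip (A : ℝ) : closure (halfStrip A) = closedHalfStrip A := by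
  rw [halfStrip, Complex.closure_reProdIm, closure_Ioi, closure_Ioo (by linarith [Real.pi_pos])]
  rfl

theorem convex_reProdIm {s t : Set ℝ} (hs : Convex ℝ s) (ht : Convex ℝ t) : Convex ℝ (s ×ℂ t) :=
  (hs.linear_preimage Complex.reLm).inter (ht.linear_preimage Complex.imLm)

theorem isOpen_halfStrip (A : ℝ) : IsOpen (halfStrip A) := isOpen_Ioi.reProdIm isOpen_Ioo

section

variable {m : ℕ} {A : ℝ}

/-- The map `z ↦ z^{-m}` recovers `w` with no branch ambiguity; injectivity, the closure and the
disc map are all obtained through it. -/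
theorem inv_pow_negRoot (hm : 1 ≤ m) {w : ℂ} (hw : w ≠ 0) : ((negRoot m w) ^ m)⁻¹ = w := by
  have : (m : ℂ) ≠ 0 := by exact_mod_cast (by omega : m ≠ 0)
  rw [negRoot, ← Complex.exp_nat_mul, ← Complex.exp_neg,
    show -((m : ℂ) * (-Complex.log w / m)) = Complex.log w by field_simp, Complex.exp_log hw]

theorem negRoot_ne_zero (m : ℕ) (w : ℂ) : negRoot m w ≠ 0 := Complex.exp_ne_zero _

theorem norm_negRoot (m : ℕ) (w : ℂ) : ‖negRoot m w‖ = Real.exp (-Real.log ‖w‖ / m) := by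
  rw [negRoot, Complex.norm_exp]
  congr 1
  rw [← Complex.ofReal_natCast, Complex.div_ofReal_re, Complex.neg_re, Complex.log_re]

theorem norm_negRoot_le_one (m : ℕ) {w : ℂ} (hw : 1 ≤ ‖w‖) : ‖negRoot m w‖ ≤ 1 := by
  rw [norm_negRoot, Real.exp_le_one_iff]
  have := Real.log_nonneg hw
  apply div_nonpos_of_nonpos_of_nonneg <;> [linarith; positivity]

theorem hasStrictDerivAt_negRoot (m : ℕ) {w : ℂ} (hw : w ∈ Complex.slitPlane) :
    HasStrictDerivAt (negRoot m) (negRoot m w * (-w⁻¹ / m)) w :=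
  (((Complex.hasStrictDerivAt_log hw).neg).div_const (m : ℂ)).cexp

theorem mem_slitPlane_of_mem (hA : 0 < A) {w : ℂ} (hw : w ∈ closedHalfStrip A) :
    w ∈ Complex.slitPlane := Or.inl (hA.trans_le hw.1)

theorem ne_zero_of_mem (hA : 0 < A) {w : ℂ} (hw : w ∈ closedHalfStrip A) : w ≠ 0 :=
  Complex.slitPlane_ne_zero (mem_slitPlane_of_mem hA hw)

theorem le_norm_of_mem {w : ℂ} (hw : w ∈ closedHalfStrip A) : A ≤ ‖w‖ :=
  le_trans hw.1 (Complex.re_le_norm w)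

theorem continuousAt_negRoot (m : ℕ) (hA : 0 < A) {w : ℂ} (hw : w ∈ closedHalfStrip A) :
    ContinuousAt (negRoot m) w :=
  (hasStrictDerivAt_negRoot m (mem_slitPlane_of_mem hA hw)).hasDerivAt.continuousAt

theorem continuousOn_negRoot (m : ℕ) (hA : 0 < A) : ContinuousOn (negRoot m) (closedHalfStrip A) :=
  fun _ hw => (continuousAt_negRoot m hA hw).continuousWithinAt

theorem injOn_negRoot (hm : 1 ≤ m) (hA : 0 < A) : InjOn (negRoot m) (closedHalfStrip A) := by
  intro w hw w' hw' h
  rw [← inv_pow_negRoot hm (ne_zero_of_mem hA hw), h, inv_pow_negRoot hm (ne_zero_of_mem hA hw')]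

theorem isOpen_cusp (hm : 1 ≤ m) (hA : 0 < A) : IsOpen (cusp m A) := by
  rw [isOpen_iff_mem_nhds]
  rintro _ ⟨w, hw, rfl⟩
  have hw' := halfStrip_subset_closedHalfStrip A hw
  have hm' : (m : ℂ) ≠ 0 := by exact_mod_cast (by omega : m ≠ 0)
  rw [← (hasStrictDerivAt_negRoot m (mem_slitPlane_of_mem hA hw')).map_nhds_eq
    (mul_ne_zero (negRoot_ne_zero m w)
      (div_ne_zero (neg_ne_zero.2 (inv_ne_zero (ne_zero_of_mem hA hw'))) hm'))]
  exact image_mem_map ((isOpen_halfStrip A).mem_nhds hw)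

theorem ofReal_mem_halfStrip {t : ℝ} (ht : A < t) : (t : ℂ) ∈ halfStrip A := by
  refine ⟨by simpa using ht, ?_⟩
  simp [Real.pi_pos]

theorem isConnected_cusp (m : ℕ) (hA : 0 < A) : IsConnected (cusp m A) := by
  refine IsConnected.image ⟨⟨_, ofReal_mem_halfStrip (lt_add_one A)⟩, ?_⟩ _
    ((continuousOn_negRoot m hA).mono (halfStrip_subset_closedHalfStrip A))
  exact (convex_reProdIm (convex_Ioi A) (convex_Ioo _ _)).isPreconnected

theorem isBounded_cusp (m : ℕ) (hA : 1 ≤ A) : Bornology.IsBounded (cusp m A) := by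
  refine (Metric.isBounded_closedBall (x := (0 : ℂ)) (r := 1)).subset ?_
  rintro _ ⟨w, hw, rfl⟩
  rw [mem_closedBall_zero_iff]
  exact norm_negRoot_le_one m (hA.trans (le_norm_of_mem (halfStrip_subset_closedHalfStrip A hw)))

theorem tendsto_negRoot (hm : 1 ≤ m) : Tendsto (negRoot m) (Bornology.cobounded ℂ) (𝓝 0) := by
  rw [tendsto_zero_iff_norm_tendsto_zero]
  simp_rw [norm_negRoot]
  refine Real.tendsto_exp_atBot.comp ?_
  have h1 : Tendsto (fun w : ℂ => Real.log ‖w‖) (Bornology.cobounded ℂ) atTop :=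
    Real.tendsto_log_atTop.comp tendsto_norm_cobounded_atTop
  exact (tendsto_neg_atTop_atBot.comp h1).atBot_div_const (by exact_mod_cast hm)

theorem tendsto_ofReal_add_cobounded (c : ℂ) :
    Tendsto (fun t : ℝ => (t : ℂ) + c) atTop (Bornology.cobounded ℂ) := by
  rw [← tendsto_norm_atTop_iff_cobounded]
  refine tendsto_atTop_mono (fun t => ?_) (tendsto_atTop_add_const_right _ c.re tendsto_id)
  simpa using Complex.re_le_norm (t + c)

/-- Near a nonzero limit point `z ↦ z^{-m}` is continuous, so `z^{-m}` lies in the closed half strip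
and the identity `negRoot m (z^{-m}) = z` survives the limit. The only other limit is the vertex,
reached as `w → ∞`. -/
theorem closure_cusp (hm : 1 ≤ m) (hA : 0 < A) :
    closure (cusp m A) = insert 0 (negRoot m '' closedHalfStrip A) := by
  refine Subset.antisymm (fun z hz => ?_) (insert_subset ?_ ?_)
  · rcases eq_or_ne z 0 with rfl | hz0
    · exact mem_insert _ _
    have hP : ContinuousAt (fun z : ℂ => (z ^ m)⁻¹) z :=
      (continuous_pow m).continuousAt.inv₀ (pow_ne_zero _ hz0)
    have h1 : (z ^ m)⁻¹ ∈ closedHalfStrip A := by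
      rw [← closure_halfStrip]
      refine closure_mono ?_ (hP.continuousWithinAt.mem_closure_image hz)
      rintro _ ⟨_, ⟨w, hw, rfl⟩, rfl⟩
      simpa [inv_pow_negRoot hm (ne_zero_of_mem hA (halfStrip_subset_closedHalfStrip A hw))] using hw
    have hQ : ContinuousAt (fun z : ℂ => negRoot m (z ^ m)⁻¹ - z) z :=
      (ContinuousAt.comp (f := fun z : ℂ => (z ^ m)⁻¹) (continuousAt_negRoot m hA h1) hP).sub
        continuousAt_id
    have h2 : negRoot m (z ^ m)⁻¹ - z ∈ ({0} : Set ℂ) := by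
      rw [← closure_singleton]
      refine closure_mono ?_ (hQ.continuousWithinAt.mem_closure_image hz)
      rintro _ ⟨_, ⟨w, hw, rfl⟩, rfl⟩
      simp [inv_pow_negRoot hm (ne_zero_of_mem hA (halfStrip_subset_closedHalfStrip A hw))]
    exact mem_insert_of_mem _ ⟨_, h1, sub_eq_zero.1 h2⟩
  · refine mem_closure_of_tendsto
      ((tendsto_negRoot hm).comp (tendsto_ofReal_add_cobounded 0)) ?_
    filter_upwards [eventually_gt_atTop A] with t ht
    rw [Function.comp_apply, add_zero]
    exact mem_image_of_mem _ (ofReal_mem_halfStrip ht)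
  · rw [← closure_halfStrip]
    exact ContinuousOn.image_closure (by rw [closure_halfStrip]; exact continuousOn_negRoot m hA)

theorem frontier_cusp (hm : 1 ≤ m) (hA : 0 < A) :
    frontier (cusp m A) = insert 0 (negRoot m '' (closedHalfStrip A \ halfStrip A)) := by
  rw [frontier, (isOpen_cusp hm hA).interior_eq, closure_cusp hm hA, insert_sdiff_of_notMem,
    (injOn_negRoot hm hA).image_sdiff, inter_eq_right.2 (halfStrip_subset_closedHalfStrip A)]
  · rfl
  · rintro ⟨w, -, hw⟩
    exact negRoot_ne_zero m w hw

theorem isBoundedDomain_image_cusp (hm : 1 ≤ m) (hA : 1 ≤ A) :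
    IsBoundedDomain (planeIso '' cusp m A) where
  isOpen := planeIso.toHomeomorph.isOpenMap _ (isOpen_cusp hm (by linarith))
  isConnected := (isConnected_cusp m (by linarith)).image _ planeIso.continuous.continuousOn
  isBounded := planeIso.lipschitz.isBounded_image (isBounded_cusp m hA)

end


/-! ### Mapping the cusp domain to the disc; Dirichlet regularity. -/

section

variable {m : ℕ} {A : ℝ}

/-- From this formula `sinh` sends the interior of the half strip at `0` to the right half plane and
its sides to the imaginary axis. -/
theorem re_sinh (u : ℂ) : (Complex.sinh u).re = Real.sinh u.re * Real.cos u.im := by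
  conv_lhs => rw [← Complex.re_add_im u]
  rw [Complex.sinh_add, Complex.sinh_mul_I, Complex.cosh_mul_I, ← Complex.ofReal_sinh,
    ← Complex.ofReal_cos, ← Complex.ofReal_cosh, ← Complex.ofReal_sin]
  simp [-Complex.ofReal_cos, -Complex.ofReal_sin, -Complex.ofReal_sinh, -Complex.ofReal_cosh]

theorem re_le_norm_sinh {u : ℂ} (hu : 0 ≤ u.re) : u.re ≤ ‖Complex.sinh u‖ := by
  refine (Real.self_le_sinh_iff.2 hu).trans ?_
  rw [Real.sinh_eq, Complex.sinh, norm_div, Complex.norm_two]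
  gcongr
  refine le_trans (le_of_eq ?_) (norm_sub_norm_le _ _)
  rw [Complex.norm_exp, Complex.norm_exp, Complex.neg_re]

/-- Equality of the values factors as `(e^u - e^v)(1 + e^{-(u+v)}) = 0`. The first factor decides by
the bound on imaginary parts; the second puts both points on the imaginary axis, where `sin` is
injective on `[-π/2, π/2]`. -/
theorem injOn_sinh : InjOn Complex.sinh (closedHalfStrip 0) := by
  intro u hu v hv h
  have hu1 : 0 ≤ u.re := hu.1
  have hv1 : 0 ≤ v.re := hv.1
  have hu2 : u.im ∈ Icc (-(Real.pi / 2)) (Real.pi / 2) := hu.2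
  have hv2 : v.im ∈ Icc (-(Real.pi / 2)) (Real.pi / 2) := hv.2
  have hπ := Real.pi_pos
  have h1 : (Complex.exp u - Complex.exp v) * (1 + Complex.exp (-(u + v))) = 0 := by
    have e1 : Complex.exp u * Complex.exp (-(u + v)) = Complex.exp (-v) := by
      rw [← Complex.exp_add]; ring_nf
    have e2 : Complex.exp v * Complex.exp (-(u + v)) = Complex.exp (-u) := by
      rw [← Complex.exp_add]; ring_nf
    simp only [Complex.sinh] at h
    linear_combination e1 - e2 + 2 * h
  rcases mul_eq_zero.1 h1 with h2 | h2
  · exact Complex.exp_inj_of_neg_pi_lt_of_le_pi (by linarith [hu2.1]) (by linarith [hu2.2])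
      (by linarith [hv2.1]) (by linarith [hv2.2]) (sub_eq_zero.1 h2)
  · have h3 : ‖Complex.exp (-(u + v))‖ = 1 := by
      rw [show Complex.exp (-(u + v)) = -1 by linear_combination h2]; simp
    rw [Complex.norm_exp, Real.exp_eq_one_iff] at h3
    simp only [Complex.neg_re, Complex.add_re] at h3
    have hu0 : u = u.im * Complex.I := by
      apply Complex.ext <;> simp; linarith
    have hv0 : v = v.im * Complex.I := by
      apply Complex.ext <;> simp; linarith
    rw [hu0, hv0, Complex.sinh_mul_I, Complex.sinh_mul_I] at h
    have h4 := mul_right_cancel₀ Complex.I_ne_zero h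
    rw [hu0, hv0, Real.injOn_sin hu2 hv2 (by exact_mod_cast h4)]

theorem one_add_ne_zero_of_re {s : ℂ} (hs : 0 ≤ s.re) : 1 + s ≠ 0 := by
  intro h
  have := congrArg Complex.re h
  simp at this
  linarith

theorem norm_one_sub_div_lt_one {s : ℂ} (hs : 0 < s.re) : ‖(1 - s) / (1 + s)‖ < 1 := by
  have h := norm_pos_iff.2 (one_add_ne_zero_of_re hs.le)
  rw [norm_div, div_lt_one h, ← sq_lt_sq₀ (norm_nonneg _) h.le, ← Complex.normSq_eq_norm_sq,
    ← Complex.normSq_eq_norm_sq, Complex.normSq_apply, Complex.normSq_apply]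
  simp
  nlinarith

theorem norm_one_sub_div_eq_one {s : ℂ} (hs : s.re = 0) : ‖(1 - s) / (1 + s)‖ = 1 := by
  have h := norm_pos_iff.2 (one_add_ne_zero_of_re hs.ge)
  rw [norm_div, div_eq_one_iff_eq h.ne', ← sq_eq_sq₀ (norm_nonneg _) h.le,
    ← Complex.normSq_eq_norm_sq, ← Complex.normSq_eq_norm_sq, Complex.normSq_apply,
    Complex.normSq_apply]
  simp [hs]

theorem sub_mem_closedHalfStrip {w : ℂ} (hw : w ∈ closedHalfStrip A) :
    w - A ∈ closedHalfStrip 0 := by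
  have h1 : A ≤ w.re := hw.1
  refine ⟨?_, ?_⟩
  · simpa using h1
  · simpa using hw.2

theorem re_sinh_sub_nonneg {w : ℂ} (hw : w ∈ closedHalfStrip A) :
    0 ≤ (Complex.sinh (w - A)).re := by
  have h := sub_mem_closedHalfStrip hw
  rw [re_sinh]
  exact mul_nonneg (Real.sinh_nonneg_iff.2 h.1) (Real.cos_nonneg_of_mem_Icc h.2)

theorem re_sinh_sub_pos {w : ℂ} (hw : w ∈ halfStrip A) : 0 < (Complex.sinh (w - A)).re := by
  have h1 : A < w.re := hw.1
  rw [re_sinh]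
  refine mul_pos (Real.sinh_pos_iff.2 (by simpa using h1)) (Real.cos_pos_of_mem_Ioo ?_)
  simpa using hw.2

theorem mem_closedHalfStrip_diff {w : ℂ} (hw : w ∈ closedHalfStrip A \ halfStrip A) :
    w.re = A ∨ w.im = Real.pi / 2 ∨ w.im = -(Real.pi / 2) := by
  by_contra! h
  refine hw.2 ⟨lt_of_le_of_ne hw.1.1 (Ne.symm h.1), lt_of_le_of_ne hw.1.2.1 (Ne.symm h.2.2),
    lt_of_le_of_ne hw.1.2.2 h.2.1⟩

theorem re_sinh_sub_eq_zero {w : ℂ} (hw : w ∈ closedHalfStrip A \ halfStrip A) :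
    (Complex.sinh (w - A)).re = 0 := by
  rw [re_sinh]
  rcases mem_closedHalfStrip_diff hw with h | h | h <;> simp [h]

/-- A conformal map from the cusp domain onto the unit disc. -/
noncomputable def discMap (m : ℕ) (A : ℝ) (z : ℂ) : ℂ :=
  if z = 0 then -1 else
    (1 - Complex.sinh ((z ^ m)⁻¹ - A)) / (1 + Complex.sinh ((z ^ m)⁻¹ - A))

theorem discMap_zero (m : ℕ) (A : ℝ) : discMap m A 0 = -1 := if_pos rfl

theorem discMap_of_ne_zero (m : ℕ) (A : ℝ) {z : ℂ} (hz : z ≠ 0) : discMap m A z =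
    (1 - Complex.sinh ((z ^ m)⁻¹ - A)) / (1 + Complex.sinh ((z ^ m)⁻¹ - A)) := if_neg hz

theorem discMap_negRoot (hm : 1 ≤ m) (hA : 0 < A) {w : ℂ} (hw : w ∈ closedHalfStrip A) :
    discMap m A (negRoot m w) = (1 - Complex.sinh (w - A)) / (1 + Complex.sinh (w - A)) := by
  rw [discMap_of_ne_zero m A (negRoot_ne_zero m w), inv_pow_negRoot hm (ne_zero_of_mem hA hw)]

/-- The Cayley transform is injective and never takes the value `-1`, which is thus reserved for the
vertex. -/
theorem injOn_discMap (hm : 1 ≤ m) (hA : 0 < A) : InjOn (discMap m A) (closure (cusp m A)) := by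
  rw [closure_cusp hm hA]
  have key : ∀ w ∈ closedHalfStrip A, discMap m A (negRoot m w) ≠ -1 := by
    intro w hw h
    have h0 := one_add_ne_zero_of_re (re_sinh_sub_nonneg hw)
    rw [discMap_negRoot hm hA hw, div_eq_iff h0] at h
    have : (2 : ℂ) = 0 := by linear_combination h
    norm_num at this
  rintro z (rfl | ⟨w, hw, rfl⟩) z' (rfl | ⟨w', hw', rfl⟩) h
  · rfl
  · exact absurd (h.symm.trans (discMap_zero m A)) (key w' hw')
  · exact absurd (h.trans (discMap_zero m A)) (key w hw)
  · have h0 := one_add_ne_zero_of_re (re_sinh_sub_nonneg hw)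
    have h0' := one_add_ne_zero_of_re (re_sinh_sub_nonneg hw')
    rw [discMap_negRoot hm hA hw, discMap_negRoot hm hA hw', div_eq_div_iff h0 h0'] at h
    have h1 : Complex.sinh (w - A) = Complex.sinh (w' - A) := by
      linear_combination -h / 2
    have := injOn_sinh (sub_mem_closedHalfStrip hw) (sub_mem_closedHalfStrip hw') h1
    rw [sub_left_inj.1 this]

theorem differentiableAt_discMap (hm : 1 ≤ m) (hA : 0 < A) {w : ℂ} (hw : w ∈ closedHalfStrip A) :
    DifferentiableAt ℂ (discMap m A) (negRoot m w) := by
  have h0 := one_add_ne_zero_of_re (re_sinh_sub_nonneg hw)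
  have h1 := negRoot_ne_zero m w
  have h2 : DifferentiableAt ℂ (fun z : ℂ => Complex.sinh ((z ^ m)⁻¹ - A)) (negRoot m w) := by
    have h3 : negRoot m w ^ m ≠ 0 := pow_ne_zero _ h1
    fun_prop (disch := exact h3)
  refine DifferentiableAt.congr_of_eventuallyEq (f := fun z : ℂ =>
    (1 - Complex.sinh ((z ^ m)⁻¹ - A)) / (1 + Complex.sinh ((z ^ m)⁻¹ - A))) ?_ ?_
  · have h3 : 1 + Complex.sinh ((negRoot m w ^ m)⁻¹ - A) ≠ 0 := by
      rwa [inv_pow_negRoot hm (ne_zero_of_mem hA hw)]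
    exact (h2.const_sub 1).fun_div (h2.const_add 1) h3
  · filter_upwards [isOpen_ne.mem_nhds h1] with z hz
    exact discMap_of_ne_zero m A hz

/-- Only the vertex needs care. With `s = sinh (w - A)` the distance to `-1` is `2 / |1 + s|`, and
`|1 + s| ≥ |s| ≥ Re w - A ≥ |w| - π/2 - A`, where `|w| = |z|^{-m}` tends to infinity. -/
theorem continuousOn_discMap (hm : 1 ≤ m) (hA : 0 < A) :
    ContinuousOn (discMap m A) (closure (cusp m A)) := by
  rw [closure_cusp hm hA]
  rintro z (rfl | ⟨w, hw, rfl⟩)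
  · rw [continuousWithinAt_insert_self, ContinuousWithinAt, discMap_zero,
      tendsto_iff_norm_sub_tendsto_zero]
    have hlim : Tendsto (fun z : ℂ => ‖z‖⁻¹ ^ m - Real.pi / 2 - A)
        (𝓝[negRoot m '' closedHalfStrip A] 0) atTop := by
      refine tendsto_atTop_add_const_right _ _ (tendsto_atTop_add_const_right _ _ ?_)
      refine (tendsto_pow_atTop (by omega)).comp ?_
      refine tendsto_norm_nhdsNE_zero.inv_tendsto_nhdsGT_zero.mono_left (nhdsWithin_mono _ ?_)
      rintro _ ⟨w, -, rfl⟩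
      exact negRoot_ne_zero m w
    refine squeeze_zero' (Eventually.of_forall fun _ => norm_nonneg _) ?_
      ((tendsto_const_nhds (x := (2 : ℝ))).div_atTop hlim)
    filter_upwards [self_mem_nhdsWithin, hlim.eventually_gt_atTop 0] with z hz hpos
    obtain ⟨w, hw, rfl⟩ := hz
    have h0 := one_add_ne_zero_of_re (re_sinh_sub_nonneg hw)
    have h1 : (1 - Complex.sinh (w - A)) / (1 + Complex.sinh (w - A)) - -1 =
        2 / (1 + Complex.sinh (w - A)) := by
      field_simp
      ring
    rw [discMap_negRoot hm hA hw, h1, norm_div, Complex.norm_two]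
    refine div_le_div_of_nonneg_left zero_le_two hpos ?_
    have h2 : ‖Complex.sinh (w - A)‖ ≤ ‖1 + Complex.sinh (w - A)‖ := by
      rw [← sq_le_sq₀ (norm_nonneg _) (norm_nonneg _), ← Complex.normSq_eq_norm_sq,
        ← Complex.normSq_eq_norm_sq, Complex.normSq_apply, Complex.normSq_apply]
      have := re_sinh_sub_nonneg hw
      simp only [Complex.add_re, Complex.add_im, Complex.one_re, Complex.one_im]
      nlinarith
    have h3 := re_le_norm_sinh (sub_mem_closedHalfStrip hw).1
    have h4 : ‖negRoot m w‖⁻¹ ^ m = ‖w‖ := by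
      conv_rhs => rw [← inv_pow_negRoot hm (ne_zero_of_mem hA hw)]
      rw [norm_inv, norm_pow, inv_pow]
    have h5 : ‖w‖ ≤ |w.re| + |w.im| := Complex.norm_le_abs_re_add_abs_im w
    have h6 : |w.im| ≤ Real.pi / 2 := abs_le.2 hw.2
    have h7 : |w.re| = w.re := abs_of_nonneg (hA.le.trans hw.1)
    rw [Complex.sub_re, Complex.ofReal_re] at h3
    rw [h4]
    linarith
  · exact (differentiableAt_discMap hm hA hw).continuousAt.continuousWithinAt

theorem isDirichletRegular_image_cusp (hm : 1 ≤ m) (hA : 1 ≤ A) :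
    IsDirichletRegular (planeIso '' cusp m A) := by
  have hA0 : 0 < A := by linarith
  have hcl : closure (planeIso '' cusp m A) = planeIso '' closure (cusp m A) :=
    (planeIso.toHomeomorph.image_closure _).symm
  have hfr : frontier (planeIso '' cusp m A) = planeIso '' frontier (cusp m A) :=
    (planeIso.toHomeomorph.image_frontier _).symm
  refine isDirichletRegular_of_disc_map (isBoundedDomain_image_cusp hm hA)
    (Ψ := fun x => discMap m A (planeIso.symm x)) ?_ ?_ ?_ ?_ ?_
  · rw [hcl]
    refine (continuousOn_discMap hm hA0).comp planeIso.symm.continuous.continuousOn ?_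
    rintro _ ⟨z, hz, rfl⟩
    simpa using hz
  · rintro _ ⟨_, ⟨w, hw, rfl⟩, rfl⟩
    have hw' := halfStrip_subset_closedHalfStrip A hw
    simp only [LinearIsometryEquiv.symm_apply_apply, mem_ball_zero_iff]
    rw [discMap_negRoot hm hA0 hw']
    exact norm_one_sub_div_lt_one (re_sinh_sub_pos hw)
  · rw [hfr, frontier_cusp hm hA0]
    rintro _ ⟨_, (rfl | ⟨w, hw, rfl⟩), rfl⟩
    · simp [discMap_zero]
    · simp only [LinearIsometryEquiv.symm_apply_apply, mem_sphere_zero_iff_norm]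
      rw [discMap_negRoot hm hA0 hw.1]
      exact norm_one_sub_div_eq_one (re_sinh_sub_eq_zero hw)
  · rw [hfr]
    rintro _ ⟨z, hz, rfl⟩ _ ⟨z', hz', rfl⟩ h
    simp only [LinearIsometryEquiv.symm_apply_apply] at h
    rw [injOn_discMap hm hA0 (frontier_subset_closure hz) (frontier_subset_closure hz') h]
  · rintro _ ⟨z, hz, rfl⟩
    simp only [LinearIsometryEquiv.symm_apply_apply]
    refine DifferentiableOn.analyticAt (s := cusp m A) ?_ ((isOpen_cusp hm hA0).mem_nhds hz)
    rintro _ ⟨w, hw, rfl⟩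
    exact (differentiableAt_discMap hm hA0
      (halfStrip_subset_closedHalfStrip A hw)).differentiableWithinAt

end


/-! ### Ahlfors regularity of the boundary of the cusp domain. -/

section

variable {m : ℕ} {A : ℝ}

/-- The hypothesis keeps `φ'` within 60° of the negative real axis, so the curve `exp ∘ φ` moves at
most twice as fast as its modulus decreases. -/
theorem norm_exp_sub_exp_le {φ φ' : ℝ → ℂ} {a b : ℝ} (hab : a ≤ b)
    (hφ : ∀ t ∈ Icc a b, HasDerivAt φ (φ' t) t)
    (h : ∀ t ∈ Icc a b, ‖φ' t‖ ≤ -2 * (φ' t).re) :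
    ‖Complex.exp (φ b) - Complex.exp (φ a)‖ ≤
      2 * (‖Complex.exp (φ a)‖ - ‖Complex.exp (φ b)‖) := by
  have hre : ∀ t ∈ Icc a b, HasDerivAt (fun t => Real.exp (φ t).re)
      (Real.exp (φ t).re * (φ' t).re) t := fun t ht =>
    (Complex.reCLM.hasFDerivAt.comp_hasDerivAt t (hφ t ht)).exp
  have hex : ∀ t ∈ Icc a b, HasDerivAt (fun t => Complex.exp (φ t) - Complex.exp (φ a))
      (Complex.exp (φ t) * φ' t) t := fun t ht => (hφ t ht).cexp.sub_const _
  have hB : ∀ t ∈ Icc a b, HasDerivAt (fun t => 2 * (Real.exp (φ a).re - Real.exp (φ t).re))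
      (2 * -(Real.exp (φ t).re * (φ' t).re)) t := fun t ht =>
    ((hre t ht).const_sub _).const_mul 2
  have := image_norm_le_of_norm_deriv_right_le_deriv_boundary'
    (fun t ht => (hex t ht).continuousAt.continuousWithinAt)
    (fun t ht => (hex t (Ico_subset_Icc_self ht)).hasDerivWithinAt) (by simp)
    (fun t ht => (hB t ht).continuousAt.continuousWithinAt)
    (fun t ht => (hB t (Ico_subset_Icc_self ht)).hasDerivWithinAt)
    (fun t ht => by
      rw [norm_mul, Complex.norm_exp]
      have := mul_le_mul_of_nonneg_left (h t (Ico_subset_Icc_self ht)) (Real.exp_pos (φ t).re).le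
      linarith) (right_mem_Icc.2 hab)
  simpa [Complex.norm_exp] using this

theorem norm_pow_sub_pow_le {a b : ℂ} (ha : ‖a‖ ≤ 1) (hb : ‖b‖ ≤ 1) (n : ℕ) :
    ‖a ^ n - b ^ n‖ ≤ n * ‖a - b‖ := by
  induction n with
  | zero => simp
  | succ n ih =>
    rw [show a ^ (n + 1) - b ^ (n + 1) = a ^ n * (a - b) + (a ^ n - b ^ n) * b by ring]
    refine (norm_add_le _ _).trans ?_
    rw [norm_mul, norm_mul, norm_pow]
    have h1 : ‖a‖ ^ n ≤ 1 := pow_le_one₀ (norm_nonneg _) ha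
    push_cast
    nlinarith [mul_le_mul_of_nonneg_right h1 (norm_nonneg (a - b)),
      mul_le_mul_of_nonneg_left hb (norm_nonneg (a ^ n - b ^ n))]

/-- The line `Im = b`, parametrised by the real part, on `[A, ∞)`. -/
def ray (A b : ℝ) : Set ℂ := Ici A ×ℂ {b}

/-- The vertical side of the half strip. -/
def cap (A : ℝ) : Set ℂ := {A} ×ℂ Icc (-(Real.pi / 2)) (Real.pi / 2)

theorem closedHalfStrip_diff (A : ℝ) : closedHalfStrip A \ halfStrip A =
    cap A ∪ ray A (Real.pi / 2) ∪ ray A (-(Real.pi / 2)) := by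
  ext w
  constructor
  · intro hw
    rcases mem_closedHalfStrip_diff hw with h | h | h
    · exact Or.inl (Or.inl ⟨h, hw.1.2⟩)
    · exact Or.inl (Or.inr ⟨hw.1.1, h⟩)
    · exact Or.inr ⟨hw.1.1, h⟩
  · have hπ := Real.pi_pos
    rintro ((h | h) | h)
    · have h1 : w.re = A := h.1
      exact ⟨⟨h1.ge, h.2⟩, fun h' => (h'.1 : A < w.re).ne' h1⟩
    · have h1 : w.im = Real.pi / 2 := h.2
      refine ⟨⟨h.1, ?_⟩, fun h' => (h'.2.2 : w.im < _).ne h1⟩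
      change w.im ∈ Icc _ _
      rw [h1]; constructor <;> linarith
    · have h1 : w.im = -(Real.pi / 2) := h.2
      refine ⟨⟨h.1, ?_⟩, fun h' => (h'.2.1 : _ < w.im).ne' h1⟩
      change w.im ∈ Icc _ _
      rw [h1]; constructor <;> linarith

theorem ray_subset (A : ℝ) {b : ℝ} (hb : |b| = Real.pi / 2) : ray A b ⊆ closedHalfStrip A := by
  rintro w ⟨h1, h2⟩
  refine ⟨h1, ?_⟩
  change w.im = b at h2
  change w.im ∈ Icc _ _
  rw [h2]
  exact abs_le.1 hb.le

theorem cap_subset (A : ℝ) : cap A ⊆ closedHalfStrip A := by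
  rintro w ⟨h1, h2⟩
  exact ⟨(show w.re = A from h1).ge, h2⟩

theorem isPreconnected_closedHalfStrip_diff (A : ℝ) :
    IsPreconnected (closedHalfStrip A \ halfStrip A) := by
  rw [closedHalfStrip_diff]
  have hc : IsPreconnected (cap A) :=
    (convex_reProdIm (convex_singleton A) (convex_Icc _ _)).isPreconnected
  have hr : ∀ b, IsPreconnected (ray A b) := fun b =>
    (convex_reProdIm (convex_Ici A) (convex_singleton b)).isPreconnected
  have hπ := Real.pi_pos
  refine IsPreconnected.union (⟨A, -(Real.pi / 2)⟩ : ℂ) (Or.inl ?_) ?_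
    (IsPreconnected.union (⟨A, Real.pi / 2⟩ : ℂ) ?_ ?_ hc (hr _)) (hr _)
  · exact ⟨rfl, le_rfl, show -(Real.pi / 2) ≤ Real.pi / 2 by linarith⟩
  · exact ⟨le_refl A, rfl⟩
  · exact ⟨rfl, show -(Real.pi / 2) ≤ Real.pi / 2 by linarith, le_rfl⟩
  · exact ⟨le_refl A, rfl⟩

/-- The three arcs form the continuous image of a connected set, and the vertex is a limit point of
that image. -/
theorem isPreconnected_frontier_cusp (hm : 1 ≤ m) (hA : 0 < A) :
    IsPreconnected (frontier (cusp m A)) := by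
  rw [frontier_cusp hm hA]
  refine ((isPreconnected_closedHalfStrip_diff A).image (negRoot m)
    ((continuousOn_negRoot m hA).mono sdiff_subset)).subset_closure (subset_insert _ _)
    (insert_subset ?_ subset_closure)
  refine mem_closure_of_tendsto ((tendsto_negRoot hm).comp
    (tendsto_ofReal_add_cobounded ((Real.pi / 2 : ℝ) * Complex.I))) ?_
  filter_upwards [eventually_ge_atTop A] with t ht
  refine mem_image_of_mem _ ?_
  rw [closedHalfStrip_diff]
  refine Or.inl (Or.inr ⟨?_, ?_⟩)
  · simpa using ht
  · simp

/-- Makes the modulus a coordinate with Lipschitz inverse on the image of a horizontal side: the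
logarithmic derivative is `-1/(m z)`, and `|z| ≤ 2 Re z` because `|Im z| = π/2 ≤ A ≤ Re z`. -/
theorem dist_negRoot_ray_le (hA : Real.pi / 2 ≤ A) {b : ℝ} (hb : |b| = Real.pi / 2)
    {w w' : ℂ} (hw : w ∈ ray A b) (hw' : w' ∈ ray A b) :
    dist (negRoot m w) (negRoot m w') ≤ 2 * |‖negRoot m w‖ - ‖negRoot m w'‖| := by
  wlog hle : w.re ≤ w'.re generalizing w w'
  · rw [dist_comm, abs_sub_comm]
    exact this hw' hw (le_of_not_ge hle)
  have hA0 : 0 < A := lt_of_lt_of_le (by positivity) hA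
  have hmem : ∀ t ∈ Icc w.re w'.re, ((t : ℂ) + b * Complex.I) ∈ ray A b := fun t ht =>
    ⟨by simpa using le_trans hw.1 ht.1, by simp⟩
  have hwe : (w.re : ℂ) + b * Complex.I = w := by
    rw [← (hw.2 : w.im = b), Complex.re_add_im]
  have hwe' : (w'.re : ℂ) + b * Complex.I = w' := by
    rw [← (hw'.2 : w'.im = b), Complex.re_add_im]
  have hd : ∀ t ∈ Icc w.re w'.re,
      HasDerivAt (fun t : ℝ => -Complex.log ((t : ℂ) + b * Complex.I) / m)
        (-((t : ℂ) + b * Complex.I)⁻¹ / m) t := by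
    intro t ht
    have h1 : HasDerivAt (fun t : ℝ => (t : ℂ) + b * Complex.I) 1 t :=
      (Complex.ofRealCLM.hasDerivAt (x := t)).add_const _
    have h2 := h1.clog_real (mem_slitPlane_of_mem hA0 (ray_subset A hb (hmem t ht)))
    rw [one_div] at h2
    exact (h2.neg).div_const _
  have := norm_exp_sub_exp_le hle hd ?_
  · simp only [hwe, hwe'] at this
    rw [dist_comm, dist_eq_norm]
    exact this.trans (by gcongr; exact le_abs_self _)
  · intro t ht
    set z : ℂ := (t : ℂ) + b * Complex.I with hz
    have h1 := hmem t ht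
    have h3 := ray_subset A hb h1
    have hzre : A ≤ z.re := h1.1
    have hz0 : 0 < ‖z‖ := norm_pos_iff.2 (ne_zero_of_mem hA0 h3)
    have h4 : ‖z‖ ≤ 2 * z.re := by
      have := Complex.norm_le_abs_re_add_abs_im z
      rw [(h1.2 : z.im = b), hb, abs_of_nonneg (hA0.le.trans hzre)] at this
      linarith
    rw [← Complex.ofReal_natCast, Complex.div_ofReal_re, norm_div, norm_neg, norm_inv,
      Complex.neg_re, Complex.inv_re, Complex.normSq_eq_norm_sq, Complex.ofReal_natCast,
      Complex.norm_natCast]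
    rw [show -2 * (-(z.re / ‖z‖ ^ 2) / (m : ℝ)) = (2 * z.re / ‖z‖ ^ 2) / m by ring]
    gcongr
    rw [le_div_iff₀ (by positivity)]
    field_simp
    exact h4

theorem dist_negRoot_le (hm : 1 ≤ m) (hA : 1 ≤ A) {w w' : ℂ} (hw : w ∈ closedHalfStrip A)
    (hw' : w' ∈ closedHalfStrip A) : dist (negRoot m w) (negRoot m w') ≤ dist w w' := by
  have hA0 : 0 < A := by linarith
  rw [dist_eq_norm, dist_eq_norm, ← one_mul ‖w - w'‖]
  refine Convex.norm_image_sub_le_of_norm_hasDerivWithin_le (s := closedHalfStrip A)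
    (fun x hx => (hasStrictDerivAt_negRoot m
      (mem_slitPlane_of_mem hA0 hx)).hasDerivAt.hasDerivWithinAt) (fun x hx => ?_)
    (convex_reProdIm (convex_Ici A) (convex_Icc _ _)) hw' hw
  have h1 : 1 ≤ ‖x‖ := hA.trans (le_norm_of_mem hx)
  have h2 : (1 : ℝ) ≤ m := by exact_mod_cast hm
  rw [norm_mul, norm_div, norm_neg, norm_inv, Complex.norm_natCast]
  exact mul_le_one₀ (norm_negRoot_le_one m h1) (by positivity)
    (div_le_one_of_le₀ ((inv_le_one_of_one_le₀ h1).trans h2) (by positivity))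

/-- With `ζ = negRoot m w` and `ζ' = negRoot m w'` one has `w - w' = w w' (ζ'^m - ζ^m)`, and `|w|,
|w'| ≤ A + π/2` on the vertical side. -/
theorem dist_le_dist_negRoot (hm : 1 ≤ m) (hA : 1 ≤ A) {w w' : ℂ} (hw : w ∈ cap A)
    (hw' : w' ∈ cap A) :
    dist w w' ≤ (A + Real.pi / 2) ^ 2 * m * dist (negRoot m w) (negRoot m w') := by
  have hA0 : 0 < A := by linarith
  have key : ∀ w ∈ cap A, ‖w‖ ≤ A + Real.pi / 2 := by
    intro w hw
    have h1 := Complex.norm_le_abs_re_add_abs_im w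
    have h2 : |w.im| ≤ Real.pi / 2 := abs_le.2 hw.2
    rw [(hw.1 : w.re = A), abs_of_pos hA0] at h1
    linarith
  have hc := cap_subset A hw
  have hc' := cap_subset A hw'
  have e1 := inv_pow_negRoot hm (ne_zero_of_mem hA0 hc)
  have e2 := inv_pow_negRoot hm (ne_zero_of_mem hA0 hc')
  have h1 := norm_negRoot_le_one m (hA.trans (le_norm_of_mem hc))
  have h2 := norm_negRoot_le_one m (hA.trans (le_norm_of_mem hc'))
  have e3 : w - w' = w * w' * (negRoot m w' ^ m - negRoot m w ^ m) := by
    have f1 : w * negRoot m w ^ m = 1 := by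
      nth_rewrite 1 [← e1]
      exact inv_mul_cancel₀ (pow_ne_zero m (negRoot_ne_zero m w))
    have f2 : w' * negRoot m w' ^ m = 1 := by
      nth_rewrite 1 [← e2]
      exact inv_mul_cancel₀ (pow_ne_zero m (negRoot_ne_zero m w'))
    linear_combination (-w) * f2 + w' * f1
  rw [dist_comm (negRoot m w), dist_eq_norm, dist_eq_norm, e3, norm_mul, norm_mul, mul_assoc _ (m : ℝ), sq]
  exact mul_le_mul (mul_le_mul (key w hw) (key w' hw') (norm_nonneg _) (by positivity))
    (norm_pow_sub_pow_le h2 h1 m) (norm_nonneg _) (by positivity)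

/-- Lower bound: the boundary is connected and contains `0` and `p`, one of which is at distance at
least `‖p‖/2` from any given point. Upper bound: the two horizontal sides contribute `8r` each and
the vertical side `4Lr`, with coordinates the modulus and `Im z^{-m}`. -/
theorem isAhlforsRegular_frontier_image_cusp (hm : 1 ≤ m) (hA : Real.pi / 2 ≤ A) :
    IsAhlforsRegular (frontier (planeIso '' cusp m A)) := by
  have hA1 : 1 ≤ A := by linarith [Real.pi_gt_three]
  have hA0 : 0 < A := by linarith
  have hπ := Real.pi_pos
  rw [show frontier (planeIso '' cusp m A) = planeIso '' frontier (cusp m A) from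
    (planeIso.toHomeomorph.image_frontier _).symm]
  set L : ℝ := (A + Real.pi / 2) ^ 2 * m
  set p : ℂ := negRoot m ⟨A, Real.pi / 2⟩
  have hp0 : 0 < ‖p‖ := norm_pos_iff.2 (negRoot_ne_zero m _)
  have h0F : (0 : ℂ) ∈ frontier (cusp m A) := by
    rw [frontier_cusp hm hA0]; exact mem_insert _ _
  have hpF : p ∈ frontier (cusp m A) := by
    rw [frontier_cusp hm hA0, closedHalfStrip_diff]
    exact mem_insert_of_mem _ (mem_image_of_mem _ (Or.inl (Or.inr ⟨le_refl A, rfl⟩)))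
  refine isAhlforsRegular_image_planeIso (C₀ := 1) (C₁ := 16 + 4 * L) (R := ‖p‖ / 2) one_pos
    (by positivity) (by positivity) fun x hx r hr hrR => ⟨?_, ?_⟩
  · rw [one_mul]
    rcases le_total (‖p‖ / 2) (dist x 0) with h | h
    · exact le_hausdorffMeasure_ball_inter (isPreconnected_frontier_cusp hm hA0) hx h0F
        (hrR.le.trans h)
    · refine le_hausdorffMeasure_ball_inter (isPreconnected_frontier_cusp hm hA0) hx hpF ?_
      have := dist_triangle_left p 0 x
      rw [dist_zero_right] at this
      linarith
  · have hray : ∀ b : ℝ, |b| = Real.pi / 2 →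
        Measure.hausdorffMeasure 1 (Metric.ball x r ∩ negRoot m '' ray A b) ≤
          ENNReal.ofReal (8 * r) := by
      intro b hb
      convert hausdorffMeasure_ball_inter_le (S := negRoot m '' ray A b) (p := fun z => ‖z‖)
        (L := 1) (L' := 2) zero_le_one zero_le_two ?_ ?_ x r using 2
      · ring
      · intro a _ c _
        rw [one_mul, dist_eq_norm]
        exact abs_norm_sub_norm_le a c
      · rintro _ ⟨w, hw, rfl⟩ _ ⟨w', hw', rfl⟩
        exact dist_negRoot_ray_le hA hb hw hw'
    have hcap : Measure.hausdorffMeasure 1 (Metric.ball x r ∩ negRoot m '' cap A) ≤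
        ENNReal.ofReal (4 * L * r) := by
      have hdist : ∀ w ∈ cap A, ∀ w' ∈ cap A, |w.im - w'.im| = dist w w' := by
        intro w hw w' hw'
        rw [Complex.dist_of_re_eq ((hw.1 : w.re = A).trans (hw'.1 : w'.re = A).symm),
          Real.dist_eq]
      convert hausdorffMeasure_ball_inter_le (S := negRoot m '' cap A)
        (p := fun z => ((z ^ m)⁻¹).im) (L := L) (L' := 1) (by positivity) zero_le_one ?_ ?_ x r
        using 2
      · ring
      · rintro _ ⟨w, hw, rfl⟩ _ ⟨w', hw', rfl⟩
        rw [inv_pow_negRoot hm (ne_zero_of_mem hA0 (cap_subset A hw)),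
          inv_pow_negRoot hm (ne_zero_of_mem hA0 (cap_subset A hw')), hdist w hw w' hw']
        exact dist_le_dist_negRoot hm hA1 hw hw'
      · rintro _ ⟨w, hw, rfl⟩ _ ⟨w', hw', rfl⟩
        rw [inv_pow_negRoot hm (ne_zero_of_mem hA0 (cap_subset A hw)),
          inv_pow_negRoot hm (ne_zero_of_mem hA0 (cap_subset A hw')), hdist w hw w' hw', one_mul]
        exact dist_negRoot_le hm hA1 (cap_subset A hw) (cap_subset A hw')
    have h0 : Measure.hausdorffMeasure 1 ({0} : Set ℂ) = 0 := by
      have := Measure.nullSingletonClass_hausdorff ℂ (d := 1) one_pos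
      exact measure_singleton 0
    have hsub : Metric.ball x r ∩ frontier (cusp m A) ⊆ {0} ∪
        ((Metric.ball x r ∩ negRoot m '' cap A) ∪
          (Metric.ball x r ∩ negRoot m '' ray A (Real.pi / 2)) ∪
          (Metric.ball x r ∩ negRoot m '' ray A (-(Real.pi / 2)))) := by
      rw [frontier_cusp hm hA0, closedHalfStrip_diff, image_union, image_union]
      rintro z ⟨hz, (rfl | ((h | h) | h))⟩
      · exact Or.inl rfl
      · exact Or.inr (Or.inl (Or.inl ⟨hz, h⟩))
      · exact Or.inr (Or.inl (Or.inr ⟨hz, h⟩))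
      · exact Or.inr (Or.inr ⟨hz, h⟩)
    have hb1 : |Real.pi / 2| = Real.pi / 2 := abs_of_pos (by positivity)
    have hb2 : |-(Real.pi / 2)| = Real.pi / 2 := by rw [abs_neg, hb1]
    refine (measure_mono hsub).trans ((measure_union_le _ _).trans ?_)
    rw [h0, zero_add]
    refine (measure_union_le _ _).trans ?_
    refine (add_le_add ((measure_union_le _ _).trans (add_le_add hcap (hray _ hb1)))
      (hray _ hb2)).trans ?_
    rw [← ENNReal.ofReal_add (by positivity) (by positivity),
      ← ENNReal.ofReal_add (by positivity) (by positivity)]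
    exact ENNReal.ofReal_le_ofReal (by linarith)

end


/-! ### Shape of the cusp and divergence of the `β`-integral; part (iii). -/

section

variable {m : ℕ} {A : ℝ}

theorem re_negRoot (m : ℕ) (w : ℂ) :
    (negRoot m w).re = ‖negRoot m w‖ * Real.cos (w.arg / m) := by
  rw [negRoot, Complex.norm_exp, Complex.exp_re, ← Complex.ofReal_natCast, Complex.div_ofReal_im,
    Complex.neg_im, Complex.log_im, neg_div, neg_div,
    Real.cos_neg]

theorem im_negRoot (m : ℕ) (w : ℂ) :
    (negRoot m w).im = -(‖negRoot m w‖ * Real.sin (w.arg / m)) := by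
  rw [negRoot, Complex.norm_exp, Complex.exp_im, ← Complex.ofReal_natCast, Complex.div_ofReal_im,
    Complex.neg_im, Complex.log_im, neg_div, neg_div,
    Real.sin_neg, mul_neg]

theorem norm_negRoot_pow (hm : 1 ≤ m) {w : ℂ} (hw : w ≠ 0) : ‖negRoot m w‖ ^ m = ‖w‖⁻¹ := by
  conv_rhs => rw [← inv_pow_negRoot hm hw]
  rw [norm_inv, norm_pow, inv_inv]

theorem abs_arg_div_le (hm : 1 ≤ m) (w : ℂ) : |w.arg / m| ≤ |w.arg| := by
  rw [abs_div, Nat.abs_cast]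
  exact div_le_self (abs_nonneg _) (by exact_mod_cast hm)

/-- Since `|w| ≤ 2 Re w`, the cosine of `arg w` is at least `1/2`, and dividing the argument by `m`
only increases it. -/
theorem norm_negRoot_le_two_mul_re (hm : 1 ≤ m) (hA : Real.pi / 2 ≤ A) {w : ℂ}
    (hw : w ∈ closedHalfStrip A) : ‖negRoot m w‖ ≤ 2 * (negRoot m w).re := by
  have hA0 : 0 < A := lt_of_lt_of_le (by positivity) hA
  have hre : A ≤ w.re := hw.1
  have him : |w.im| ≤ Real.pi / 2 := abs_le.2 hw.2
  have hw0 := ne_zero_of_mem hA0 hw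
  have hn : 0 < ‖w‖ := norm_pos_iff.2 hw0
  have h1 : 1 / 2 ≤ Real.cos w.arg := by
    rw [Complex.cos_arg hw0, le_div_iff₀ hn]
    have := Complex.norm_le_abs_re_add_abs_im w
    rw [abs_of_nonneg (hA0.le.trans hre)] at this
    linarith
  have h2 : Real.cos w.arg ≤ Real.cos (w.arg / m) := by
    rw [← Real.cos_abs w.arg, ← Real.cos_abs (w.arg / m)]
    exact Real.cos_le_cos_of_nonneg_of_le_pi (abs_nonneg _) (Complex.abs_arg_le_pi w)
      (abs_arg_div_le hm w)
  rw [re_negRoot]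
  nlinarith [norm_nonneg (negRoot m w)]

/-- The angle of the image is at most `|arg w|` in size, whose sine is `|Im w| / |w| ≤ 2 / |w|`; and
`|w|^{-1}` is the `m`-th power of the modulus of the image. -/
theorem abs_im_negRoot_le (hm : 1 ≤ m) (hA : 0 < A) {w : ℂ} (hw : w ∈ closedHalfStrip A) :
    |(negRoot m w).im| ≤ 2 * ‖negRoot m w‖ ^ (m + 1) := by
  have hre : A ≤ w.re := hw.1
  have him : |w.im| ≤ Real.pi / 2 := abs_le.2 hw.2
  have hw0 := ne_zero_of_mem hA hw
  have harg : |w.arg| ≤ Real.pi / 2 := Complex.abs_arg_le_pi_div_two_iff.2 (hA.le.trans hre)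
  have hsin : ∀ x : ℝ, |x| ≤ Real.pi / 2 → |Real.sin x| = Real.sin |x| := by
    intro x hx
    have h0 : 0 ≤ Real.sin |x| := Real.sin_nonneg_of_nonneg_of_le_pi (abs_nonneg x)
      (by linarith [Real.pi_pos])
    rcases abs_choice x with h | h
    · rw [h] at h0 ⊢; exact abs_of_nonneg h0
    · rw [h] at h0 ⊢
      rw [Real.sin_neg] at h0 ⊢
      exact abs_of_nonpos (by linarith)
  have h1 : |Real.sin (w.arg / m)| ≤ 2 * ‖w‖⁻¹ := by
    rw [hsin _ ((abs_arg_div_le hm w).trans harg)]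
    refine (Real.sin_le_sin_of_le_of_le_pi_div_two (by linarith [abs_nonneg (w.arg / m),
      Real.pi_pos]) harg (abs_arg_div_le hm w)).trans ?_
    rw [← hsin _ harg, Complex.sin_arg, abs_div, abs_norm, div_eq_mul_inv]
    gcongr
    linarith [Real.pi_le_four]
  rw [im_negRoot, abs_neg, abs_mul, abs_norm, pow_succ, norm_negRoot_pow hm hw0]
  nlinarith [mul_le_mul_of_nonneg_left h1 (norm_nonneg (negRoot m w))]

/-- Nonnegativity of the supersolution on the domain, with `K = 4^{m+2}` coming from `(2
(2x)^{m+1})²`. -/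
theorem im_sq_le_of_mem_cusp (hm : 1 ≤ m) (hA : Real.pi / 2 ≤ A) {z : ℂ} (hz : z ∈ cusp m A) :
    z.im ^ 2 ≤ 4 ^ (m + 2) * z.re ^ (2 * m + 2) := by
  obtain ⟨w, hw, rfl⟩ := hz
  have hw' := halfStrip_subset_closedHalfStrip A hw
  have h1 := abs_im_negRoot_le hm (lt_of_lt_of_le (by positivity) hA) hw'
  have h2 := norm_negRoot_le_two_mul_re hm hA hw'
  calc (negRoot m w).im ^ 2 = |(negRoot m w).im| ^ 2 := (sq_abs _).symm
    _ ≤ (2 * (2 * (negRoot m w).re) ^ (m + 1)) ^ 2 := by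
      refine pow_le_pow_left₀ (abs_nonneg _) (h1.trans ?_) 2
      gcongr
    _ = 4 ^ (m + 2) * (negRoot m w).re ^ (2 * m + 2) := by
      rw [show (4 : ℝ) = 2 ^ 2 by norm_num, ← pow_mul]
      ring

/-- A large `A` cuts the domain close to the vertex, which makes the `x^{2m}` term in the Laplacian
of the supersolution as small as required. -/
theorem re_pow_mul_le_of_mem_cusp (hm : 1 ≤ m) (hA : 1 ≤ A) {z : ℂ} (hz : z ∈ cusp m A) :
    A * z.re ^ (2 * m) ≤ 1 := by
  obtain ⟨w, hw, rfl⟩ := hz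
  have hA0 : 0 < A := by linarith
  have hw' := halfStrip_subset_closedHalfStrip A hw
  have h1 : A ≤ ‖w‖ := le_norm_of_mem hw'
  have h2 : (negRoot m w).re ^ (2 * m) ≤ (‖w‖⁻¹) ^ 2 := by
    rw [← norm_negRoot_pow hm (ne_zero_of_mem hA0 hw'), ← pow_mul, mul_comm m 2,
      pow_mul, pow_mul, ← sq_abs]
    gcongr
    exact Complex.abs_re_le_norm _
  have h3 : ‖w‖⁻¹ ≤ 1 := inv_le_one_of_one_le₀ (hA.trans h1)
  calc A * (negRoot m w).re ^ (2 * m) ≤ ‖w‖ * (‖w‖⁻¹) ^ 2 :=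
        mul_le_mul h1 h2 ((even_two_mul m).pow_nonneg _) (norm_nonneg _)
    _ = ‖w‖⁻¹ := by
      have : ‖w‖ ≠ 0 := by linarith
      field_simp
    _ ≤ 1 := h3

/-- Near its vertex, the cusp domain contains the points below a multiple of the graph of
`x ↦ x ^ (m + 1)`. -/
theorem mem_cusp_of_abs_im_lt (hm : 1 ≤ m) (hA : 0 < A) {z : ℂ} (hre : 0 < z.re)
    (hsmall : (A + 1) * z.re ^ m ≤ 1) (him : m * |z.im| < z.re ^ (m + 1)) : z ∈ cusp m A := by
  have hm1 : (1 : ℝ) ≤ m := by exact_mod_cast hm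
  have hm0 : (m : ℂ) ≠ 0 := by exact_mod_cast (by omega : m ≠ 0)
  have hz0 : z ≠ 0 := by rintro rfl; simp at hre
  have hn : 0 < ‖z‖ := norm_pos_iff.2 hz0
  have hxn : z.re ≤ ‖z‖ := Complex.re_le_norm z
  have hxm : 0 < z.re ^ m := pow_pos hre m
  have hxm1 : z.re ^ m ≤ 1 := by nlinarith
  set w : ℂ := (z ^ m)⁻¹ with hw
  -- The point is that `m |arg z| < π`, so the logarithm of `z^{-m}` stays on the principal branch.
  have hroot : negRoot m w = z := by
    have h1 : 2 / Real.pi * |z.arg| ≤ |z.im| / ‖z‖ := by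
      have := Real.mul_abs_le_abs_sin (Complex.abs_arg_le_pi_div_two_iff.2 hre.le)
      rwa [Complex.sin_arg, abs_div, abs_norm] at this
    have h2 : m * (|z.im| / ‖z‖) < 1 := by
      rw [← mul_div_assoc, div_lt_one hn]
      refine him.trans_le (le_trans ?_ hxn)
      rw [pow_succ]
      nlinarith
    have h3 : m * |z.arg| < Real.pi := by
      have hπ := Real.pi_pos
      have h4 : |z.arg| ≤ Real.pi / 2 * (|z.im| / ‖z‖) := by
        rw [div_mul_eq_mul_div, div_le_iff₀ hπ] at h1
        linarith
      have h5 := mul_le_mul_of_nonneg_left h4 (by positivity : (0 : ℝ) ≤ m)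
      nlinarith
    have h4 : Complex.log w = -(m * Complex.log z) := by
      rw [hw, ← Complex.exp_log hz0, ← Complex.exp_nat_mul, ← Complex.exp_neg, Complex.log_exp,
        Complex.exp_log hz0]
      all_goals
        rw [Complex.neg_im, ← Complex.ofReal_natCast, Complex.im_ofReal_mul, Complex.log_im]
        have h5 : |m * z.arg| < Real.pi := by rwa [abs_mul, Nat.abs_cast]
        linarith [(abs_lt.1 h5).1, (abs_lt.1 h5).2]
    rw [negRoot, h4, neg_neg, mul_div_cancel_left₀ _ hm0, Complex.exp_log hz0]
  -- With `x = Re z`, `|(x/z)^m - 1| ≤ m |x/z - 1| = m |Im z| / |z| < x^m`. Hence `Re w > (A + 1) -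
  -- 1` and `|Im w| < 1 < π/2`.
  have hdist : ‖w - ((z.re ^ m)⁻¹ : ℝ)‖ < 1 := by
    have hxc : (z.re : ℂ) ≠ 0 := by exact_mod_cast hre.ne'
    have e1 : w - ((z.re ^ m)⁻¹ : ℝ) = ((z.re ^ m)⁻¹ : ℝ) * ((z.re / z) ^ m - 1 ^ m) := by
      rw [hw, div_pow]
      push_cast
      field_simp
      ring
    have e2 : (z.re : ℂ) / z - 1 = -(z.im * Complex.I) / z := by
      rw [div_sub_one hz0]
      congr 1
      linear_combination Complex.re_add_im z
    have h1 : ‖(z.re : ℂ) / z‖ ≤ 1 := by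
      rw [norm_div, Complex.norm_real, Real.norm_of_nonneg hre.le]
      exact div_le_one_of_le₀ hxn hn.le
    have h2 := norm_pow_sub_pow_le h1 (b := 1) (by simp) m
    rw [e2, norm_div, norm_neg, norm_mul, Complex.norm_I, mul_one, Complex.norm_real,
      Real.norm_eq_abs] at h2
    rw [e1, norm_mul, Complex.norm_real, Real.norm_of_nonneg (by positivity),
      inv_mul_lt_iff₀ hxm, mul_one]
    refine h2.trans_lt ?_
    rw [← mul_div_assoc, div_lt_iff₀ hn]
    rw [pow_succ] at him
    nlinarith
  have hre' : |w.re - (z.re ^ m)⁻¹| < 1 := by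
    have := (Complex.abs_re_le_norm (w - ((z.re ^ m)⁻¹ : ℝ))).trans_lt hdist
    rwa [Complex.sub_re, Complex.ofReal_re] at this
  have him' : |w.im| < 1 := by
    have := (Complex.abs_im_le_norm (w - ((z.re ^ m)⁻¹ : ℝ))).trans_lt hdist
    rwa [Complex.sub_im, Complex.ofReal_im, sub_zero] at this
  refine ⟨w, ⟨?_, ?_⟩, hroot⟩
  · have h1 : A + 1 ≤ (z.re ^ m)⁻¹ := by
      rwa [← one_div, le_div_iff₀ hxm]
    change A < w.re
    linarith [(abs_lt.1 hre').1]
  · have h1 : |w.im| < Real.pi / 2 := by linarith [Real.pi_gt_three]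
    exact abs_lt.1 h1

theorem volume_rectangle (a b c d : ℝ) :
    volume {y : EuclideanSpace ℝ (Fin 2) | y 0 ∈ Ioo a b ∧ y 1 ∈ Ioo c d} =
      ENNReal.ofReal (b - a) * ENNReal.ofReal (d - c) := by
  have h : {y : EuclideanSpace ℝ (Fin 2) | y 0 ∈ Ioo a b ∧ y 1 ∈ Ioo c d} =
      WithLp.ofLp ⁻¹' (univ.pi fun i : Fin 2 => Ioo (![a, c] i) (![b, d] i)) := by
    ext y
    simp [Set.mem_pi, Fin.forall_fin_two]
  rw [h, (PiLp.volume_preserving_ofLp (Fin 2)).measure_preimage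
    (MeasurableSet.univ_pi fun i => measurableSet_Ioo).nullMeasurableSet, Real.volume_pi_Ioo]
  simp

theorem le_betaIntegral {n : ℕ} {Ω S : Set (EuclideanSpace ℝ (Fin n))}
    {u : EuclideanSpace ℝ (Fin n) → ℝ} {β t : ℝ} (hβ : 0 ≤ β) (ht : 0 < t) (hS : S ⊆ Ω)
    (hSm : MeasurableSet S) (h : ∀ᵐ y ∂volume.restrict Ω, y ∈ S → u y ≤ t) :
    ENNReal.ofReal (t ^ (-β)) * volume S ≤ betaIntegral Ω u β := by
  rw [← setLIntegral_const]
  refine le_trans ?_ (lintegral_mono_set hS)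
  refine lintegral_mono_ae ?_
  filter_upwards [ae_restrict_of_ae_restrict_of_subset hS h, ae_restrict_mem hSm] with y h1 h2
  rw [← ENNReal.ofReal_rpow_of_pos ht, ENNReal.rpow_neg, ENNReal.rpow_neg, ENNReal.inv_le_inv]
  exact ENNReal.rpow_le_rpow (ENNReal.ofReal_le_ofReal (h1 h2)) hβ

/-- For small `x` one box `(x/2, x) × (-h, h)` lies in the domain and there `u ≤ 4^{m+2} x^{2m+2}`,
so the integral is at least `c x^e`; the hypothesis on `m` says exactly that `e = 1 - (m+1)(2β-1) <
0`. -/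
theorem betaIntegral_image_cusp (hm : 1 ≤ m) (hA : Real.pi / 2 ≤ A)
    (hA' : 4 ^ (m + 2) * ((2 * m + 2) * (2 * m + 1)) ≤ A) {β : ℝ} (hβ : 1 / 2 < β)
    (hmβ : 1 < (m + 1) * (2 * β - 1)) {u : EuclideanSpace ℝ (Fin 2) → ℝ}
    (hu : IsSolution (planeIso '' cusp m A) u) :
    betaIntegral (planeIso '' cusp m A) u β = ⊤ := by
  have hA1 : 1 ≤ A := by linarith [Real.pi_gt_three]
  have hA0 : 0 < A := by linarith
  have hm0 : (0 : ℝ) < m := by exact_mod_cast hm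
  have hsuper := ae_le_of_pow_sub_sq (K := 4 ^ (m + 2)) (k := m)
    (isBoundedDomain_image_cusp hm hA1) hu
    (by
      rintro _ ⟨z, hz, rfl⟩
      rw [planeIso_apply_zero, planeIso_apply_one]
      exact im_sq_le_of_mem_cusp hm hA hz)
    (by
      rintro _ ⟨z, hz, rfl⟩
      rw [planeIso_apply_zero, ← mul_assoc (2 * (m : ℝ) + 2), ← mul_assoc]
      exact (mul_le_mul_of_nonneg_right hA' ((even_two_mul m).pow_nonneg _)).trans
        (re_pow_mul_le_of_mem_cusp hm hA1 hz))
  set e : ℝ := (m + 2) - (2 * m + 2) * β with he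
  set c : ℝ := (4 ^ (m + 2) : ℝ) ^ (-β) * ((1 / 2) * (2 * ((1 / 2) ^ (m + 1) / m))) with hc
  have hlim : Tendsto (fun x : ℝ => ENNReal.ofReal (c * x ^ e)) (𝓝[>] 0) (𝓝 ⊤) :=
    ENNReal.tendsto_ofReal_atTop.comp
      ((tendsto_rpow_neg_nhdsGT_zero (by rw [he]; linarith)).const_mul_atTop (by positivity))
  refine top_le_iff.1 (le_of_tendsto hlim ?_)
  have hev : ∀ᶠ x : ℝ in 𝓝[>] 0, (A + 1) * x ^ m < 1 := by
    have : Tendsto (fun x : ℝ => (A + 1) * x ^ m) (𝓝 0) (𝓝 ((A + 1) * 0 ^ m)) :=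
      ((continuous_pow m).tendsto 0).const_mul _
    rw [zero_pow (by omega), mul_zero] at this
    exact nhdsWithin_le_nhds (this.eventually_lt_const one_pos)
  filter_upwards [hev, self_mem_nhdsWithin] with x hx hx0
  replace hx0 : 0 < x := hx0
  -- Half-height evaluated at the thin end `x/2`, so that the whole box satisfies the membership
  -- criterion of the cusp.
  set h : ℝ := (x / 2) ^ (m + 1) / m with hh
  have hmain := le_betaIntegral (Ω := planeIso '' cusp m A) (u := u) (β := β)
    (S := {y | y 0 ∈ Ioo (x / 2) x ∧ y 1 ∈ Ioo (-h) h}) (t := 4 ^ (m + 2) * x ^ (2 * m + 2))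
    (by linarith) (by positivity) ?_ ?_ ?_
  · rw [volume_rectangle, ← ENNReal.ofReal_mul (by linarith),
      ← ENNReal.ofReal_mul (by positivity)] at hmain
    refine le_of_eq_of_le (congrArg ENNReal.ofReal ?_) hmain
    rw [Real.mul_rpow (by positivity) (by positivity), ← Real.rpow_natCast x, ← Real.rpow_mul hx0.le,
      hc, he, hh]
    have e1 : x ^ ((m : ℝ) + 2 - (2 * m + 2) * β) =
        x ^ (((2 * m + 2 : ℕ) : ℝ) * -β) * x ^ (m + 2) := by
      rw [← Real.rpow_natCast x (m + 2), ← Real.rpow_add hx0]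
      congr 1
      push_cast
      ring
    rw [e1, div_pow, div_pow]
    ring
  · intro y hy
    refine ⟨planeIso.symm y, mem_cusp_of_abs_im_lt hm hA0 ?_ ?_ ?_, by simp⟩
    all_goals
      rw [← planeIso_apply_zero, LinearIsometryEquiv.apply_symm_apply]
      try rw [← planeIso_apply_one, LinearIsometryEquiv.apply_symm_apply]
    · linarith [hy.1.1]
    · refine le_trans ?_ hx.le
      have h1 : y 0 ≤ x := hy.1.2.le
      have h2 : 0 ≤ y 0 := by linarith [hy.1.1]
      gcongr
    · have h1 : |y 1| < h := abs_lt.2 hy.2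
      rw [hh, lt_div_iff₀ hm0, mul_comm] at h1
      refine h1.trans_le ?_
      have h2 : x / 2 ≤ y 0 := hy.1.1.le
      gcongr
  · have hc : ∀ i : Fin 2, Continuous fun y : EuclideanSpace ℝ (Fin 2) => y i := fun i => by fun_prop
    exact ((isOpen_Ioo.preimage (hc 0)).inter (isOpen_Ioo.preimage (hc 1))).measurableSet
  · filter_upwards [hsuper] with y hy hyS
    have h1 : y 0 ≤ x := hyS.1.2.le
    have h2 : 0 ≤ y 0 := by linarith [hyS.1.1]
    have h3 : (4 : ℝ) ^ (m + 2) * y 0 ^ (2 * m + 2) ≤ 4 ^ (m + 2) * x ^ (2 * m + 2) := by gcongr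
    nlinarith [sq_nonneg (y 1)]

theorem exists_domain_betaIntegral_eq_top {β : ℝ} (hβ : 1 / 2 < β) :
    ∃ Ω : Set (EuclideanSpace ℝ (Fin 2)), IsBoundedDomain Ω ∧ IsDirichletRegular Ω ∧
      IsAhlforsRegular (frontier Ω) ∧
      ∀ u : EuclideanSpace ℝ (Fin 2) → ℝ, IsSolution Ω u → betaIntegral Ω u β = ⊤ := by
  obtain ⟨m, hm⟩ := exists_nat_gt (1 / (2 * β - 1))
  have hβ' : 0 < 2 * β - 1 := by linarith
  have hm1 : 1 ≤ m := by
    have : (0 : ℝ) < m := lt_trans (by positivity) hm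
    exact_mod_cast this
  rw [div_lt_iff₀ hβ'] at hm
  set A : ℝ := 4 ^ (m + 2) * ((2 * m + 2) * (2 * m + 1)) with hA
  have hA2 : 2 ≤ A := by
    have h1 : (1 : ℝ) ≤ 4 ^ (m + 2) := one_le_pow₀ (by norm_num)
    have h2 : (0 : ℝ) ≤ m := by positivity
    nlinarith [mul_nonneg h2 h2]
  have hAπ : Real.pi / 2 ≤ A := by linarith [Real.pi_le_four]
  have hA1 : 1 ≤ A := by linarith
  exact ⟨planeIso '' cusp m A, isBoundedDomain_image_cusp hm1 hA1,
    isDirichletRegular_image_cusp hm1 hA1, isAhlforsRegular_frontier_image_cusp hm1 hAπ,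
    fun u hu => betaIntegral_image_cusp hm1 hAπ le_rfl hβ (by linarith) hu⟩

end

end SaintVenant

theorem proposition2p10 :
    -- (i)
    (∀ n : ℕ, 1 ≤ n → ∀ Ω : Set (EuclideanSpace ℝ (Fin n)), SaintVenant.IsBoundedDomain Ω →
      ∀ γ : ℝ, γ < n → SaintVenant.upperMinkowskiContent Ω γ < ⊤ →
      ∀ β : ℝ, 0 < β → β < (n - γ) / 2 →
      ∀ u : EuclideanSpace ℝ (Fin n) → ℝ, SaintVenant.IsSolution Ω u →
        SaintVenant.betaIntegral Ω u β < ⊤) ∧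
    -- (ii), finiteness
    (∀ n : ℕ, 1 ≤ n → ∀ Ω : Set (EuclideanSpace ℝ (Fin n)), SaintVenant.IsBoundedDomain Ω →
      SaintVenant.IsAhlforsRegular (frontier Ω) →
      ∀ β : ℝ, 0 < β → β < 1 / 2 →
      ∀ u : EuclideanSpace ℝ (Fin n) → ℝ, SaintVenant.IsSolution Ω u →
        SaintVenant.betaIntegral Ω u β < ⊤) ∧
    -- (ii), the quantitative estimate
    (∀ n : ℕ, 1 ≤ n → ∀ β : ℝ, 0 < β → β < 1 / 2 →
      ∀ C₀ C₁ R : ℝ, 0 < C₀ → 0 < C₁ → 0 < R →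
      ∃ C : ℝ≥0, ∀ Ω : Set (EuclideanSpace ℝ (Fin n)), SaintVenant.IsBoundedDomain Ω →
        SaintVenant.IsAhlforsRegularWith (frontier Ω) C₀ C₁ (R * Metric.diam Ω) →
        (∀ u : EuclideanSpace ℝ (Fin n) → ℝ, SaintVenant.IsSolution Ω u →
          SaintVenant.betaIntegral Ω u β ≤
            C * (volume Ω ^ (1 - 2 * β) *
              SaintVenant.surfaceMeasure n (frontier Ω) ^ (2 * β))) ∧
        volume Ω ^ (1 - 2 * β) * SaintVenant.surfaceMeasure n (frontier Ω) ^ (2 * β) ≤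
          C * ENNReal.ofReal (Metric.diam Ω) ^ (n - 2 * β)) ∧
    -- (iii)
    (∀ β : ℝ, 1 / 2 < β → β < 1 →
      ∃ Ω : Set (EuclideanSpace ℝ (Fin 2)), SaintVenant.IsBoundedDomain Ω ∧
        SaintVenant.IsDirichletRegular Ω ∧
        SaintVenant.IsAhlforsRegular (frontier Ω) ∧
        ∀ u : EuclideanSpace ℝ (Fin 2) → ℝ, SaintVenant.IsSolution Ω u →
          SaintVenant.betaIntegral Ω u β = ⊤) := by
  refine ⟨fun n hn Ω hΩ γ _ hM β hβ0 hβ u hu =>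
      SaintVenant.betaIntegral_lt_top_of_minkowski hn hΩ hM hβ0 hβ hu,
    fun n hn Ω hΩ hreg β hβ0 hβ u hu =>
      SaintVenant.betaIntegral_lt_top_of_ahlforsRegular hn hΩ hreg hβ0 hβ hu,
    fun n hn β hβ0 hβ C₀ C₁ R hC₀ hC₁ hR =>
      SaintVenant.exists_betaIntegral_le hn hβ0 hβ hC₀ hC₁ hR,
    fun β hβ _ => SaintVenant.exists_domain_betaIntegral_eq_top hβ⟩
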